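/- A relation $r$ over attributes $A_1,\dots,A_k$ is a finite set of tuples of $k$ numbers; since relations are given to a machine, the numbers are rational. For attributes $G$ and $A$ and an aggregate function $\alpha$, which maps bags of numbers to numbers, $r$ satisfies the aggregate order dependency (AOD) $G\nearrow\alpha(A)$ if for all values $g\le g'$ that occur in column $G$ of $r$ we have $\alpha_r(A\mid G=g)\le\alpha_r(A\mid G=g')$, where $\alpha_r(A\mid G=g)$ is $\alpha$ applied to the bag of the $A$-values of the tuples $t\in r$ with $t[G]=g$. A C-repair of $r$ is a subset $r'\subseteq r$ that satisfies the AOD and has maximum size among all such subsets. The median of a bag is its middle element, or the mean of its two middle elements if its size is even; $\mathsf{count}$ counts with multiplicity and $\mathsf{countd}$ counts distinct values. **Theorem.** 1. For each $\alpha\in\{\mathsf{max},\mathsf{min},\mathsf{count},\mathsf{countd},\mathsf{median}\}$ there is an algorithm that, given $k$, attributes $G$ and $A$ and a relation $r$ (numbers written in binary, as numerator and denominator), outputs a C-repair of $r$ for $G\nearrow\alpha(A)$ in time polynomial in the length of the input. 2. For each $\alpha\in\{\mathsf{sum},\mathsf{avg}\}$ there is an algorithm that, given $k$, $G$, $A$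 and a relation $r$ whose values in column $A$ are integers, outputs a C-repair of $r$ for $G\nearrow\alpha(A)$ in pseudo-polynomial time, i.e. in time polynomial in the length that the input has when the integers in column $A$ are written in unary. Time is the logarithmic cost of a random access machine: every instruction costs one plus the bit lengths of the integers that it handles. -/

import Mathlib

namespace AODRepair

/-! ### Aggregate functions on bags of numbers -/

/-- The aggregate functions. -/
inductive Agg where
  | max | min | count | countd | median | sum | avg

/-- The value of an aggregate function on a bag.  The median of a bag of even size is the mean of
the two middle elements (with repetitions).  Only values on nonempty bags matter below. -/
def Agg.eval : Agg → Multiset ℚ → ℚ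
  | .max, V => WithBot.unbotD 0 V.toFinset.max
  | .min, V => WithTop.untopD 0 V.toFinset.min
  | .count, V => (V.card : ℚ)
  | .countd, V => (V.toFinset.card : ℚ)
  | .median, V =>
      let s := V.sort (· ≤ ·)
      (s.getD ((s.length - 1) / 2) 0 + s.getD (s.length / 2) 0) / 2
  | .sum, V => V.sum
  | .avg, V => V.sum / (V.card : ℚ)

/-! ### Relations, aggregate order dependencies, C-repairs -/

/-- A tuple over a schema with `k` numeric attributes.  Numbers are rational, so that they can be
given to a machine. -/
abbrev Tuple (k : ℕ) : Type := Fin k → ℚ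

/-- A relation: a finite set of tuples. -/
abbrev Relation (k : ℕ) : Type := Finset (Tuple k)

/-- `α_r(A | G = g)`: the value of `α` on the bag of `A`-values of the tuples `t ∈ r` with
`t[G] = g`. -/
def groupAgg {k : ℕ} (α : Agg) (G A : Fin k) (r : Relation k) (g : ℚ) : ℚ :=
  α.eval ((r.filter fun t => t G = g).val.map fun t => t A)

/-- `r` satisfies the aggregate order dependency `G ↗ α(A)`. -/
def Satisfies {k : ℕ} (α : Agg) (G A : Fin k) (r : Relation k) : Prop :=
  ∀ g ∈ r.image (fun t => t G), ∀ g' ∈ r.image (fun t => t G),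
    g ≤ g' → groupAgg α G A r g ≤ groupAgg α G A r g'

/-- `r'` is a monotonic subset of `r` for `G ↗ α(A)`. -/
def IsMonotonicSubset {k : ℕ} (α : Agg) (G A : Fin k) (r r' : Relation k) : Prop :=
  r' ⊆ r ∧ Satisfies α G A r'

/-- `r'` is a C-repair of `r` for `G ↗ α(A)`: a monotonic subset of maximum size. -/
def IsCRepair {k : ℕ} (α : Agg) (G A : Fin k) (r r' : Relation k) : Prop :=
  IsMonotonicSubset α G A r r' ∧
    ∀ r'' : Relation k, IsMonotonicSubset α G A r r'' → r''.card ≤ r'.card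

/-! ### The machine model: a random access machine with logarithmic cost

A program uses finitely many integer registers and finitely many integer arrays (those that occur
in its text); arrays are addressed indirectly, through a register.  Every instruction costs one plus
the bit lengths of the integers (operands, addresses, tested values) that it handles. -/

/-- The bit length of an integer, sign included. -/
def bitLen (z : ℤ) : ℕ := z.natAbs.size + 1

/-- Arithmetic operations; `div` is integer division. -/
inductive Op where
  | add | sub | mul | div

def Op.eval : Op → ℤ → ℤ → ℤ
  | .add, x, y => x + y
  | .sub, x, y => x - y
  | .mul, x, y => x * y
  | .div, x, y => x / y

/-- Programs.  Natural numbers are names of registers and arrays. -/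
inductive Program where
  /-- do nothing -/
  | skip
  /-- `v_d := c` -/
  | const (d : ℕ) (c : ℤ)
  /-- `v_d := v_x` -/
  | copy (d x : ℕ)
  /-- `v_d := v_x op v_y` -/
  | arith (op : Op) (d x y : ℕ)
  /-- `v_d := M_m[v_i]` -/
  | load (d m i : ℕ)
  /-- `M_m[v_i] := v_x` -/
  | store (m i x : ℕ)
  /-- `p ; q` -/
  | seq (p q : Program)
  /-- `if v_x > 0 then p else q` -/
  | branch (x : ℕ) (p q : Program)
  /-- `while v_x > 0 do p` -/
  | loop (x : ℕ) (p : Program)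

/-- Machine states: the contents of the registers `v_0, v_1, …` and of the arrays
`M_0, M_1, …`. -/
structure State where
  reg : ℕ → ℤ
  mem : ℕ → ℤ → ℤ

def State.setReg (s : State) (d : ℕ) (z : ℤ) : State :=
  { s with reg := Function.update s.reg d z }

def State.setMem (s : State) (m : ℕ) (i z : ℤ) : State :=
  { s with mem := Function.update s.mem m (Function.update (s.mem m) i z) }

/-- `Exec p s s' c`: started in state `s`, the program `p` halts in state `s'`, and the run has
cost `c`. -/
inductive Exec : Program → State → State → ℕ → Prop where
  | skip (s : State) : Exec .skip s s 1
  | const (s : State) (d : ℕ) (z : ℤ) :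
      Exec (.const d z) s (s.setReg d z) (1 + bitLen z)
  | copy (s : State) (d x : ℕ) :
      Exec (.copy d x) s (s.setReg d (s.reg x)) (1 + bitLen (s.reg x))
  | arith (s : State) (op : Op) (d x y : ℕ) :
      Exec (.arith op d x y) s (s.setReg d (op.eval (s.reg x) (s.reg y)))
        (1 + bitLen (s.reg x) + bitLen (s.reg y))
  | load (s : State) (d m i : ℕ) :
      Exec (.load d m i) s (s.setReg d (s.mem m (s.reg i)))
        (1 + bitLen (s.reg i) + bitLen (s.mem m (s.reg i)))
  | store (s : State) (m i x : ℕ) :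
      Exec (.store m i x) s (s.setMem m (s.reg i) (s.reg x))
        (1 + bitLen (s.reg i) + bitLen (s.reg x))
  | seq {p q : Program} {s s₁ s₂ : State} {c₁ c₂ : ℕ}
      (hp : Exec p s s₁ c₁) (hq : Exec q s₁ s₂ c₂) :
      Exec (.seq p q) s s₂ (c₁ + c₂)
  | branch_pos {x : ℕ} {p q : Program} {s s' : State} {c : ℕ}
      (hx : 0 < s.reg x) (hp : Exec p s s' c) :
      Exec (.branch x p q) s s' (1 + bitLen (s.reg x) + c)
  | branch_neg {x : ℕ} {p q : Program} {s s' : State} {c : ℕ}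
      (hx : ¬ 0 < s.reg x) (hq : Exec q s s' c) :
      Exec (.branch x p q) s s' (1 + bitLen (s.reg x) + c)
  | loop_exit {x : ℕ} {p : Program} {s : State} (hx : ¬ 0 < s.reg x) :
      Exec (.loop x p) s s (1 + bitLen (s.reg x))
  | loop_iter {x : ℕ} {p : Program} {s s₁ s₂ : State} {c₁ c₂ : ℕ}
      (hx : 0 < s.reg x) (hp : Exec p s s₁ c₁) (hl : Exec (.loop x p) s₁ s₂ c₂) :
      Exec (.loop x p) s s₂ (1 + bitLen (s.reg x) + c₁ + c₂)

/-- The initial state on input `w`: the word `w` is in array `M_0` (from index `0` on), its length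
is in register `v_0`, and everything else is `0`. -/
def initState (w : List ℤ) : State where
  reg := fun i => if i = 0 then (w.length : ℤ) else 0
  mem := fun m i => if m = 0 ∧ 0 ≤ i then w.getD i.toNat 0 else 0

/-- The output word of a halting state: it is in array `M_1`, and its length is in register
`v_1`. -/
def HasOutput (s : State) (w : List ℤ) : Prop :=
  s.reg 1 = (w.length : ℤ) ∧ ∀ i : ℕ, i < w.length → s.mem 1 (i : ℤ) = w.getD i 0

/-- Search problems solvable in polynomial time.  Instances `x ∈ D` are given to the machine as the
word `encode x`, and `Correct x w` says that `w` is an acceptable answer; there are one program and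
one polynomial such that, on every `x ∈ D`, the program halts with an acceptable answer and its
cost is at most the polynomial at `size x`. -/
def SolvableInPolyTime {I : Type} (D : Set I) (encode : I → List ℤ) (size : I → ℕ)
    (Correct : I → List ℤ → Prop) : Prop :=
  ∃ (p : Program) (P : Polynomial ℕ), ∀ x ∈ D, ∃ (s : State) (w : List ℤ) (c : ℕ),
    Exec p (initState (encode x)) s c ∧ HasOutput s w ∧ Correct x w ∧ c ≤ P.eval (size x)

/-! ### The repair problem as a search problem -/

/-- An input of the repair problem: the number of attributes, the grouping and the aggregate
attribute, and the tuples of the relation, listed in an arbitrary order without repetition. -/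
structure Instance where
  k : ℕ
  G : Fin k
  A : Fin k
  tuples : List (Tuple k)
  nodup : tuples.Nodup

/-- The relation of an input. -/
def Instance.relation (x : Instance) : Relation x.k := x.tuples.toFinset

/-- A number is written as numerator and denominator (in lowest terms). -/
def encodeRat (q : ℚ) : List ℤ := [q.num, (q.den : ℤ)]

/-- A tuple is written entry by entry. -/
def encodeTuple {k : ℕ} (t : Tuple k) : List ℤ := (List.ofFn t).flatMap encodeRat

/-- A listed relation is written as arity, number of tuples, and the tuples. -/
def encodeTuples {k : ℕ} (l : List (Tuple k)) : List ℤ :=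
  (k : ℤ) :: (l.length : ℤ) :: l.flatMap encodeTuple

/-- The word given to the machine. -/
def Instance.encode (x : Instance) : List ℤ :=
  ((x.G : ℕ) : ℤ) :: ((x.A : ℕ) : ℤ) :: encodeTuples x.tuples

/-- The length of the input when all integers are written in binary. -/
def Instance.binarySize (x : Instance) : ℕ := (x.encode.map bitLen).sum

/-- The length of the input when the (integer) entries of column `A` are written in unary, and all
other integers in binary. -/
def Instance.unarySize (x : Instance) : ℕ :=
  bitLen ((x.G : ℕ) : ℤ) + bitLen ((x.A : ℕ) : ℤ) + bitLen (x.k : ℤ) +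
    bitLen (x.tuples.length : ℤ) +
    (x.tuples.map fun t => ∑ j : Fin x.k,
      if j = x.A then (t j).num.natAbs + 1
      else bitLen (t j).num + bitLen ((t j).den : ℤ)).sum

/-- The values in column `A` are integers. -/
def Instance.IntegerColumn (x : Instance) : Prop :=
  ∀ t ∈ x.tuples, ∃ z : ℤ, t x.A = (z : ℚ)

/-- The word `w` represents (lists the tuples of) a C-repair of the input relation. -/
def Instance.IsAnswer (α : Agg) (x : Instance) (w : List ℤ) : Prop :=
  ∃ l : List (Tuple x.k), l.Nodup ∧ w = encodeTuples l ∧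
    IsCRepair α x.G x.A x.relation l.toFinset

end AODRepair

/-! Sort the tuples by `G`, then by `A`, then by their place in the input. Groups become intervals
of positions, and a subrelation is a set of positions. Scan the positions from left to right and
decide for each whether it is taken. By transitivity of `≤`, it is enough to compare every group
that keeps some tuple with the preceding group of this kind, so the scan has to remember only data
about two groups.

The aggregate of the taken part of a group is determined by a few additive counters once a little
has been guessed. For `max` and `min` one guesses the position of the extreme value and counts what
lies on the right side of it. For `median` one guesses the two middle positions and counts the taken
positions before them. For `sum` and `avg` one adds up values shifted to be nonnegative. For
`countd` one may take all tuples with equal group and value together, since this keeps the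
aggregates and does not decrease the size; then it suffices to count the first tuple of each such
class. `Scheme.Valid` isolates what is needed of such a description, and the lemmas
`Scheme.valid_max` to `Scheme.valid_countd` verify it.

The scan is then a nondeterministic automaton whose states are thirteen numbers below `D = (2n +
2)(W + 1)`. Here `W` is zero for the first five aggregates and the sum of the absolute values in
column `A` for `sum` and `avg`; this is the only place where unary length is needed. Accepting runs
yield monotonic sets (`Scheme.Step.mono`), and monotonic sets that respect the classes yield runs
(`Scheme.step_trace`). Hence a C-repair is a heaviest path in a layered graph with `n + 1` layers of
`D ^ 13` states. Such a path is found by dynamic programming and backtracking (`isPath_back`);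
`Scheme.taken_spec` puts this together.

For the running time, programs are not analysed one by one. Integer expressions with sums over all
numbers below a parameter `N` are compiled to the machine, with polynomial bounds on digits and cost
(`Term.exec_compile`). An array whose entries are given by one expression in terms of earlier
entries can be filled in polynomial time (`exec_tableProg`). Sorting, the dynamic program, the
backtracking and the output are four such arrays, and `Exec.repairProgram` runs them in sequence. -/

namespace AODRepair

/-! ### An expression language with bounded sums, compiled to the machine -/

/-! ### Digit counts under arithmetic operations. -/

/-- `z` has at most `b` binary digits. -/
def Fits (b : ℕ) (z : ℤ) : Prop := z.natAbs < 2 ^ b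

theorem Fits.bitLen_le {b : ℕ} {z : ℤ} (h : Fits b z) : bitLen z ≤ b + 1 :=
  Nat.succ_le_succ (Nat.size_le.2 h)

theorem fits_of_bitLen_le {b : ℕ} {z : ℤ} (h : bitLen z ≤ b) : Fits b z :=
  Nat.size_le.1 ((Nat.le_succ _).trans h)

theorem Fits.mono {b c : ℕ} {z : ℤ} (h : Fits b z) (hbc : b ≤ c) : Fits c z :=
  lt_of_lt_of_le h (Nat.pow_le_pow_right (by norm_num) hbc)

theorem fits_natCast {b n : ℕ} (h : n ≤ b) : Fits b (n : ℤ) := by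
  have : b < 2 ^ b := Nat.lt_two_pow_self
  simp only [Fits, Int.natAbs_natCast]; omega

theorem fits_zero (b : ℕ) : Fits b 0 := fits_natCast (n := 0) (Nat.zero_le _)

theorem Fits.add {b c : ℕ} {y z : ℤ} (hy : Fits b y) (hz : Fits c z) :
    Fits (b + c + 1) (y + z) := by
  have h1 : 2 ^ b ≤ 2 ^ (b + c) := Nat.pow_le_pow_right (by norm_num) (by omega)
  have h2 : 2 ^ c ≤ 2 ^ (b + c) := Nat.pow_le_pow_right (by norm_num) (by omega)
  simp only [Fits, pow_succ] at *
  omega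

theorem Fits.neg {b : ℕ} {z : ℤ} (h : Fits b z) : Fits b (-z) := by
  simpa [Fits] using h

theorem Fits.mul {b c : ℕ} {y z : ℤ} (hy : Fits b y) (hz : Fits c z) : Fits (b + c) (y * z) := by
  simp only [Fits, Int.natAbs_mul, pow_add] at *
  exact Nat.mul_lt_mul'' hy hz

theorem Fits.ediv {b : ℕ} {y z : ℤ} (hy : Fits b y) : Fits (b + 1) (y / z) := by
  have h : (y / z).natAbs ≤ y.natAbs + 1 := by
    rcases lt_trichotomy z 0 with hz | hz | hz
    · have := Int.natAbs_ediv_le_natAbs y z; omega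
    · subst hz; simp
    · have := Int.natAbs_ediv_le_natAbs y z; omega
  have : 0 < 2 ^ b := by positivity
  simp only [Fits, pow_succ] at *
  omega

theorem Fits.op {b c : ℕ} {y z : ℤ} (o : Op) (hy : Fits b y) (hz : Fits c z) :
    Fits (b + c + 1) (o.eval y z) := by
  cases o
  · exact hy.add hz
  · simpa only [Op.eval, sub_eq_add_neg] using hy.add hz.neg
  · exact (hy.mul hz).mono (by omega)
  · exact hy.ediv.mono (by omega)

/-- Since `n < 2 ^ n`, adding up `n` terms costs at most `n` further digits. This is crude, but `n`
will be polynomial in the input length. -/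
theorem fits_sum {b n : ℕ} {f : ℕ → ℤ} (h : ∀ i < n, Fits b (f i)) :
    Fits (b + n) (∑ i ∈ Finset.range n, f i) := by
  have h1 : (∑ i ∈ Finset.range n, f i).natAbs ≤ n * 2 ^ b - n := by
    induction n with
    | zero => simp
    | succ n ih =>
      rw [Finset.sum_range_succ]
      have h2 := ih fun i hi => h i (by omega)
      have h3 := h n (by omega)
      have h4 : n ≤ n * 2 ^ b := Nat.le_mul_of_pos_right _ (by positivity)
      simp only [Fits] at h3
      have h5 := Int.natAbs_add_le (∑ i ∈ Finset.range n, f i) (f n)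
      rw [Nat.succ_mul]
      omega
  have h2 : n * 2 ^ b < 2 ^ (b + n) := by
    rw [pow_add, mul_comm]
    exact Nat.mul_lt_mul_of_pos_left Nat.lt_two_pow_self (by positivity)
  exact lt_of_le_of_lt (h1.trans (Nat.sub_le _ _)) h2

/-! ### Expressions, their values, and polynomial bounds for digits and cost. -/

/-- Integer expressions.  `bound` is a global parameter, `pos e` is `1` if `e > 0` and `0`
otherwise, and `sum x e` sums `e` over all values of the variable `x` below the parameter. -/
inductive Term where
  | lit (z : ℤ)
  | bound
  | var (x : ℕ)
  | arr (m : ℕ) (i : Term)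
  | bin (o : Op) (e f : Term)
  | pos (e : Term)
  | sum (x : ℕ) (e : Term)

def Term.eval (N : ℕ) (M : ℕ → ℤ → ℤ) : Term → (ℕ → ℤ) → ℤ
  | .lit z, _ => z
  | .bound, _ => N
  | .var x, ρ => ρ x
  | .arr m i, ρ => M m (i.eval N M ρ)
  | .bin o e f, ρ => o.eval (e.eval N M ρ) (f.eval N M ρ)
  | .pos e, ρ => if 0 < e.eval N M ρ then 1 else 0
  | .sum x e, ρ => ∑ v ∈ Finset.range N, e.eval N M (Function.update ρ x v)

open Polynomial in
/-- A bound for the number of digits of the values of an expression. -/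
noncomputable def Term.bits : Term → ℕ[X]
  | .lit z => (bitLen z : ℕ[X])
  | .bound => X
  | .var _ => X
  | .arr _ _ => X
  | .bin _ e f => e.bits + f.bits + 1
  | .pos _ => 1
  | .sum _ e => e.bits + X

open Polynomial in
/-- A bound for the cost of evaluating an expression. -/
noncomputable def Term.cost : Term → ℕ[X]
  | .lit z => 1 + (bitLen z : ℕ[X])
  | .bound => X + 2
  | .var _ => X + 2
  | .arr _ i => i.cost + i.bits + X + 3
  | .bin _ e f => e.cost + f.cost + e.bits + f.bits + 3
  | .pos e => e.cost + e.bits + 5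
  | .sum _ e => 3 * X + 10 + X * (4 * X + 20 + e.cost + 2 * e.bits)

theorem Term.fits_eval {N B : ℕ} {M : ℕ → ℤ → ℤ} (hN : N ≤ B) (hM : ∀ m i, Fits B (M m i))
    (e : Term) : ∀ ρ : ℕ → ℤ, (∀ x, Fits B (ρ x)) → Fits (e.bits.eval B) (e.eval N M ρ) := by
  induction e with
  | lit z => intro ρ _; simpa [Term.bits, Term.eval] using fits_of_bitLen_le le_rfl
  | bound => intro ρ _; simpa [Term.bits, Term.eval] using fits_natCast hN
  | var x => intro ρ h; simpa [Term.bits, Term.eval] using h x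
  | arr m i _ => intro ρ h; simpa [Term.bits, Term.eval] using hM _ _
  | bin o e f ihe ihf =>
    intro ρ h; simpa [Term.bits, Term.eval] using Fits.op o (ihe ρ h) (ihf ρ h)
  | pos e _ =>
    intro ρ _
    simp only [Term.bits, Term.eval, Polynomial.eval_one]
    split_ifs
    · exact fits_natCast (n := 1) le_rfl
    · exact fits_zero _
  | sum x e ih =>
    intro ρ h
    simp only [Term.bits, Term.eval, Polynomial.eval_add, Polynomial.eval_X]
    refine (fits_sum fun v hv => ih _ fun y => ?_).mono (Nat.add_le_add_left hN _)
    rcases eq_or_ne y x with rfl | hy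
    · simpa using fits_natCast (n := v) (by omega)
    · simpa [hy] using h y

/-! ### Compilation of expressions. -/

/-- The registers for intermediate results. -/
def tmp (d : ℕ) : ℕ := 2 * d + 1

/-- The registers for the variables of expressions. -/
def slot (x : ℕ) : ℕ := 2 * x + 4

/-- The register of the global parameter is `2`. -/
def Term.compile : Term → ℕ → Program
  | .lit z, d => .const (tmp d) z
  | .bound, d => .copy (tmp d) 2
  | .var x, d => .copy (tmp d) (slot x)
  | .arr m i, d => .seq (i.compile d) (.load (tmp d) m (tmp d))
  | .bin o e f, d =>
      .seq (e.compile d) (.seq (f.compile (d + 1)) (.arith o (tmp d) (tmp d) (tmp (d + 1))))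
  | .pos e, d => .seq (e.compile d) (.branch (tmp d) (.const (tmp d) 1) (.const (tmp d) 0))
  | .sum x e, d =>
      .seq (.const (tmp d) 0) (.seq (.copy (tmp (d + 1)) 2) (.seq (.copy (tmp (d + 2)) (slot x))
        (.seq (.loop (tmp (d + 1))
          (.seq (.const (tmp (d + 3)) 1)
            (.seq (.arith .sub (tmp (d + 1)) (tmp (d + 1)) (tmp (d + 3)))
              (.seq (.copy (slot x) (tmp (d + 1)))
                (.seq (e.compile (d + 3))
                  (.arith .add (tmp d) (tmp d) (tmp (d + 3))))))))
          (.copy (slot x) (tmp (d + 2))))))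

theorem State.setReg_reg (s : State) (d : ℕ) (z : ℤ) (r : ℕ) :
    (s.setReg d z).reg r = if r = d then z else s.reg r := by
  simp [State.setReg, Function.update_apply]

@[simp] theorem State.setReg_mem (s : State) (d : ℕ) (z : ℤ) : (s.setReg d z).mem = s.mem := rfl

/-- The states agree on everything but the intermediate results from `d` on. -/
def Agree (d : ℕ) (s s' : State) : Prop :=
  s'.mem = s.mem ∧ ∀ r, (r % 2 = 0 ∨ r < 2 * d + 1) → s'.reg r = s.reg r

/-- The counter runs downwards, and when it is `j` the accumulator holds the sum over `j ≤ v < N`;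
at `0` the sum is complete. The slot of `x` is exempt from the frame condition because the loop
overwrites it. Its old value waits in `tmp (d + 2)` and is put back after the loop. -/
theorem Term.exec_sum_loop {N B : ℕ} {x : ℕ} {e : Term} (hNB : N ≤ B)
    (ih : ∀ (d : ℕ) (s : State), s.reg 2 = N → (∀ m i, Fits B (s.mem m i)) →
      (∀ x, Fits B (s.reg (slot x))) → ∃ s' c, Exec (e.compile d) s s' c ∧ Agree d s s' ∧
        s'.reg (tmp d) = e.eval N s.mem (fun x => s.reg (slot x)) ∧ c ≤ e.cost.eval B)
    (d : ℕ) (s₀ : State) (h2 : s₀.reg 2 = N) (hM : ∀ m i, Fits B (s₀.mem m i))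
    (hρ : ∀ x, Fits B (s₀.reg (slot x))) (j : ℕ) :
    ∀ s : State, j ≤ N → s.mem = s₀.mem →
      (∀ r, r ≠ slot x → (r % 2 = 0 ∨ r < 2 * d + 1) → s.reg r = s₀.reg r) →
      s.reg (tmp (d + 1)) = j → s.reg (tmp (d + 2)) = s₀.reg (slot x) →
      s.reg (tmp d) = ∑ v ∈ Finset.Ico j N,
        e.eval N s₀.mem (Function.update (fun x => s₀.reg (slot x)) x v) →
      Fits B (s.reg (slot x)) →
      ∃ s' c, Exec (.loop (tmp (d + 1))
          (.seq (.const (tmp (d + 3)) 1)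
            (.seq (.arith .sub (tmp (d + 1)) (tmp (d + 1)) (tmp (d + 3)))
              (.seq (.copy (slot x) (tmp (d + 1)))
                (.seq (e.compile (d + 3))
                  (.arith .add (tmp d) (tmp d) (tmp (d + 3)))))))) s s' c ∧
        s'.mem = s₀.mem ∧
        (∀ r, r ≠ slot x → (r % 2 = 0 ∨ r < 2 * d + 1) → s'.reg r = s₀.reg r) ∧
        s'.reg (tmp (d + 2)) = s₀.reg (slot x) ∧
        s'.reg (tmp d) = ∑ v ∈ Finset.range N,
          e.eval N s₀.mem (Function.update (fun x => s₀.reg (slot x)) x v) ∧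
        c ≤ 2 + j * (4 * B + 20 + e.cost.eval B + 2 * e.bits.eval B) := by
  have hfit : ∀ v < N, Fits (e.bits.eval B)
      (e.eval N s₀.mem (Function.update (fun x => s₀.reg (slot x)) x v)) := by
    intro v hv
    refine Term.fits_eval hNB hM e _ fun y => ?_
    rcases eq_or_ne y x with rfl | hy
    · simpa using fits_natCast (n := v) (by omega)
    · simpa [hy] using hρ y
  induction j with
  | zero =>
    intro s _ hmem hr h1 h3 h4 _
    refine ⟨s, _, Exec.loop_exit (by rw [h1]; simp), hmem, hr, h3, ?_, ?_⟩
    · rw [h4, Nat.Ico_zero_eq_range]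
    · rw [h1]; simp [bitLen]
  | succ j ihj =>
    intro s hj hmem hr h1 h3 h4 h5
    have hs2 : s.reg 2 = N := by rw [hr 2 (by simp only [slot]; omega) (by simp), h2]
    set s1 := s.setReg (tmp (d + 3)) 1 with hs1
    set s2 := s1.setReg (tmp (d + 1)) (Op.sub.eval (s1.reg (tmp (d + 1))) (s1.reg (tmp (d + 3))))
      with hs2'
    set s3 := s2.setReg (slot x) (s2.reg (tmp (d + 1))) with hs3
    have e1 : s1.reg (tmp (d + 1)) = j + 1 := by
      rw [hs1, State.setReg_reg, if_neg (by simp [tmp]), h1]; push_cast; rfl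
    have e2 : s1.reg (tmp (d + 3)) = 1 := by rw [hs1, State.setReg_reg, if_pos rfl]
    have e3 : s2.reg (tmp (d + 1)) = j := by
      rw [hs2', State.setReg_reg, if_pos rfl, e1, e2]; simp [Op.eval]
    have e4 : s3.reg (slot x) = j := by rw [hs3, State.setReg_reg, if_pos rfl, e3]
    have e5 : s3.reg (tmp (d + 1)) = j := by
      rw [hs3, State.setReg_reg, if_neg (by simp only [tmp, slot]; omega), e3]
    have e6 : ∀ r, r ≠ slot x → r ≠ tmp (d + 1) → r ≠ tmp (d + 3) → s3.reg r = s.reg r := by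
      intro r a b c
      rw [hs3, State.setReg_reg, if_neg a, hs2', State.setReg_reg, if_neg b, hs1,
        State.setReg_reg, if_neg c]
    have e7 : s3.mem = s₀.mem := hmem
    have e8 : (fun y => s3.reg (slot y)) =
        Function.update (fun x => s₀.reg (slot x)) x (j : ℤ) := by
      funext y
      rcases eq_or_ne y x with rfl | hy
      · simp [e4]
      · have : slot y ≠ slot x := by simpa [slot] using hy
        simp only [Function.update_of_ne hy]
        rw [e6 _ this (by simp only [slot, tmp]; omega) (by simp only [slot, tmp]; omega),
          hr _ this (by simp only [slot]; omega)]
    obtain ⟨s4, c4, x4, a4, v4, k4⟩ := ih (d + 3) s3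
      (by rw [e6 _ (by simp only [slot]; omega) (by simp only [tmp]; omega)
        (by simp only [tmp]; omega), hs2])
      (by rw [e7]; exact hM)
      (by
        intro y
        have := congrFun e8 y
        rw [this]
        rcases eq_or_ne y x with rfl | hy
        · simpa using fits_natCast (n := j) (by omega)
        · simpa [hy] using hρ y)
    rw [e7, e8] at v4
    set s5 := s4.setReg (tmp d) (Op.add.eval (s4.reg (tmp d)) (s4.reg (tmp (d + 3)))) with hs5
    have f1 : ∀ r, r ≠ slot x → r ≠ tmp (d + 1) → r ≠ tmp d →
        (r % 2 = 0 ∨ r < 2 * d + 7) → s5.reg r = s.reg r := by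
      intro r a b c f
      rw [hs5, State.setReg_reg, if_neg c, a4.2 r (by omega)]
      exact e6 r a b (by simp only [tmp]; omega)
    have f2 : s4.reg (tmp d) = s.reg (tmp d) := by
      rw [a4.2 _ (by simp only [tmp]; omega)]
      exact e6 _ (by simp only [tmp, slot]; omega) (by simp [tmp]) (by simp [tmp])
    -- The accumulator is a sum of at most `N` values of `e`, which bounds the cost of adding the
    -- next one.
    have hsum : Fits (e.bits.eval B + N) (s.reg (tmp d)) := by
      rw [h4, Finset.sum_Ico_eq_sum_range]
      exact (fits_sum fun i hi => by exact_mod_cast hfit (j + 1 + i) (by omega)).mono (by omega)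
    obtain ⟨s6, c6, x6, g1, g2, g3, g4, g5⟩ := ihj s5 (by omega) (a4.1.trans e7)
      (by
        intro r a b
        rw [f1 r a (by simp only [tmp]; omega) (by simp only [tmp]; omega) (by omega), hr r a b])
      (by
        rw [hs5, State.setReg_reg, if_neg (by simp [tmp]), a4.2 _ (by simp only [tmp]; omega), e5])
      (by
        rw [f1 _ (by simp only [tmp, slot]; omega) (by simp [tmp]) (by simp [tmp])
          (by simp only [tmp]; omega), h3])
      (by
        rw [hs5, State.setReg_reg, if_pos rfl, f2, v4, h4, Finset.sum_eq_sum_Ico_succ_bot hj]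
        simp [Op.eval, add_comm])
      (by
        rw [hs5, State.setReg_reg, if_neg (by simp only [tmp, slot]; omega),
          a4.2 _ (by simp only [slot]; omega), e4]
        exact fits_natCast (by omega))
    refine ⟨s6, _, Exec.loop_iter (by rw [h1]; positivity)
      (.seq (.const _ _ _) (.seq (.arith _ _ _ _ _) (.seq (.copy _ _ _)
        (.seq x4 (.arith _ _ _ _ _))))) x6, g1, g2, g3, g4, ?_⟩
    rw [f2, v4, ← hs1, ← hs2', e1, e2, e3, h1]
    have k1 : bitLen ((j + 1 : ℕ) : ℤ) ≤ B + 1 := (fits_natCast (by omega)).bitLen_le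
    have k2 : bitLen ((j : ℕ) : ℤ) ≤ B + 1 := (fits_natCast (by omega)).bitLen_le
    have k3 := hsum.bitLen_le
    have k5 := (hfit j (by omega)).bitLen_le
    have k6 : bitLen 1 = 2 := by simp [bitLen]
    rw [Nat.succ_mul]
    push_cast at k1 ⊢
    omega

/-- Intermediate results live in odd registers, while variables and the parameter live in even ones.
Evaluation at depth `d` changes only odd registers from `2 * d + 1` on and never writes to an array.
So a second operand, evaluated at depth `d + 1`, leaves the first operand, the variables and the
arrays intact. -/
theorem Term.exec_compile {N B : ℕ} (hNB : N ≤ B) (e : Term) : ∀ (d : ℕ) (s : State),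
    s.reg 2 = N → (∀ m i, Fits B (s.mem m i)) → (∀ x, Fits B (s.reg (slot x))) →
    ∃ s' c, Exec (e.compile d) s s' c ∧ Agree d s s' ∧
      s'.reg (tmp d) = e.eval N s.mem (fun x => s.reg (slot x)) ∧ c ≤ e.cost.eval B := by
  have agree_set : ∀ (d : ℕ) (s : State) (z : ℤ), Agree d s (s.setReg (tmp d) z) := fun d s z =>
    ⟨rfl, fun r hr => by rw [State.setReg_reg, if_neg (by simp only [tmp]; omega)]⟩
  have agree_trans : ∀ (d d' : ℕ) (s s' s'' : State), d ≤ d' → Agree d s s' → Agree d' s' s'' →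
      Agree d s s'' := fun d d' s s' s'' h a b =>
    ⟨b.1.trans a.1, fun r hr => (b.2 r (by omega)).trans (a.2 r hr)⟩
  have agree_rho : ∀ (d : ℕ) (s s' : State), Agree d s s' →
      (fun x => s'.reg (slot x)) = fun x => s.reg (slot x) := fun d s s' a =>
    funext fun x => a.2 _ (by simp only [slot]; omega)
  have fit := fun (e : Term) (s : State) (hM : ∀ m i, Fits B (s.mem m i)) hρ =>
    (Term.fits_eval hNB hM e (fun x => s.reg (slot x)) hρ).bitLen_le
  induction e with
  | lit z =>
    intro d s _ _ _
    refine ⟨_, _, .const _ _ _, agree_set _ _ _, ?_, ?_⟩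
    · simp [State.setReg_reg, Term.eval]
    · simp [Term.cost]
  | bound =>
    intro d s h2 hM hρ
    refine ⟨_, _, .copy _ _ _, agree_set _ _ _, ?_, ?_⟩
    · simp [State.setReg_reg, Term.eval, h2]
    · have := fit .bound s hM hρ
      simp only [Term.eval, Term.bits, Polynomial.eval_X] at this
      simp [Term.cost, h2]; omega
  | var x =>
    intro d s h2 hM hρ
    refine ⟨_, _, .copy _ _ _, agree_set _ _ _, ?_, ?_⟩
    · simp [State.setReg_reg, Term.eval]
    · have := (hρ x).bitLen_le
      simp [Term.cost]; omega
  | arr m i ih =>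
    intro d s h2 hM hρ
    obtain ⟨s1, c1, x1, a1, v1, k1⟩ := ih d s h2 hM hρ
    refine ⟨_, _, .seq x1 (.load _ _ _ _), agree_trans d d _ _ _ le_rfl a1 (agree_set _ _ _),
      ?_, ?_⟩
    · simp [State.setReg_reg, Term.eval, v1, a1.1]
    · have := fit i s hM hρ
      have h3 := (hM m (i.eval N s.mem fun x => s.reg (slot x))).bitLen_le
      simp only [Term.cost, v1, a1.1, Polynomial.eval_add, Polynomial.eval_X,
        Polynomial.eval_ofNat]
      omega
  | bin o e f ihe ihf =>
    intro d s h2 hM hρ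
    obtain ⟨s1, c1, x1, a1, v1, k1⟩ := ihe d s h2 hM hρ
    obtain ⟨s2, c2, x2, a2, v2, k2⟩ := ihf (d + 1) s1 ((a1.2 2 (by simp)).trans h2)
      (by rw [a1.1]; exact hM)
      (fun x => by rw [a1.2 _ (by simp only [slot]; omega)]; exact hρ x)
    rw [agree_rho _ _ _ a1, a1.1] at v2
    have v1' : s2.reg (tmp d) = e.eval N s.mem fun x => s.reg (slot x) := by
      rw [a2.2 _ (by simp only [tmp]; omega), v1]
    refine ⟨_, _, .seq x1 (.seq x2 (.arith _ _ _ _ _)),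
      agree_trans d d _ _ _ le_rfl a1 (agree_trans d d _ _ _ le_rfl
        ⟨a2.1, fun r hr => a2.2 r (by omega)⟩ (agree_set _ _ _)), ?_, ?_⟩
    · simp [State.setReg_reg, Term.eval, v1', v2]
    · have h3 := fit e s hM hρ
      have h4 := fit f s hM hρ
      simp only [Term.cost, v1', v2, Polynomial.eval_add, Polynomial.eval_ofNat]
      omega
  | pos e ih =>
    intro d s h2 hM hρ
    obtain ⟨s1, c1, x1, a1, v1, k1⟩ := ih d s h2 hM hρ
    have h3 := fit e s hM hρ
    have b1 : bitLen 1 = 2 := by simp [bitLen]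
    have b0 : bitLen 0 = 1 := by simp [bitLen]
    by_cases hp : 0 < s1.reg (tmp d)
    · refine ⟨_, _, .seq x1 (.branch_pos hp (.const _ _ _)),
        agree_trans d d _ _ _ le_rfl a1 (agree_set _ _ _), ?_, ?_⟩
      · rw [v1] at hp
        simp [State.setReg_reg, Term.eval, hp]
      · simp only [Term.cost, v1, Polynomial.eval_add, Polynomial.eval_ofNat]
        omega
    · refine ⟨_, _, .seq x1 (.branch_neg hp (.const _ _ _)),
        agree_trans d d _ _ _ le_rfl a1 (agree_set _ _ _), ?_, ?_⟩
      · rw [v1] at hp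
        simp [State.setReg_reg, Term.eval, hp]
      · simp only [Term.cost, v1, Polynomial.eval_add, Polynomial.eval_ofNat]
        omega
  | sum x e ih =>
    intro d s h2 hM hρ
    set s1 := s.setReg (tmp d) 0 with hs1
    set s2 := s1.setReg (tmp (d + 1)) (s1.reg 2) with hs2
    set s3 := s2.setReg (tmp (d + 2)) (s2.reg (slot x)) with hs3
    have q : ∀ r, r ≠ tmp d → r ≠ tmp (d + 1) → r ≠ tmp (d + 2) → s3.reg r = s.reg r := by
      intro r a b c
      rw [hs3, State.setReg_reg, if_neg c, hs2, State.setReg_reg, if_neg b, hs1,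
        State.setReg_reg, if_neg a]
    have q1 : s1.reg 2 = N := by rw [hs1, State.setReg_reg, if_neg (by simp only [tmp]; omega), h2]
    have q2 : s2.reg (slot x) = s.reg (slot x) := by
      rw [hs2, State.setReg_reg, if_neg (by simp only [tmp, slot]; omega), hs1, State.setReg_reg,
        if_neg (by simp only [tmp, slot]; omega)]
    obtain ⟨s4, c4, x4, g1, g2, g3, g4, g5⟩ := Term.exec_sum_loop (x := x) hNB ih d s h2 hM hρ N s3
      le_rfl rfl
      (fun r a b => q r (by simp only [tmp]; omega) (by simp only [tmp]; omega)
        (by simp only [tmp]; omega))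
      (by
        rw [hs3, State.setReg_reg, if_neg (by simp [tmp]), hs2, State.setReg_reg, if_pos rfl, q1])
      (by rw [hs3, State.setReg_reg, if_pos rfl, q2])
      (by
        rw [hs3, State.setReg_reg, if_neg (by simp [tmp]), hs2, State.setReg_reg,
          if_neg (by simp [tmp]), hs1, State.setReg_reg, if_pos rfl]; simp)
      (by
        rw [q _ (by simp only [tmp, slot]; omega) (by simp only [tmp, slot]; omega)
          (by simp only [tmp, slot]; omega)]; exact hρ x)
    refine ⟨_, _, .seq (.const _ _ _) (.seq (.copy _ _ _) (.seq (.copy _ _ _)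
      (.seq x4 (.copy _ _ _)))), ⟨g1, fun r hr => ?_⟩, ?_, ?_⟩
    · rw [State.setReg_reg]
      split_ifs with h
      · rw [g3, h]
      · exact g2 r h hr
    · rw [State.setReg_reg, if_neg (by simp only [tmp, slot]; omega), g4]
      rfl
    · rw [← hs1, ← hs2, q1, q2, g3]
      have k1 : bitLen ((N : ℕ) : ℤ) ≤ B + 1 := (fits_natCast (by omega)).bitLen_le
      have k2 := (hρ x).bitLen_le
      have b0 : bitLen 0 = 1 := by simp [bitLen]
      have k3 : N * (4 * B + 20 + e.cost.eval B + 2 * e.bits.eval B) ≤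
        B * (4 * B + 20 + e.cost.eval B + 2 * e.bits.eval B) := Nat.mul_le_mul_right _ hNB
      simp only [Term.cost, Polynomial.eval_add, Polynomial.eval_mul, Polynomial.eval_X,
        Polynomial.eval_ofNat]
      omega

/-! ### Filling an array by a recursive expression. -/

/-- The state is ready for evaluating expressions with parameter `N` and digit bound `B`. -/
structure Ready (N B : ℕ) (s : State) : Prop where
  le : N ≤ B
  reg : s.reg 2 = N
  mem : ∀ m i, Fits B (s.mem m i)
  slots : ∀ x, Fits B (s.reg (slot x))

theorem Agree.ready {N B d : ℕ} {s s' : State} (a : Agree d s s') (h : Ready N B s) :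
    Ready N B s' where
  le := h.le
  reg := (a.2 2 (by simp)).trans h.reg
  mem := by rw [a.1]; exact h.mem
  slots x := by rw [a.2 _ (by simp only [slot]; omega)]; exact h.slots x

/-- `M_m[i] := e` for all `i` below the parameter, where `i` is variable `0`. -/
def tableProg (m : ℕ) (e : Term) : Program :=
  .seq (.copy (tmp 0) 2) (.loop (tmp 0)
    (.seq (.arith .sub (slot 0) 2 (tmp 0))
      (.seq (e.compile 1)
        (.seq (.store m (slot 0) (tmp 1))
          (.seq (.const (tmp 1) 1) (.arith .sub (tmp 0) (tmp 0) (tmp 1)))))))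

open Polynomial in
noncomputable def tableCost (e : Term) : ℕ[X] := X + 4 + X * (e.cost + e.bits + 6 * X + 30)

/-- Indices are treated in increasing order, so `e` may read entries of the array that is being
filled. Accordingly, `he` asks for the right value at `i` under every content `V` that is correct
below `i`. This supplies the recursion that the expression language itself does not have. -/
theorem exec_tableProg {N B : ℕ} {s : State} (hs : Ready N B s) (m : ℕ) (e : Term) (f : ℕ → ℤ)
    (hf : ∀ i < N, Fits B (f i))
    (he : ∀ i < N, ∀ V : ℤ → ℤ, (∀ j < i, V j = f j) → ∀ ρ : ℕ → ℤ, ρ 0 = i →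
      e.eval N (Function.update s.mem m V) ρ = f i) :
    ∃ s' c, Exec (tableProg m e) s s' c ∧ Ready N B s' ∧ (∀ m' ≠ m, s'.mem m' = s.mem m') ∧
      (∀ i < N, s'.mem m i = f i) ∧ c ≤ (tableCost e).eval B := by
  -- The counter `j` is the number of entries still missing, so the entries below `N - j` are
  -- correct.
  have key : ∀ (j : ℕ) (t : State), j ≤ N → Ready N B t → t.reg (tmp 0) = j →
      (∀ m' ≠ m, t.mem m' = s.mem m') → (∀ i < N - j, t.mem m i = f i) →
      ∃ s' c, Exec (.loop (tmp 0)
        (.seq (.arith .sub (slot 0) 2 (tmp 0))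
          (.seq (e.compile 1)
            (.seq (.store m (slot 0) (tmp 1))
              (.seq (.const (tmp 1) 1) (.arith .sub (tmp 0) (tmp 0) (tmp 1))))))) t s' c ∧
        Ready N B s' ∧ (∀ m' ≠ m, s'.mem m' = s.mem m') ∧ (∀ i < N, s'.mem m i = f i) ∧
        c ≤ 2 + j * (e.cost.eval B + e.bits.eval B + 6 * B + 30) := by
    intro j
    induction j with
    | zero =>
      intro t _ ht h0 h1 h2
      exact ⟨t, _, .loop_exit (by rw [h0]; simp), ht, h1, by simpa using h2,
        by rw [h0]; simp [bitLen]⟩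
    | succ j ih =>
      intro t hj ht h0 h1 h2
      obtain ⟨i, hi⟩ : ∃ i, N = i + (j + 1) := ⟨N - (j + 1), by omega⟩
      set t1 := t.setReg (slot 0) (Op.sub.eval (t.reg 2) (t.reg (tmp 0))) with ht1
      have e1 : t1.reg (slot 0) = i := by
        rw [ht1, State.setReg_reg, if_pos rfl, ht.reg, h0, hi]; simp [Op.eval]
      have r1 : Ready N B t1 :=
        { le := ht.le
          reg := by rw [ht1, State.setReg_reg, if_neg (by simp [slot])]; exact ht.reg
          mem := ht.mem
          slots := fun x => by
            rcases eq_or_ne x 0 with rfl | hx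
            · rw [e1]; exact fits_natCast (by have := ht.le; omega)
            · rw [ht1, State.setReg_reg, if_neg (by simpa [slot] using hx)]; exact ht.slots x }
      obtain ⟨t2, c2, x2, a2, v2, k2⟩ := e.exec_compile ht.le 1 t1 r1.reg r1.mem r1.slots
      have v2' : t2.reg (tmp 1) = f i := by
        rw [v2]
        have : t1.mem = Function.update s.mem m (t.mem m) := by
          funext m'
          rcases eq_or_ne m' m with rfl | hm
          · simp [ht1]
          · simp [ht1, hm, h1 m' hm]
        rw [this]
        exact he i (by omega) _ (fun j' hj' => h2 j' (by omega)) _ e1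
      have e2 : t2.reg (slot 0) = i := by rw [a2.2 _ (by simp [slot]), e1]
      have e2' : t2.reg (tmp 0) = (j + 1 : ℕ) := by
        rw [a2.2 _ (by simp [tmp]), ht1, State.setReg_reg, if_neg (by simp [tmp, slot]), h0]
      set t3 := t2.setMem m (t2.reg (slot 0)) (t2.reg (tmp 1)) with ht3
      set t4 := t3.setReg (tmp 1) 1 with ht4
      set t5 := t4.setReg (tmp 0) (Op.sub.eval (t4.reg (tmp 0)) (t4.reg (tmp 1))) with ht5
      have e4 : t4.reg (tmp 0) = (j + 1 : ℕ) := by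
        rw [ht4, State.setReg_reg, if_neg (by simp [tmp])]; exact e2'
      have e4' : t4.reg (tmp 1) = 1 := by rw [ht4, State.setReg_reg, if_pos rfl]
      have q : ∀ r, r % 2 = 0 → t5.reg r = t1.reg r := by
        intro r hr
        rw [ht5, State.setReg_reg, if_neg (by simp only [tmp]; omega), ht4, State.setReg_reg,
          if_neg (by simp only [tmp]; omega)]
        exact a2.2 r (Or.inl hr)
      have q5 : t5.mem = Function.update t.mem m (Function.update (t.mem m) i (f i)) := by
        change Function.update t2.mem m (Function.update (t2.mem m) (t2.reg (slot 0))
          (t2.reg (tmp 1))) = _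
        rw [e2, v2', a2.1]; rfl
      obtain ⟨t6, c6, x6, g1, g2, g3, g4⟩ := ih t5 (by omega)
        { le := ht.le
          reg := by rw [q 2 rfl]; exact r1.reg
          mem := fun m' i' => by
            rw [q5]
            rcases eq_or_ne m' m with rfl | hm
            · rw [Function.update_self]
              rcases eq_or_ne i' i with rfl | hi'
              · rw [Function.update_self]; exact hf _ (by omega)
              · rw [Function.update_of_ne hi']; exact ht.mem _ _
            · rw [Function.update_of_ne hm]; exact ht.mem _ _
          slots := fun x => by rw [q _ (by simp only [slot]; omega)]; exact r1.slots x }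
        (by rw [ht5, State.setReg_reg, if_pos rfl, e4, e4']; simp [Op.eval])
        (fun m' hm => by rw [q5, Function.update_of_ne hm, h1 m' hm])
        (fun i' hi' => by
          rw [q5, Function.update_self]
          rcases eq_or_ne i' i with rfl | h
          · rw [Function.update_self]
          · rw [Function.update_of_ne (by exact_mod_cast h)]; exact h2 i' (by omega))
      refine ⟨t6, _, .loop_iter (by rw [h0]; positivity) (.seq (.arith _ _ _ _ _) (.seq x2
        (.seq (.store _ _ _ _) (.seq (.const _ _ _) (.arith _ _ _ _ _))))) x6, g1, g2, g3, ?_⟩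
      rw [← ht3, ← ht4, ht.reg, h0, e2, v2', e4, e4']
      have k1 : bitLen ((j + 1 : ℕ) : ℤ) ≤ B + 1 :=
        (fits_natCast (by have := ht.le; omega)).bitLen_le
      have k3 : bitLen ((i : ℕ) : ℤ) ≤ B + 1 :=
        (fits_natCast (by have := ht.le; omega)).bitLen_le
      have k4 : bitLen ((N : ℕ) : ℤ) ≤ B + 1 := (fits_natCast ht.le).bitLen_le
      have k5 := (hf i (by omega)).bitLen_le
      have k6 : bitLen 1 = 2 := by simp [bitLen]
      rw [Nat.succ_mul]
      omega
  set s0 := s.setReg (tmp 0) (s.reg 2) with hs0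
  obtain ⟨s', c, x1, g1, g2, g3, g4⟩ := key N s0 le_rfl
    { le := hs.le
      reg := by rw [hs0, State.setReg_reg, if_neg (by simp [tmp])]; exact hs.reg
      mem := hs.mem
      slots := fun x => by
        rw [hs0, State.setReg_reg, if_neg (by simp [tmp, slot])]; exact hs.slots x }
    (by rw [hs0, State.setReg_reg, if_pos rfl, hs.reg]) (fun _ _ => rfl) (by simp)
  refine ⟨s', _, .seq (.copy _ _ _) x1, g1, g2, g3, ?_⟩
  have k4 : bitLen ((N : ℕ) : ℤ) ≤ B + 1 := (fits_natCast hs.le).bitLen_le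
  have k3 := Nat.mul_le_mul_right (e.cost.eval B + e.bits.eval B + 6 * B + 30) hs.le
  rw [hs.reg]
  simp only [tableCost, Polynomial.eval_add, Polynomial.eval_mul, Polynomial.eval_X,
    Polynomial.eval_ofNat]
  omega

end AODRepair

namespace AODRepair

/-! ### Derived expressions -/

namespace Term

instance : Add Term := ⟨bin .add⟩
instance : Sub Term := ⟨bin .sub⟩
instance : Mul Term := ⟨bin .mul⟩
instance : Div Term := ⟨bin .div⟩

/-- Truth of an expression used as a condition. -/
def Holds (N : ℕ) (M : ℕ → ℤ → ℤ) (e : Term) (ρ : ℕ → ℤ) : Prop := 0 < e.eval N M ρ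

/-- Conditions are integers read by their sign. `pos` normalizes them to `0` and `1`, which turns
product, sum and difference from `1` into connectives. -/
protected def and (e f : Term) : Term := pos e * pos f
protected def or (e f : Term) : Term := pos e + pos f
protected def not (e : Term) : Term := lit 1 - pos e
protected def lt (e f : Term) : Term := f - e
protected def le (e f : Term) : Term := f + lit 1 - e
protected def eq (e f : Term) : Term := (e.le f).and (f.le e)
/-- Some value of `x` below the parameter satisfies `e`. -/
def ex (x : ℕ) (e : Term) : Term := sum x (pos e)
/-- The least value of `y` that satisfies `e`; `x` is an auxiliary variable. -/
def least (x y : ℕ) (e : Term) : Term :=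
  sum x (pos (ex y (((var y).le (var x)).and e)).not)
/-- The maximum of `e` over `x`; `y` is an auxiliary variable. -/
def maxOver (x y : ℕ) (e : Term) : Term := sum y (pos (ex x ((var y).lt e)))

def pow (e : Term) : ℕ → Term
  | 0 => lit 1
  | n + 1 => pow e n * e

variable {N : ℕ} {M : ℕ → ℤ → ℤ}

@[simp] theorem eval_lit (z : ℤ) (ρ : ℕ → ℤ) : (lit z).eval N M ρ = z := rfl
@[simp] theorem eval_var (x : ℕ) (ρ : ℕ → ℤ) : (var x).eval N M ρ = ρ x := rfl
@[simp] theorem eval_arr (m : ℕ) (i : Term) (ρ : ℕ → ℤ) :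
    (arr m i).eval N M ρ = M m (i.eval N M ρ) := rfl
@[simp] theorem eval_add (e f : Term) (ρ : ℕ → ℤ) :
    (e + f).eval N M ρ = e.eval N M ρ + f.eval N M ρ := rfl
@[simp] theorem eval_sub (e f : Term) (ρ : ℕ → ℤ) :
    (e - f).eval N M ρ = e.eval N M ρ - f.eval N M ρ := rfl
@[simp] theorem eval_mul (e f : Term) (ρ : ℕ → ℤ) :
    (e * f).eval N M ρ = e.eval N M ρ * f.eval N M ρ := rfl
@[simp] theorem eval_div (e f : Term) (ρ : ℕ → ℤ) :
    (e / f).eval N M ρ = e.eval N M ρ / f.eval N M ρ := rfl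
@[simp] theorem eval_sum (x : ℕ) (e : Term) (ρ : ℕ → ℤ) : (sum x e).eval N M ρ =
    ∑ v ∈ Finset.range N, e.eval N M (Function.update ρ x v) := rfl
open Classical in
@[simp] theorem eval_pos (e : Term) (ρ : ℕ → ℤ) :
    (pos e).eval N M ρ = if e.Holds N M ρ then 1 else 0 := by
  unfold Holds
  rw [Term.eval]
  congr

@[simp] theorem eval_pow (e : Term) (n : ℕ) (ρ : ℕ → ℤ) :
    (e.pow n).eval N M ρ = e.eval N M ρ ^ n := by
  induction n with
  | zero => simp [pow]
  | succ n ih => simp [pow, ih, pow_succ]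

@[simp] theorem holds_and (e f : Term) (ρ : ℕ → ℤ) :
    (e.and f).Holds N M ρ ↔ e.Holds N M ρ ∧ f.Holds N M ρ := by
  change 0 < (pos e * pos f).eval N M ρ ↔ _
  rw [eval_mul, eval_pos, eval_pos]; split_ifs <;> simp_all

@[simp] theorem holds_or (e f : Term) (ρ : ℕ → ℤ) :
    (e.or f).Holds N M ρ ↔ e.Holds N M ρ ∨ f.Holds N M ρ := by
  change 0 < (pos e + pos f).eval N M ρ ↔ _
  rw [eval_add, eval_pos, eval_pos]; split_ifs <;> simp_all

@[simp] theorem holds_not (e : Term) (ρ : ℕ → ℤ) : e.not.Holds N M ρ ↔ ¬ e.Holds N M ρ := by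
  change 0 < (lit 1 - pos e).eval N M ρ ↔ _
  rw [eval_sub, eval_pos, eval_lit]; split_ifs <;> simp_all

@[simp] theorem holds_lt (e f : Term) (ρ : ℕ → ℤ) :
    (e.lt f).Holds N M ρ ↔ e.eval N M ρ < f.eval N M ρ := by
  simp [Term.lt, Holds]

@[simp] theorem holds_le (e f : Term) (ρ : ℕ → ℤ) :
    (e.le f).Holds N M ρ ↔ e.eval N M ρ ≤ f.eval N M ρ := by
  simp only [Term.le, Holds, eval_add, eval_sub, eval_lit]; omega

@[simp] theorem holds_eq (e f : Term) (ρ : ℕ → ℤ) :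
    (e.eq f).Holds N M ρ ↔ e.eval N M ρ = f.eval N M ρ := by
  simp only [Term.eq, holds_and, holds_le]; omega

@[simp] theorem holds_ex (x : ℕ) (e : Term) (ρ : ℕ → ℤ) :
    (ex x e).Holds N M ρ ↔ ∃ v < N, e.Holds N M (Function.update ρ x v) := by
  change 0 < (sum x (pos e)).eval N M ρ ↔ _
  rw [eval_sum]
  rw [Finset.sum_pos_iff_of_nonneg]
  · simp only [Finset.mem_range, eval_pos]
    refine exists_congr fun v => and_congr_right fun _ => ?_
    split_ifs with h
    · simpa using h
    · simpa using h
  · intro i _; simp only [eval_pos]; split_ifs <;> simp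

end Term

open Classical in
/-- The least number below `N` with property `p` (and `N` if there is none). -/
noncomputable def leastBelow (N : ℕ) (p : ℕ → Prop) : ℕ :=
  ((Finset.range N).filter fun x => ¬ ∃ y < N, y ≤ x ∧ p y).card

theorem leastBelow_le (N : ℕ) (p : ℕ → Prop) : leastBelow N p ≤ N := by
  classical
  rw [leastBelow]
  exact (Finset.card_filter_le _ _).trans (by simp)

/-- The numbers with no solution up to and including them are exactly those below the first
solution, so their count is that solution. -/
theorem leastBelow_spec {N : ℕ} {p : ℕ → Prop} (h : ∃ x < N, p x) :
    leastBelow N p < N ∧ p (leastBelow N p) := by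
  classical
  have : leastBelow N p = Nat.find h := by
    rw [leastBelow, ← Finset.card_range (Nat.find h)]
    congr 1
    ext x
    simp only [Finset.mem_filter, Finset.mem_range, Nat.lt_find_iff]
    constructor
    · rintro ⟨hx, h2⟩ m hm ⟨h3, h4⟩
      exact h2 ⟨m, h3, hm, h4⟩
    · intro h2
      have h3 := Nat.find_spec h
      refine ⟨?_, ?_⟩
      · by_contra hx
        exact h2 (Nat.find h) (by omega) h3
      · rintro ⟨y, hy, hyx, hp⟩
        exact h2 y hyx ⟨hy, hp⟩
  rw [this]
  exact Nat.find_spec h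

theorem Term.eval_least {N : ℕ} {M : ℕ → ℤ → ℤ} {x y : ℕ} (hxy : x ≠ y) {e : Term} {ρ : ℕ → ℤ}
    {p : ℕ → Prop} (h : ∀ u < N, ∀ v < N,
      (e.Holds N M (Function.update (Function.update ρ x u) y v) ↔ p v)) :
    (Term.least x y e).eval N M ρ = (leastBelow N p : ℤ) := by
  classical
  simp only [Term.least, Term.eval_sum, Term.eval_pos, Term.holds_not, Term.holds_ex,
    Term.holds_and, Term.holds_le, Term.eval_var, Function.update_self, leastBelow,
    Function.update_of_ne hxy]
  rw [Finset.sum_boole]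
  congr 2
  refine Finset.filter_congr fun u hu => not_congr (exists_congr fun v => and_congr_right fun hv =>
    and_congr (by simp) (h u (by simpa using hu) v hv))

/-- A maximum of natural numbers equals the number of `v` that are exceeded by some of them. Since
`v` ranges only below `N`, the values must not exceed `N`. -/
theorem Term.eval_maxOver {N : ℕ} {M : ℕ → ℤ → ℤ} {x y : ℕ} (hxy : x ≠ y) {e : Term} {ρ : ℕ → ℤ}
    {f : ℕ → ℕ} (hf : ∀ u < N, f u ≤ N) (h : ∀ v < N, ∀ u < N,
      e.eval N M (Function.update (Function.update ρ y v) x u) = f u) :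
    (Term.maxOver x y e).eval N M ρ = ((Finset.range N).sup f : ℕ) := by
  classical
  simp only [Term.maxOver, Term.eval_sum, Term.eval_pos, Term.holds_ex, Term.holds_lt,
    Term.eval_var, Function.update_self, Function.update_of_ne hxy.symm]
  rw [Finset.sum_boole]
  congr 1
  rw [← Finset.card_range ((Finset.range N).sup f)]
  congr 1
  ext v
  have hN : (Finset.range N).sup f ≤ N := Finset.sup_le fun u hu => hf u (by simpa using hu)
  simp only [Finset.mem_filter, Finset.mem_range, Finset.lt_sup_iff]
  constructor
  · rintro ⟨hv, u, hu, h2⟩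
    rw [h v hv u hu] at h2
    exact ⟨u, hu, by exact_mod_cast h2⟩
  · rintro ⟨u, hu, h2⟩
    have hv : v < N := lt_of_lt_of_le h2 (hf u hu)
    exact ⟨hv, u, hu, by rw [h v hv u hu]; exact_mod_cast h2⟩

/-! ### Heaviest paths in layered graphs -/

open Classical in
/-- One plus the maximum weight of a path from state `0` in layer `0` to state `y` in layer `i`;
`0` if there is no such path. -/
noncomputable def pathValue (S : ℕ) (R : ℕ → ℕ → ℕ → Prop) (w : ℕ → ℕ) : ℕ → ℕ → ℕ
  | 0, y => if y = 0 then 1 else 0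
  | i + 1, y => (Finset.range S).sup fun x =>
      if R i x y ∧ 0 < pathValue S R w i x then pathValue S R w i x + w y else 0

/-- `X` is a path through the layers `0, …, n`. -/
structure IsPath (S : ℕ) (R : ℕ → ℕ → ℕ → Prop) (n : ℕ) (X : ℕ → ℕ) : Prop where
  zero : X 0 = 0
  lt : ∀ i ≤ n, X i < S
  rel : ∀ i < n, R i (X i) (X (i + 1))

/-- The inequality is strict because values carry an extra one, which keeps reachable states of
weight zero apart from unreachable states. -/
theorem IsPath.weight_lt {S : ℕ} {R : ℕ → ℕ → ℕ → Prop} {w : ℕ → ℕ} {n : ℕ} {X : ℕ → ℕ}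
    (h : IsPath S R n X) : ∀ m ≤ n,
    ∑ i ∈ Finset.range m, w (X (i + 1)) < pathValue S R w m (X m) := by
  classical
  intro m
  induction m with
  | zero => intro _; simp [pathValue, h.zero]
  | succ m ih =>
    intro hm
    have h1 := ih (by omega)
    rw [pathValue, Finset.sum_range_succ]
    refine lt_of_lt_of_le ?_ (Finset.le_sup (b := X m) (by simpa using h.lt m (by omega)))
    rw [if_pos ⟨h.rel m hm, by omega⟩]
    omega

theorem pathValue_le {S : ℕ} {R : ℕ → ℕ → ℕ → Prop} {w : ℕ → ℕ}
    (hw : ∀ i x y, R i x y → w y ≤ 1) : ∀ i y, pathValue S R w i y ≤ i + 1 := by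
  classical
  intro i
  induction i with
  | zero => intro y; simp only [pathValue]; split_ifs <;> omega
  | succ i ih =>
    intro y
    rw [pathValue]
    refine Finset.sup_le fun x _ => ?_
    split_ifs with h
    · have := ih x; have := hw _ _ _ h.1; omega
    · omega

/-- The condition on the state at distance `j` from the last layer `n` of a heaviest path, given the
state `y` after it. -/
def BackCond (S : ℕ) (R : ℕ → ℕ → ℕ → Prop) (w : ℕ → ℕ) (n j y x : ℕ) : Prop :=
  j ≤ n ∧ x < S ∧ ((j = 0 ∧ ∀ z < S, pathValue S R w n z ≤ pathValue S R w n x) ∨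
    (0 < j ∧ y < S ∧ R (n - j) x y ∧ 0 < pathValue S R w (n - j) x ∧
      pathValue S R w (n - j) x + w y = pathValue S R w (n - j + 1) y))

/-- The states of a heaviest path, from the last layer `n` backwards. -/
noncomputable def back (N S : ℕ) (R : ℕ → ℕ → ℕ → Prop) (w : ℕ → ℕ) (n : ℕ) : ℕ → ℕ
  | 0 => leastBelow N (BackCond S R w n 0 0)
  | j + 1 => leastBelow N (BackCond S R w n (j + 1) (back N S R w n j))

theorem back_le {N S : ℕ} {R : ℕ → ℕ → ℕ → Prop} {w : ℕ → ℕ} {n j : ℕ} :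
    back N S R w n j ≤ N := by
  cases j <;> exact leastBelow_le _ _

/-- Backtracking starts at a state of maximal value in the last layer and repeatedly picks a
predecessor at which the maximum in the recursion is attained. The given path `X` only ensures that
some state of the last layer is reachable. -/
theorem isPath_back {N S : ℕ} {R : ℕ → ℕ → ℕ → Prop} {w : ℕ → ℕ} {n : ℕ} (hS : S ≤ N)
    {X : ℕ → ℕ} (hX : IsPath S R n X) :
    IsPath S R n (fun i => back N S R w n (n - i)) ∧
    ∀ Y, IsPath S R n Y → ∑ i ∈ Finset.range n, w (Y (i + 1)) ≤
      ∑ i ∈ Finset.range n, w (back N S R w n (n - (i + 1))) := by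
  classical
  set B := back N S R w n with hB
  have h0 : BackCond S R w n 0 0 (B 0) := by
    refine (leastBelow_spec ?_).2
    have hne : (Finset.range S).Nonempty := ⟨X 0, by simpa using hX.lt 0 (by omega)⟩
    obtain ⟨x, hx, h⟩ := Finset.exists_max_image (Finset.range S) (pathValue S R w n) hne
    rw [Finset.mem_range] at hx
    exact ⟨x, by omega, Nat.zero_le _, hx, Or.inl ⟨rfl, fun z hz => h z (by simpa using hz)⟩⟩
  have hmax : ∀ z < S, pathValue S R w n z ≤ pathValue S R w n (B 0) := by
    rcases h0.2.2 with h | h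
    · exact h.2
    · exact absurd h.1 (lt_irrefl _)
  have hpos : 0 < pathValue S R w n (B 0) :=
    lt_of_lt_of_le (lt_of_le_of_lt (Nat.zero_le _) (hX.weight_lt (w := w) n le_rfl))
      (hmax _ (hX.lt n le_rfl))
  have hind : ∀ j ≤ n, B j < S ∧ 0 < pathValue S R w (n - j) (B j) ∧
      (∀ i, i + 1 = j → R (n - j) (B j) (B i) ∧
        pathValue S R w (n - j) (B j) + w (B i) = pathValue S R w (n - j + 1) (B i)) := by
    intro j
    induction j with
    | zero => exact fun _ => ⟨h0.2.1, hpos, fun i hi => absurd hi (by omega)⟩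
    | succ j ih =>
      intro hj
      obtain ⟨h1, h2, -⟩ := ih (by omega)
      have e : n - j = n - (j + 1) + 1 := by omega
      have h3 : BackCond S R w n (j + 1) (B j) (B (j + 1)) := by
        refine (leastBelow_spec ?_).2
        rw [e, pathValue] at h2
        -- The supremum is attained and positive, so the alternative `0` is not the one that attains
        -- it, and the maximizer is a genuine predecessor.
        obtain ⟨x, hx, h4⟩ := Finset.exists_mem_eq_sup (Finset.range S)
          ⟨B j, by simpa using h1⟩ (fun x => if R (n - (j + 1)) x (B j) ∧
            0 < pathValue S R w (n - (j + 1)) x then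
              pathValue S R w (n - (j + 1)) x + w (B j) else 0)
        rw [h4] at h2
        have h5 : R (n - (j + 1)) x (B j) ∧ 0 < pathValue S R w (n - (j + 1)) x := by
          by_contra h5
          rw [if_neg h5] at h2
          exact lt_irrefl _ h2
        rw [if_pos h5] at h4
        rw [Finset.mem_range] at hx
        exact ⟨x, by omega, hj, hx, Or.inr ⟨by omega, h1, h5.1, h5.2, by
          rw [pathValue]; exact h4.symm⟩⟩
      rcases h3.2.2 with h | h
      · exact absurd h.1 (by omega)
      · refine ⟨h3.2.1, h.2.2.2.1, fun i hi => ?_⟩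
        obtain rfl : i = j := by omega
        exact ⟨h.2.2.1, h.2.2.2.2⟩
  -- In layer `0` only state `0` has a positive value.
  have hzero : B (n - 0) = 0 := by
    have h1 := (hind n le_rfl).2.1
    rw [Nat.sub_self, pathValue] at h1
    by_contra h2
    rw [Nat.sub_zero] at h2
    rw [if_neg h2] at h1
    exact lt_irrefl _ h1
  have hsum : ∀ m ≤ n, ∑ i ∈ Finset.range m, w (B (n - (i + 1))) + 1 =
      pathValue S R w m (B (n - m)) := by
    intro m
    induction m with
    | zero => intro _; simp [pathValue] at hzero ⊢; exact hzero
    | succ m ih =>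
      intro hm
      have h1 := ih (by omega)
      have h2 := ((hind (n - m) (by omega)).2.2 (n - (m + 1)) (by omega)).2
      rw [show n - (n - m) = m by omega] at h2
      rw [Finset.sum_range_succ, ← h2, ← h1]
      omega
  refine ⟨⟨hzero, fun i _ => (hind _ (by omega)).1, fun i hi => ?_⟩, fun Y hY => ?_⟩
  · have h2 := ((hind (n - i) (by omega)).2.2 (n - (i + 1)) (by omega)).1
    rwa [show n - (n - i) = i by omega] at h2
  · have h1 := hY.weight_lt (w := w) n le_rfl
    have h2 := hmax _ (hY.lt n le_rfl)
    have h3 := hsum n le_rfl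
    rw [Nat.sub_self] at h3
    omega

end AODRepair

namespace AODRepair

/-! ### Sorted columns and certificates for the aggregate of a group -/

/-- Two columns of a relation with `n` tuples, in lexicographic order. -/
structure SortedCols where
  n : ℕ
  γ : ℕ → ℚ
  a : ℕ → ℚ
  sorted : ∀ i j, i < j → j < n → γ i < γ j ∨ (γ i = γ j ∧ a i ≤ a j)

namespace SortedCols

variable (d : SortedCols)

theorem γ_mono {i j : ℕ} (h : i ≤ j) (hj : j < d.n) : d.γ i ≤ d.γ j := by
  rcases h.eq_or_lt with rfl | h
  · exact le_rfl
  · rcases d.sorted i j h hj with h | h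
    · exact h.le
    · exact h.1.le

/-- By sortedness, every group is an interval of positions. -/
theorem γ_eq_of_between {i j k : ℕ} (hij : i ≤ j) (hjk : j ≤ k) (hk : k < d.n)
    (h : d.γ i = d.γ k) : d.γ j = d.γ k :=
  le_antisymm (d.γ_mono hjk hk) (h ▸ d.γ_mono hij (lt_of_le_of_lt hjk hk))

def block (s : Finset ℕ) (g : ℚ) : Finset ℕ := s.filter fun t => d.γ t = g

theorem mem_block {s : Finset ℕ} {g : ℚ} {t : ℕ} : t ∈ d.block s g ↔ t ∈ s ∧ d.γ t = g := by
  simp [block]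

def agg (α : Agg) (T : Finset ℕ) : ℚ := α.eval (T.val.map d.a)

/-- The dependency in terms of positions. Only groups that contain a taken position are compared, so
the aggregate of the empty bag plays no role. -/
def Mono (α : Agg) (s : Finset ℕ) : Prop :=
  ∀ t ∈ s, ∀ u ∈ s, d.γ t ≤ d.γ u → d.agg α (d.block s (d.γ t)) ≤ d.agg α (d.block s (d.γ u))

end SortedCols

/-- A way to recognize the aggregate of a group from additive counters.  A descriptor consists of
four counters and two guessed positions; `wt l t g h` is the contribution of position `t` to
counter `l` under the guess `g, h`.  If `conn i` then the positions `i - 1` and `i` are to be taken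
or left together. -/
structure Scheme where
  wt : ℕ → ℕ → ℕ → ℕ → ℕ
  fin : (Fin 6 → ℕ) → Prop
  le : (Fin 6 → ℕ) → (Fin 6 → ℕ) → Prop
  conn : ℕ → Prop

namespace Scheme

variable (S : Scheme) (d : SortedCols)

def Closed (s : Finset ℕ) : Prop :=
  ∀ i, 0 < i → i < d.n → S.conn i → (i - 1 ∈ s ↔ i ∈ s)

structure IsGroup (T : Finset ℕ) : Prop where
  sub : ∀ t ∈ T, t < d.n
  ne : T.Nonempty
  eq : ∀ t ∈ T, ∀ u ∈ T, d.γ t = d.γ u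
  closed : S.Closed d T

structure Cert (T : Finset ℕ) (c : Fin 6 → ℕ) : Prop extends S.IsGroup d T where
  lt4 : c 4 < d.n
  lt5 : c 5 < d.n
  count : ∀ l : Fin 4, c (Fin.castLE (by norm_num) l) = ∑ t ∈ T, S.wt l t (c 4) (c 5)
  final : S.fin c

/-- The factor `d.n` in `bound` keeps every counter, a sum over at most `d.n` positions, below the
base `D`. `le_iff` concerns arbitrary certificates, so guesses need not be unique. `saturate` says
that the restriction to closed choices costs no tuples. -/
structure Valid (α : Agg) (D : ℕ) : Prop where
  wt_zero : ∀ t g h, S.wt 0 t g h = 1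
  bound : ∀ l < 4, ∀ t < d.n, ∀ g < d.n, ∀ h < d.n, d.n * S.wt l t g h < D
  two_le : 2 ≤ D
  conn_γ : ∀ i, 0 < i → i < d.n → S.conn i → d.γ (i - 1) = d.γ i
  le_iff : ∀ T c T' c', S.Cert d T c → S.Cert d T' c' →
    (S.le c c' ↔ d.agg α T ≤ d.agg α T')
  exists_cert : ∀ T, S.IsGroup d T → ∃ c, S.Cert d T c
  saturate : ∀ s, (∀ t ∈ s, t < d.n) → d.Mono α s →
    ∃ s', (∀ t ∈ s', t < d.n) ∧ d.Mono α s' ∧ S.Closed d s' ∧ s.card ≤ s'.card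

/-! ### The automaton that checks a choice of tuples -/

def cur (X : ℕ → ℕ) : Fin 6 → ℕ := fun l => X l
def prev (X : ℕ → ℕ) : Fin 6 → ℕ := fun l => X (6 + l)

def IsStart (i : ℕ) : Prop := i = 0 ∨ d.γ (i - 1) ≠ d.γ i
def IsEnd (i : ℕ) : Prop := i + 1 = d.n ∨ d.γ (i + 1) ≠ d.γ i

/-- A step of the automaton at position `i`.  Entries `0, …, 5` of a state describe the current
group, entries `6, …, 11` the last complete group with a taken tuple, and entry `12` tells whether
the last tuple was taken. -/
structure Step (i : ℕ) (X Y : ℕ → ℕ) : Prop where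
  bit : Y 12 ≤ 1
  conn : 0 < i ∧ S.conn i → Y 12 = X 12
  lt4 : Y 4 < d.n
  lt5 : Y 5 < d.n
  guess : ¬ IsStart d i → Y 4 = X 4 ∧ Y 5 = X 5
  start : IsStart d i → ∀ l < 4, Y l = Y 12 * S.wt l i (Y 4) (Y 5)
  count : ¬ IsStart d i → ∀ l < 4, Y l = X l + Y 12 * S.wt l i (Y 4) (Y 5)
  complete : IsEnd d i ∧ 0 < Y 0 → S.fin (cur Y) ∧
    (X 6 = 0 ∨ X 10 < d.n ∧ X 11 < d.n ∧ S.le (prev X) (cur Y)) ∧ prev Y = cur Y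
  keep : ¬ (IsEnd d i ∧ 0 < Y 0) → prev Y = prev X

variable {S d}

/-- The taken positions of complete groups before position `i`. -/
def completed (d : SortedCols) (s : Finset ℕ) (i : ℕ) : Finset ℕ :=
  s.filter fun t => t < i ∧ ¬ (i < d.n ∧ d.γ t = d.γ i)

theorem mem_completed {s : Finset ℕ} {i t : ℕ} :
    t ∈ completed d s i ↔ t ∈ s ∧ t < i ∧ ¬ (i < d.n ∧ d.γ t = d.γ i) := by
  simp [completed]

/-- The taken positions up to `i` in the group of `i`. -/
def initial (d : SortedCols) (s : Finset ℕ) (i : ℕ) : Finset ℕ :=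
  (d.block s (d.γ i)).filter fun t => t ≤ i

theorem mem_initial {s : Finset ℕ} {i t : ℕ} :
    t ∈ initial d s i ↔ (t ∈ s ∧ d.γ t = d.γ i) ∧ t ≤ i := by
  simp [initial, SortedCols.mem_block]

theorem sum_initial_of_start {s : Finset ℕ} {i : ℕ} (hi : i < d.n) (h : IsStart d i)
    (f : ℕ → ℕ) : ∑ t ∈ initial d s i, f t = if i ∈ s then f i else 0 := by
  have : initial d s i = if i ∈ s then {i} else ∅ := by
    ext t
    rw [mem_initial]
    have key : t ≤ i → d.γ t = d.γ i → t = i := by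
      intro h1 h2
      by_contra h3
      rcases h with h | h
      · omega
      · exact h (d.γ_eq_of_between (i := t) (by omega) (by omega) hi h2)
    split_ifs with hs
    · rw [Finset.mem_singleton]
      exact ⟨fun h => key h.2 h.1.2, fun h => by subst h; exact ⟨⟨hs, rfl⟩, le_rfl⟩⟩
    · simp only [Finset.notMem_empty, iff_false]
      rintro ⟨⟨h1, h2⟩, h3⟩
      exact hs (key h3 h2 ▸ h1)
  rw [this]
  split_ifs <;> simp

theorem sum_initial_of_not_start {s : Finset ℕ} {i : ℕ} (h : ¬ IsStart d i)
    (f : ℕ → ℕ) : ∑ t ∈ initial d s i, f t =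
      ∑ t ∈ initial d s (i - 1), f t + if i ∈ s then f i else 0 := by
  simp only [IsStart, not_or, not_not] at h
  have : initial d s i = initial d s (i - 1) ∪ (if i ∈ s then {i} else ∅) := by
    ext t
    rw [Finset.mem_union, mem_initial, mem_initial, h.2]
    have : t ∈ (if i ∈ s then {i} else ∅ : Finset ℕ) ↔ t ∈ s ∧ t = i := by
      split_ifs with hs
      · rw [Finset.mem_singleton]; exact ⟨fun h => ⟨h ▸ hs, h⟩, fun h => h.2⟩
      · simp only [Finset.notMem_empty, false_iff]; rintro ⟨h1, rfl⟩; exact hs h1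
    rw [this]
    constructor
    · rintro ⟨h1, h2⟩
      by_cases h3 : t = i
      · exact Or.inr ⟨h1.1, h3⟩
      · exact Or.inl ⟨h1, by omega⟩
    · rintro (⟨h1, h2⟩ | ⟨h1, rfl⟩)
      · exact ⟨h1, by omega⟩
      · exact ⟨⟨h1, rfl⟩, le_rfl⟩
  rw [this, Finset.sum_union]
  · split_ifs <;> simp
  · rw [Finset.disjoint_left]
    intro t ht
    rw [mem_initial] at ht
    split_ifs
    · rw [Finset.mem_singleton]; omega
    · simp

theorem initial_of_end {s : Finset ℕ} (hs : ∀ t ∈ s, t < d.n) {i : ℕ} (h : IsEnd d i) :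
    initial d s i = d.block s (d.γ i) := by
  ext t
  rw [mem_initial, d.mem_block]
  refine ⟨fun h => h.1, fun h1 => ⟨h1, ?_⟩⟩
  have h2 := hs t h1.1
  by_contra h3
  rcases h with h | h
  · omega
  · exact h ((d.γ_eq_of_between (i := i) (j := i + 1) (k := t) (by omega) (by omega) h2
      h1.2.symm).trans h1.2)

theorem completed_of_not_end {s : Finset ℕ} {i : ℕ} (hi : i < d.n) (h : ¬ IsEnd d i) :
    completed d s (i + 1) = completed d s i := by
  simp only [IsEnd, not_or, not_not] at h
  ext t
  rw [mem_completed, mem_completed, h.2]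
  constructor
  · rintro ⟨h1, h2, h3⟩
    have h4 : t ≠ i := by rintro rfl; exact h3 ⟨by omega, rfl⟩
    exact ⟨h1, by omega, fun h5 => h3 ⟨by omega, h5.2⟩⟩
  · rintro ⟨h1, h2, h3⟩
    exact ⟨h1, by omega, fun h5 => h3 ⟨by omega, h5.2⟩⟩

theorem mem_completed_of_end {s : Finset ℕ} {i t : ℕ} (hs : ∀ t ∈ s, t < d.n)
    (h : IsEnd d i) : t ∈ completed d s (i + 1) ↔ t ∈ completed d s i ∨ t ∈ d.block s (d.γ i) := by
  rw [← initial_of_end hs h, mem_completed, mem_completed, mem_initial]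
  constructor
  · rintro ⟨h1, h2, -⟩
    by_cases h3 : d.γ t = d.γ i
    · exact Or.inr ⟨⟨h1, h3⟩, by omega⟩
    · refine Or.inl ⟨h1, ?_, fun h => h3 h.2⟩
      have : t ≠ i := fun h => h3 (by rw [h])
      omega
  · have key : t ≤ i → ¬ (i + 1 < d.n ∧ d.γ t = d.γ (i + 1)) := by
      rintro h1 ⟨h2, h3⟩
      rcases h with h | h
      · omega
      · exact h (h3.symm.trans ((d.γ_eq_of_between h1 (Nat.le_succ i) h2 h3).symm ▸ h3))
    rintro (⟨h1, h2, -⟩ | ⟨h1, h2⟩)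
    · exact ⟨h1, by omega, key (by omega)⟩
    · exact ⟨h1.1, by omega, key h2⟩

theorem γ_lt_of_mem_completed {s : Finset ℕ} {i t : ℕ} (hi : i < d.n)
    (h : t ∈ completed d s i) : d.γ t < d.γ i := by
  rw [mem_completed] at h
  exact lt_of_le_of_ne (d.γ_mono h.2.1.le hi) fun h1 => h.2.2 ⟨hi, h1⟩

theorem completed_last {s : Finset ℕ} (hs : ∀ t ∈ s, t < d.n) : completed d s d.n = s := by
  ext t
  rw [mem_completed]
  exact ⟨fun h => h.1, fun h => ⟨h, hs t h, fun h => absurd h.1 (lt_irrefl _)⟩⟩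

theorem isGroup_block {α : Agg} {D : ℕ} (hS : S.Valid d α D) {s : Finset ℕ}
    (hs : ∀ t ∈ s, t < d.n) (hc : S.Closed d s) {g : ℚ} (hne : (d.block s g).Nonempty) :
    S.IsGroup d (d.block s g) where
  sub t ht := hs t (d.mem_block.1 ht).1
  ne := hne
  eq t ht u hu := (d.mem_block.1 ht).2.trans (d.mem_block.1 hu).2.symm
  closed i hi hin h := by
    rw [d.mem_block, d.mem_block, hS.conn_γ i hi hin h, hc i hi hin h]

/-! ### Soundness: every run of the automaton selects a monotonic set. -/

section Sound

variable {X : ℕ → ℕ → ℕ}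

/-- Counters are reset at the start of a group, and the guesses are frozen within it. So at every
moment the counters belong to one and the same guess. -/
theorem Step.sum_initial (hstep : ∀ i < d.n, S.Step d i (X i) (X (i + 1))) {s : Finset ℕ}
    (hs : ∀ i, i ∈ s ↔ i < d.n ∧ X (i + 1) 12 = 1) (i : ℕ) (hi : i < d.n) :
    ∀ l < 4, X (i + 1) l = ∑ t ∈ initial d s i, S.wt l t (X (i + 1) 4) (X (i + 1) 5) := by
  induction i with
  | zero =>
    intro l hl
    have h := hstep 0 hi
    have hst : IsStart d 0 := Or.inl rfl
    rw [sum_initial_of_start hi hst, h.start hst l hl]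
    have := h.bit
    split_ifs with h1
    · rw [hs] at h1; rw [h1.2, one_mul]
    · rw [hs] at h1
      have : X (0 + 1) 12 = 0 := by
        by_contra h2; exact h1 ⟨hi, by omega⟩
      rw [this, zero_mul]
  | succ i ih =>
    intro l hl
    have h := hstep (i + 1) hi
    have hbit : X (i + 1 + 1) 12 * S.wt l (i + 1) (X (i + 1 + 1) 4) (X (i + 1 + 1) 5) =
        if i + 1 ∈ s then S.wt l (i + 1) (X (i + 1 + 1) 4) (X (i + 1 + 1) 5) else 0 := by
      have := h.bit
      split_ifs with h1
      · rw [hs] at h1; rw [h1.2, one_mul]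
      · rw [hs] at h1
        have : X (i + 1 + 1) 12 = 0 := by
          by_contra h2; exact h1 ⟨hi, by omega⟩
        rw [this, zero_mul]
    by_cases hst : IsStart d (i + 1)
    · rw [sum_initial_of_start hi hst, ← hbit]
      exact h.start hst l hl
    · rw [sum_initial_of_not_start hst, ← hbit, h.count hst l hl, ih (by omega) l hl,
        (h.guess hst).1, (h.guess hst).2]
      rfl

/-- The automaton compares a finished nonempty group only with the last one before it; transitivity
gives the comparison with all earlier ones. -/
theorem Step.mono {α : Agg} {D : ℕ} (hS : S.Valid d α D) (h0 : ∀ l, X 0 l = 0)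
    (hstep : ∀ i < d.n, S.Step d i (X i) (X (i + 1))) {s : Finset ℕ}
    (hs : ∀ i, i ∈ s ↔ i < d.n ∧ X (i + 1) 12 = 1) : d.Mono α s := by
  have hsn : ∀ t ∈ s, t < d.n := fun t ht => ((hs t).1 ht).1
  have hclosed : S.Closed d s := by
    intro i hi hin hc
    have h := (hstep i hin).conn ⟨hi, hc⟩
    rw [hs, hs, h, Nat.sub_add_cancel hi]
    exact ⟨fun h => ⟨hin, h.2⟩, fun h => ⟨by omega, h.2⟩⟩
  -- Entry `6` is the size of the last nonempty finished group, so `0` means that there is none.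
  -- Otherwise entries `6` to `11` certify the finished group with the greatest `γ`.
  have key : ∀ i ≤ d.n,
      (X i 6 = 0 → completed d s i = ∅) ∧
      (X i 6 ≠ 0 → ∃ u ∈ completed d s i, (∀ t ∈ completed d s i, d.γ t ≤ d.γ u) ∧
        S.Cert d (d.block s (d.γ u)) (prev (X i))) ∧
      (∀ t ∈ completed d s i, ∀ u ∈ completed d s i, d.γ t ≤ d.γ u →
        d.agg α (d.block s (d.γ t)) ≤ d.agg α (d.block s (d.γ u))) := by
    intro i
    induction i with
    | zero =>
      intro _
      have : completed d s 0 = ∅ := by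
        ext t; rw [mem_completed]; simp
      exact ⟨fun _ => this, fun h => absurd (h0 6) h, by rw [this]; simp⟩
    | succ i ih =>
      intro hi
      obtain ⟨ih1, ih2, ih3⟩ := ih (by omega)
      have hin : i < d.n := by omega
      have h := hstep i hin
      have hsum := Step.sum_initial hstep hs i hin
      by_cases he : IsEnd d i
      · rw [initial_of_end hsn he] at hsum
        have hcard : X (i + 1) 0 = (d.block s (d.γ i)).card := by
          rw [hsum 0 (by norm_num), Finset.card_eq_sum_ones]
          exact Finset.sum_congr rfl fun t _ => hS.wt_zero _ _ _
        by_cases hne : (d.block s (d.γ i)).Nonempty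
        · have hpos : 0 < X (i + 1) 0 := by rw [hcard]; exact hne.card_pos
          obtain ⟨k1, k2, k3⟩ := h.complete ⟨he, hpos⟩
          have hcert : S.Cert d (d.block s (d.γ i)) (cur (X (i + 1))) :=
            { toIsGroup := isGroup_block hS hsn hclosed hne
              lt4 := h.lt4
              lt5 := h.lt5
              count := fun l => hsum l l.2
              final := k1 }
          obtain ⟨v, hv⟩ := hne
          have hv' := d.mem_block.1 hv
          have hmem := fun t => mem_completed_of_end (t := t) hsn he
          refine ⟨fun h6 => ?_, fun _ => ⟨v, (hmem v).2 (Or.inr hv), fun t ht => ?_, ?_⟩, ?_⟩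
          · have := congrFun k3 0
            simp only [prev, cur, Fin.coe_ofNat_eq_mod] at this
            rw [show X (i + 1) 6 = X (i + 1) 0 from this] at h6
            omega
          · rw [hv'.2]
            rcases (hmem t).1 ht with ht | ht
            · exact (γ_lt_of_mem_completed hin ht).le
            · exact (d.mem_block.1 ht).2.le
          · rw [hv'.2, k3]; exact hcert
          · intro t ht u hu htu
            rcases (hmem t).1 ht with ht | ht <;> rcases (hmem u).1 hu with hu | hu
            · exact ih3 t ht u hu htu
            · rw [(d.mem_block.1 hu).2]
              rcases Nat.eq_zero_or_pos (X i 6) with h6 | h6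
              · rw [ih1 h6] at ht; simp at ht
              · obtain ⟨w, hw, hw1, hw2⟩ := ih2 h6.ne'
                -- The comparison of an old group with the new one passes through the last old
                -- group, that of `w`.
                refine (ih3 t ht w hw (hw1 t ht)).trans ?_
                rcases k2 with k2 | k2
                · omega
                · exact (hS.le_iff _ _ _ _ hw2 hcert).1 k2.2.2
            · have h1 := γ_lt_of_mem_completed hin hu
              rw [(d.mem_block.1 ht).2] at htu
              exact absurd htu (not_le.2 h1)
            · rw [(d.mem_block.1 hu).2, (d.mem_block.1 ht).2]
        · have hpos : ¬ 0 < X (i + 1) 0 := by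
            rw [hcard, Finset.card_pos]; exact hne
          have k := h.keep fun h => hpos h.2
          have : completed d s (i + 1) = completed d s i := by
            ext t
            rw [mem_completed_of_end hsn he]
            rw [Finset.not_nonempty_iff_eq_empty] at hne
            simp [hne]
          have k6 : X (i + 1) 6 = X i 6 := congrFun k 0
          rw [this, k, k6]
          exact ⟨ih1, ih2, ih3⟩
      · have k := h.keep fun h => he h.1
        have k6 : X (i + 1) 6 = X i 6 := congrFun k 0
        rw [completed_of_not_end hin he, k, k6]
        exact ⟨ih1, ih2, ih3⟩
  have := (key d.n le_rfl).2.2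
  rw [completed_last hsn] at this
  exact this

end Sound

/-! ### Completeness: every closed monotonic set is selected by a run. -/

section Complete

open Classical in
/-- A certificate for the taken part of the group `g`. -/
noncomputable def blockCert (S : Scheme) (d : SortedCols) (s : Finset ℕ) (g : ℚ) : Fin 6 → ℕ :=
  if h : ∃ c, S.Cert d (d.block s g) c then h.choose else 0

theorem blockCert_spec {α : Agg} {D : ℕ} (hS : S.Valid d α D) {s : Finset ℕ}
    (hs : ∀ t ∈ s, t < d.n) (hc : S.Closed d s) {g : ℚ} (hne : (d.block s g).Nonempty) :
    S.Cert d (d.block s g) (S.blockCert d s g) := by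
  have h := hS.exists_cert _ (isGroup_block hS hs hc hne)
  rw [blockCert, dif_pos h]
  exact h.choose_spec

theorem blockCert_of_empty {s : Finset ℕ} {g : ℚ} (hne : ¬ (d.block s g).Nonempty) :
    S.blockCert d s g = 0 := by
  rw [blockCert, dif_neg]
  rintro ⟨c, hc⟩
  exact hne hc.ne

open Classical in
/-- The descriptor of the last complete group with a taken tuple before position `i`. -/
noncomputable def lastCert (S : Scheme) (d : SortedCols) (s : Finset ℕ) (i : ℕ) : Fin 6 → ℕ :=
  if h : (completed d s i).Nonempty then S.blockCert d s (d.γ ((completed d s i).max' h)) else 0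

open Classical in
/-- The states of the automaton on the choice `s`. -/
noncomputable def trace (S : Scheme) (d : SortedCols) (s : Finset ℕ) (i j : ℕ) : ℕ :=
  if i = 0 then 0 else
  if j < 4 then ∑ t ∈ initial d s (i - 1),
    S.wt j t (S.blockCert d s (d.γ (i - 1)) 4) (S.blockCert d s (d.γ (i - 1)) 5) else
  if j = 4 then S.blockCert d s (d.γ (i - 1)) 4 else
  if j = 5 then S.blockCert d s (d.γ (i - 1)) 5 else
  if h : j - 6 < 6 then S.lastCert d s i ⟨j - 6, h⟩ else
  if i - 1 ∈ s then 1 else 0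

variable {s : Finset ℕ}

theorem trace_zero (j : ℕ) : S.trace d s 0 j = 0 := by simp [trace]

theorem trace_count (i l : ℕ) (hl : l < 4) : S.trace d s (i + 1) l = ∑ t ∈ initial d s i,
    S.wt l t (S.blockCert d s (d.γ i) 4) (S.blockCert d s (d.γ i) 5) := by
  simp [trace, hl]

theorem trace_four (i : ℕ) : S.trace d s (i + 1) 4 = S.blockCert d s (d.γ i) 4 := by simp [trace]
theorem trace_five (i : ℕ) : S.trace d s (i + 1) 5 = S.blockCert d s (d.γ i) 5 := by simp [trace]

theorem trace_bit (i : ℕ) : S.trace d s (i + 1) 12 = if i ∈ s then 1 else 0 := by simp [trace]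

theorem prev_trace (i : ℕ) : prev (S.trace d s i) = S.lastCert d s i := by
  funext l
  rcases Nat.eq_zero_or_pos i with rfl | hi
  · have : completed d s 0 = ∅ := by ext t; rw [mem_completed]; simp
    simp [prev, trace, lastCert, this]
  · have h1 : ¬ (6 + (l : ℕ) < 4) := by omega
    have h2 : ¬ (6 + (l : ℕ) = 4) := by omega
    have h3 : ¬ (6 + (l : ℕ) = 5) := by omega
    simp only [prev, trace, hi.ne', h1, h2, h3, if_false, Nat.add_sub_cancel_left, l.2, dif_pos]

/-- Each weight satisfies `d.n * wt ≤ D - 1`, so `d.n` times the sum is at most `T.card * (D - 1) ≤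
d.n * (D - 1)`, and the positive factor `d.n` cancels. -/
theorem sum_wt_lt {α : Agg} {D : ℕ} (hS : S.Valid d α D) {T : Finset ℕ} (hT : ∀ t ∈ T, t < d.n)
    {g h l : ℕ} (hg : g < d.n) (hh : h < d.n) (hl : l < 4) : ∑ t ∈ T, S.wt l t g h < D := by
  have hD := hS.two_le
  have h1 : d.n * ∑ t ∈ T, S.wt l t g h ≤ d.n * (D - 1) := by
    rw [Finset.mul_sum]
    refine (Finset.sum_le_card_nsmul T _ (D - 1) fun t ht => ?_).trans ?_
    · have := hS.bound l hl t (hT t ht) g hg h hh; omega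
    · refine Nat.mul_le_mul_right _ ?_
      calc T.card ≤ (Finset.range d.n).card :=
            Finset.card_le_card fun t ht => by simpa using hT t ht
        _ = d.n := by simp
  have := Nat.le_of_mul_le_mul_left h1 (by omega)
  omega

theorem Cert.lt {α : Agg} {D : ℕ} (hS : S.Valid d α D) {T : Finset ℕ} {c : Fin 6 → ℕ}
    (h : S.Cert d T c) (l : Fin 6) : c l < D := by
  have hn : d.n < D := by
    have := hS.bound 0 (by norm_num) (c 4) h.lt4 _ h.lt4 _ h.lt4
    rwa [hS.wt_zero, mul_one] at this
  have h1 : ∀ l : Fin 4, c (Fin.castLE (by norm_num) l) < D := fun l => by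
    rw [h.count l]; exact sum_wt_lt hS h.sub h.lt4 h.lt5 l.2
  fin_cases l
  · exact h1 0
  · exact h1 1
  · exact h1 2
  · exact h1 3
  · exact h.lt4.trans hn
  · exact h.lt5.trans hn

theorem blockCert_lt {α : Agg} {D : ℕ} (hS : S.Valid d α D) (hs : ∀ t ∈ s, t < d.n)
    (hc : S.Closed d s) (g : ℚ) (l : Fin 6) : S.blockCert d s g l < D := by
  by_cases hne : (d.block s g).Nonempty
  · exact (blockCert_spec hS hs hc hne).lt hS l
  · rw [blockCert_of_empty hne]
    have := hS.two_le
    simp only [Pi.zero_apply]; omega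

theorem blockCert_guess {α : Agg} {D : ℕ} (hS : S.Valid d α D) (hs : ∀ t ∈ s, t < d.n)
    (hc : S.Closed d s) (hn : 0 < d.n) (g : ℚ) :
    S.blockCert d s g 4 < d.n ∧ S.blockCert d s g 5 < d.n := by
  by_cases hne : (d.block s g).Nonempty
  · exact ⟨(blockCert_spec hS hs hc hne).lt4, (blockCert_spec hS hs hc hne).lt5⟩
  -- A group without taken positions gets the default guess `0`, which is a position because `d.n`
  -- is positive.
  · rw [blockCert_of_empty hne]; exact ⟨hn, hn⟩

theorem trace_lt {α : Agg} {D : ℕ} (hS : S.Valid d α D) (hs : ∀ t ∈ s, t < d.n)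
    (hc : S.Closed d s) {i : ℕ} (hi : i ≤ d.n) (j : ℕ) : S.trace d s i j < D := by
  have hD := hS.two_le
  rcases i with _ | i
  · rw [trace_zero]; omega
  · have hg := blockCert_guess hS hs hc (by omega) (d.γ i)
    by_cases hj : j < 4
    · rw [trace_count i j hj]
      exact sum_wt_lt hS (fun t ht => hs t (mem_initial.1 ht).1.1) hg.1 hg.2 hj
    · rw [trace, if_neg (by omega), if_neg hj]
      split_ifs with h1 h2 h3 h4
      · exact blockCert_lt hS hs hc _ _
      · exact blockCert_lt hS hs hc _ _
      · rw [lastCert]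
        split_ifs
        · exact blockCert_lt hS hs hc _ _
        · simp only [Pi.zero_apply]; omega
      · omega
      · omega

/-- The trace uses, throughout a group, the guesses of a certificate for its complete taken part. At
the end of the group the counters agree with that certificate, so the final test and the comparison
succeed. -/
theorem step_trace {α : Agg} {D : ℕ} (hS : S.Valid d α D) (hs : ∀ t ∈ s, t < d.n)
    (hc : S.Closed d s) (hm : d.Mono α s) (i : ℕ) (hi : i < d.n) :
    S.Step d i (S.trace d s i) (S.trace d s (i + 1)) := by
  have hg := blockCert_guess hS hs hc (by omega) (d.γ i)
  have hbit : ∀ l, (if i ∈ s then 1 else 0) * S.wt l i (S.blockCert d s (d.γ i) 4)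
      (S.blockCert d s (d.γ i) 5) = if i ∈ s then S.wt l i (S.blockCert d s (d.γ i) 4)
      (S.blockCert d s (d.γ i) 5) else 0 := fun l => by split_ifs <;> simp
  have hend : IsEnd d i → S.trace d s (i + 1) 0 = (d.block s (d.γ i)).card := by
    intro he
    rw [trace_count i 0 (by norm_num), initial_of_end hs he, Finset.card_eq_sum_ones]
    exact Finset.sum_congr rfl fun t _ => hS.wt_zero _ _ _
  refine ⟨?_, ?_, ?_, ?_, ?_, ?_, ?_, ?_, ?_⟩
  · rw [trace_bit]; split_ifs <;> omega
  · rintro ⟨h1, h2⟩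
    obtain ⟨k, rfl⟩ : ∃ k, i = k + 1 := ⟨i - 1, by omega⟩
    have := hc (k + 1) h1 hi h2
    rw [Nat.add_sub_cancel] at this
    rw [trace_bit, trace_bit]
    simp only [this]
  · rw [trace_four]; exact hg.1
  · rw [trace_five]; exact hg.2
  · intro h
    simp only [IsStart, not_or, not_not] at h
    obtain ⟨k, rfl⟩ : ∃ k, i = k + 1 := ⟨i - 1, by omega⟩
    have h2 := h.2
    rw [Nat.add_sub_cancel] at h2
    rw [trace_four, trace_five, trace_four, trace_five, h2]
    exact ⟨rfl, rfl⟩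
  · intro h l hl
    rw [trace_four, trace_five, trace_bit, trace_count i l hl, hbit, sum_initial_of_start hi h]
  · intro h l hl
    rw [trace_four, trace_five, trace_bit, trace_count i l hl, hbit, sum_initial_of_not_start h]
    simp only [IsStart, not_or, not_not] at h
    obtain ⟨k, rfl⟩ : ∃ k, i = k + 1 := ⟨i - 1, by omega⟩
    rw [trace_count k l hl]
    have h2 := h.2
    rw [Nat.add_sub_cancel] at h2 ⊢
    rw [h2]
  · rintro ⟨he, hpos⟩
    rw [hend he, Finset.card_pos] at hpos
    have hcert := blockCert_spec hS hs hc hpos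
    have hcur : cur (S.trace d s (i + 1)) = S.blockCert d s (d.γ i) := by
      have h4 : ∀ l : Fin 4, S.trace d s (i + 1) l =
          S.blockCert d s (d.γ i) (Fin.castLE (by norm_num) l) := fun l => by
        rw [trace_count i l l.2, initial_of_end hs he, hcert.count l]
      funext l
      fin_cases l
      · exact h4 0
      · exact h4 1
      · exact h4 2
      · exact h4 3
      · exact trace_four i
      · exact trace_five i
    -- The largest finished taken position lies in the group just closed; otherwise its `γ` would be
    -- smaller than that of the earlier position `v`.
    have hlast : S.lastCert d s (i + 1) = S.blockCert d s (d.γ i) := by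
      obtain ⟨v, hv⟩ := hpos
      have hmem := fun t => mem_completed_of_end (t := t) hs he
      have hne : (completed d s (i + 1)).Nonempty := ⟨v, (hmem v).2 (Or.inr hv)⟩
      rw [lastCert, dif_pos hne]
      congr 1
      have h1 := Finset.max'_mem _ hne
      rw [hmem] at h1
      rcases h1 with h1 | h1
      · have h2 := γ_lt_of_mem_completed hi h1
        have h3 : v ≤ _ := Finset.le_max' _ v ((hmem v).2 (Or.inr hv))
        have h4 := d.γ_mono h3 (hs _ (mem_completed.1 h1).1)
        rw [(d.mem_block.1 hv).2] at h4
        exact absurd h2 (not_lt.2 h4)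
      · exact (d.mem_block.1 h1).2
    refine ⟨by rw [hcur]; exact hcert.final, ?_, by rw [prev_trace, hcur, hlast]⟩
    by_cases hne : (completed d s i).Nonempty
    · right
      have hu := Finset.max'_mem _ hne
      set u := (completed d s i).max' hne with hu'
      have hus := (mem_completed.1 hu).1
      have hune : (d.block s (d.γ u)).Nonempty := ⟨u, d.mem_block.2 ⟨hus, rfl⟩⟩
      have hp : prev (S.trace d s i) = S.blockCert d s (d.γ u) := by
        rw [prev_trace, lastCert, dif_pos hne]
      have hcu := blockCert_spec hS hs hc hune
      refine ⟨?_, ?_, ?_⟩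
      · have := congrFun hp 4
        rw [show S.trace d s i 10 = _ from this]; exact hcu.lt4
      · have := congrFun hp 5
        rw [show S.trace d s i 11 = _ from this]; exact hcu.lt5
      · rw [hp, hcur, hS.le_iff _ _ _ _ hcu hcert]
        obtain ⟨v, hv⟩ := hpos
        have hv := d.mem_block.1 hv
        have := hm u hus v hv.1 (by rw [hv.2]; exact (γ_lt_of_mem_completed hi hu).le)
        rwa [hv.2] at this
    -- With no finished nonempty group the stored descriptor is the default `0`, in particular at
    -- entry `6`.
    · left
      have := congrFun (prev_trace (S := S) (d := d) (s := s) i) 0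
      rw [lastCert, dif_neg hne] at this
      exact this
  · intro h
    rw [prev_trace, prev_trace]
    have : completed d s (i + 1) = completed d s i := by
      by_cases he : IsEnd d i
      · have hne : ¬ (d.block s (d.γ i)).Nonempty := fun h1 => h ⟨he, by
          rw [hend he]; exact h1.card_pos⟩
        rw [Finset.not_nonempty_iff_eq_empty] at hne
        ext t
        rw [mem_completed_of_end hs he, hne]; simp
      · exact completed_of_not_end hi he
    unfold lastCert
    simp only [this]

end Complete

/-! ### Packing states into numbers -/

/-- Digit `j` of `q` in base `D`. -/
def digit (D q j : ℕ) : ℕ := q / D ^ j % D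

theorem exists_digits {D : ℕ} (hD : 0 < D) (m : ℕ) : ∀ f : ℕ → ℕ, (∀ j < m, f j < D) →
    ∃ q < D ^ m, ∀ j < m, digit D q j = f j := by
  induction m with
  | zero => exact fun f _ => ⟨0, by simp, fun j hj => absurd hj (by omega)⟩
  | succ m ih =>
    intro f hf
    obtain ⟨q, hq, h⟩ := ih (fun j => f (j + 1)) fun j hj => hf _ (by omega)
    have h0 := hf 0 (by omega)
    refine ⟨f 0 + D * q, ?_, fun j hj => ?_⟩
    · rw [pow_succ']
      calc f 0 + D * q < D * (q + 1) := by rw [Nat.mul_add]; omega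
        _ ≤ D * D ^ m := Nat.mul_le_mul_left _ hq
    · rcases j with _ | j
      · simp [digit, Nat.mod_eq_of_lt h0]
      · rw [← h j (by omega), digit, digit, pow_succ', ← Nat.div_div_eq_div_mul,
          Nat.add_mul_div_left _ _ hD, Nat.div_eq_of_lt h0, zero_add]

def PackedStep (S : Scheme) (d : SortedCols) (D i x y : ℕ) : Prop :=
  S.Step d i (digit D x) (digit D y)

/-- A step looks only at the entries `0` to `12`; thirteen digits therefore suffice for packing a
state. -/
theorem Step.congr {i : ℕ} {X Y X' Y' : ℕ → ℕ} (h : S.Step d i X Y) (hX : ∀ j < 13, X' j = X j)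
    (hY : ∀ j < 13, Y' j = Y j) : S.Step d i X' Y' := by
  have e1 : cur Y' = cur Y := funext fun l => hY l (by omega)
  have e2 : prev Y' = prev Y := funext fun l => hY _ (by omega)
  have e3 : prev X' = prev X := funext fun l => hX _ (by omega)
  have y12 := hY 12 (by norm_num)
  have y4 := hY 4 (by norm_num)
  have y5 := hY 5 (by norm_num)
  have y0 := hY 0 (by norm_num)
  refine ⟨?_, ?_, ?_, ?_, ?_, ?_, ?_, ?_, ?_⟩
  · rw [y12]; exact h.bit
  · rw [y12, hX 12 (by norm_num)]; exact h.conn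
  · rw [y4]; exact h.lt4
  · rw [y5]; exact h.lt5
  · rw [y4, y5, hX 4 (by norm_num), hX 5 (by norm_num)]; exact h.guess
  · intro hs l hl; rw [hY l (by omega), y4, y5, y12]; exact h.start hs l hl
  · intro hs l hl; rw [hY l (by omega), hX l (by omega), y4, y5, y12]; exact h.count hs l hl
  · rw [e1, e2, e3, y0, hX 6 (by norm_num), hX 10 (by norm_num), hX 11 (by norm_num)]
    exact h.complete
  · rw [e2, e3, y0]; exact h.keep

open Classical in
/-- The positions taken along a heaviest path of the automaton. -/
noncomputable def taken (S : Scheme) (d : SortedCols) (D N : ℕ) : Finset ℕ :=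
  (Finset.range d.n).filter fun i =>
    digit D (back N (D ^ 13) (S.PackedStep d D) (fun y => digit D y 12) d.n (d.n - (i + 1))) 12 = 1

theorem taken_spec {α : Agg} {D N : ℕ} (hS : S.Valid d α D) (hN : D ^ 13 ≤ N) :
    d.Mono α (S.taken d D N) ∧ ∀ s : Finset ℕ, (∀ t ∈ s, t < d.n) → d.Mono α s →
      s.card ≤ (S.taken d D N).card := by
  classical
  have hD : 0 < D := by have := hS.two_le; omega
  set w : ℕ → ℕ := fun y => digit D y 12 with hw
  have path : ∀ s : Finset ℕ, (∀ t ∈ s, t < d.n) → d.Mono α s → S.Closed d s →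
      ∃ Y, IsPath (D ^ 13) (S.PackedStep d D) d.n Y ∧
        s.card = ∑ i ∈ Finset.range d.n, w (Y (i + 1)) := by
    intro s hs hm hc
    -- A path has to begin in state `0`, and this number packs the initial trace, all of whose
    -- entries vanish.
    have hex : ∀ i, ∃ q, (i = 0 → q = 0) ∧ (i ≤ d.n → q < D ^ 13 ∧
        ∀ j < 13, digit D q j = S.trace d s i j) := by
      intro i
      rcases Nat.eq_zero_or_pos i with rfl | hi
      · exact ⟨0, fun _ => rfl, fun _ => ⟨by positivity, fun j _ => by
          simp [trace_zero, digit]⟩⟩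
      · by_cases hin : i ≤ d.n
        · obtain ⟨q, hq, h⟩ := exists_digits hD 13 (S.trace d s i)
            fun j _ => trace_lt hS hs hc hin j
          exact ⟨q, fun h => absurd h hi.ne', fun _ => ⟨hq, h⟩⟩
        · exact ⟨0, fun _ => rfl, fun h => absurd h hin⟩
    choose Y hY0 hY using hex
    refine ⟨Y, ⟨hY0 0 rfl, fun i hi => (hY i hi).1, fun i hi => ?_⟩, ?_⟩
    · exact (step_trace hS hs hc hm i hi).congr (hY i hi.le).2 (hY (i + 1) hi).2
    · have : s = (Finset.range d.n).filter fun i => i ∈ s := by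
        ext t; simp only [Finset.mem_filter, Finset.mem_range]
        exact ⟨fun h => ⟨hs t h, h⟩, fun h => h.2⟩
      rw [this, Finset.card_filter]
      refine Finset.sum_congr rfl fun i hi => ?_
      rw [hw]
      simp only
      rw [(hY (i + 1) (by simpa using hi)).2 12 (by norm_num), trace_bit]
  -- The empty choice is monotonic and closed, so there is at least one path and backtracking is
  -- meaningful.
  obtain ⟨Y, hY, -⟩ := path ∅ (by simp) (by intro t ht; simp at ht)
    (fun i _ _ _ => by simp)
  obtain ⟨hp, hmax⟩ := isPath_back (w := w) hN hY
  set B := back N (D ^ 13) (S.PackedStep d D) w d.n with hB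
  have hcard : (S.taken d D N).card = ∑ i ∈ Finset.range d.n, w (B (d.n - (i + 1))) := by
    rw [taken, Finset.card_filter]
    refine Finset.sum_congr rfl fun i hi => ?_
    have h : digit D (B (d.n - (i + 1))) 12 ≤ 1 := (hp.rel i (by simpa using hi)).bit
    change (if w (B (d.n - (i + 1))) = 1 then 1 else 0) = w (B (d.n - (i + 1)))
    change w (B (d.n - (i + 1))) ≤ 1 at h
    split_ifs with h1
    · exact h1.symm
    · omega
  constructor
  · refine Step.mono (S := S) (X := fun i => digit D (B (d.n - i))) hS (fun l => ?_)
      (fun i hi => hp.rel i hi) fun i => ?_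
    · have := hp.zero
      simp only [this]
      simp [digit]
    · simp [taken, hB, hw]
  · intro s hs hm
    obtain ⟨s', hs', hm', hc', hle⟩ := hS.saturate s hs hm
    obtain ⟨Y', hY', hc⟩ := path s' hs' hm' hc'
    rw [hcard]
    exact hle.trans (hc ▸ hmax Y' hY')

end Scheme

end AODRepair

namespace AODRepair

/-! ### Schemes for the aggregate functions -/

namespace Scheme

variable {d : SortedCols} {S : Scheme}

/-- The descriptor of a group with given guesses. -/
def desc (S : Scheme) (T : Finset ℕ) (g h : ℕ) : Fin 6 → ℕ :=
  ![∑ t ∈ T, S.wt 0 t g h, ∑ t ∈ T, S.wt 1 t g h, ∑ t ∈ T, S.wt 2 t g h,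
    ∑ t ∈ T, S.wt 3 t g h, g, h]

theorem cert_desc {T : Finset ℕ} {g h : ℕ} (hT : S.IsGroup d T) (hg : g < d.n) (hh : h < d.n)
    (hf : S.fin (S.desc T g h)) : S.Cert d T (S.desc T g h) where
  toIsGroup := hT
  lt4 := hg
  lt5 := hh
  count l := by fin_cases l <;> rfl
  final := hf

theorem Cert.eq_desc {T : Finset ℕ} {c : Fin 6 → ℕ} (h : S.Cert d T c) :
    c = S.desc T (c 4) (c 5) := by
  funext l
  fin_cases l
  · exact h.count 0
  · exact h.count 1
  · exact h.count 2
  · exact h.count 3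
  · rfl
  · rfl

/-- When no positions are tied together every choice is closed, so nothing has to be saturated; and
guesses can be taken from the group itself. -/
theorem valid_of_not_conn {α : Agg} {D : ℕ} (hc : ∀ i, ¬ S.conn i)
    (h0 : ∀ t g h, S.wt 0 t g h = 1)
    (hb : ∀ l < 4, ∀ t < d.n, ∀ g < d.n, ∀ h < d.n, d.n * S.wt l t g h < D) (h2 : 2 ≤ D)
    (hle : ∀ T g h T' g' h', S.Cert d T (S.desc T g h) → S.Cert d T' (S.desc T' g' h') →
      (S.le (S.desc T g h) (S.desc T' g' h') ↔ d.agg α T ≤ d.agg α T'))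
    (hex : ∀ T, S.IsGroup d T → ∃ g ∈ T, ∃ h ∈ T, S.fin (S.desc T g h)) : S.Valid d α D where
  wt_zero := h0
  bound := hb
  two_le := h2
  conn_γ i _ _ h := absurd h (hc i)
  le_iff T c T' c' h h' := by
    have h1 := h
    have h1' := h'
    rw [h.eq_desc] at h1 ⊢
    rw [h'.eq_desc] at h1' ⊢
    exact hle _ _ _ _ _ _ h1 h1'
  exists_cert T hT := by
    obtain ⟨g, hg, h, hh, hf⟩ := hex T hT
    exact ⟨_, cert_desc hT (hT.sub g hg) (hT.sub h hh) hf⟩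
  saturate s hs hm := ⟨s, hs, hm, fun i _ _ h => absurd h (hc i), le_rfl⟩

/-! ### The schemes for the seven aggregate functions. -/

open Classical in
-- The guess is a position of the maximum. Counter `1` checks that it is taken, and equality of
-- counters `2` and `0` checks that no taken value exceeds the one there.
noncomputable def maxScheme (d : SortedCols) : Scheme where
  wt l t g _ := if l = 0 then 1 else if l = 1 then (if t = g then 1 else 0)
    else if l = 2 then (if d.a t ≤ d.a g then 1 else 0) else 0
  fin c := c 1 = 1 ∧ c 2 = c 0
  le c c' := d.a (c 4) ≤ d.a (c' 4)
  conn _ := False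

open Classical in
noncomputable def minScheme (d : SortedCols) : Scheme where
  wt l t g _ := if l = 0 then 1 else if l = 1 then (if t = g then 1 else 0)
    else if l = 2 then (if d.a g ≤ d.a t then 1 else 0) else 0
  fin c := c 1 = 1 ∧ c 2 = c 0
  le c c' := d.a (c 4) ≤ d.a (c' 4)
  conn _ := False

def countScheme : Scheme where
  wt l _ _ _ := if l = 0 then 1 else 0
  fin _ := True
  le c c' := c 0 ≤ c' 0
  conn _ := False

open Classical in
-- Equal values within a group are adjacent, and counter `1` counts the first positions of such
-- classes. Since `conn` lets a class be taken only as a whole, this is the number of distinct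
-- values.
noncomputable def countdScheme (d : SortedCols) : Scheme where
  wt l t _ _ := if l = 0 then 1 else if l = 1 then
    (if 0 < t ∧ d.γ (t - 1) = d.γ t ∧ d.a (t - 1) = d.a t then 0 else 1) else 0
  fin _ := True
  le c c' := c 1 ≤ c' 1
  conn t := d.γ (t - 1) = d.γ t ∧ d.a (t - 1) = d.a t

/-- The guesses are the two middle positions, which coincide for odd size. Positions in a group are
ordered by value, so counting the taken positions before a guess determines its rank; counter `3`
equals `2` exactly when both guesses are taken. -/
def medianScheme (d : SortedCols) : Scheme where
  wt l t g h := if l = 0 then 1 else if l = 1 then (if t < g then 1 else 0)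
    else if l = 2 then (if t < h then 1 else 0)
    else if l = 3 then (if t = g then 1 else 0) + (if t = h then 1 else 0) else 0
  fin c := c 1 = (c 0 - 1) / 2 ∧ c 2 = c 0 / 2 ∧ c 3 = 2
  le c c' := d.a (c 4) + d.a (c 5) ≤ d.a (c' 4) + d.a (c' 5)
  conn _ := False

/-- Counters are natural numbers, so every value is shifted by `W`; the comparison subtracts `W`
times the size of the group again. -/
def sumScheme (z : ℕ → ℤ) (W : ℕ) : Scheme where
  wt l t _ _ := if l = 0 then 1 else if l = 1 then (z t + W).toNat else 0
  fin _ := True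
  le c c' := (c 1 : ℤ) - W * c 0 ≤ c' 1 - W * c' 0
  conn _ := False

def avgScheme (z : ℕ → ℤ) (W : ℕ) : Scheme where
  wt l t _ _ := if l = 0 then 1 else if l = 1 then (z t + W).toNat else 0
  fin _ := True
  le c c' := ((c 1 : ℤ) - W * c 0) * c' 0 ≤ (c' 1 - W * c' 0) * c 0
  conn _ := False

/-! ### The aggregates of a set of positions. -/

theorem agg_max {T : Finset ℕ} {g : ℕ} (hg : g ∈ T) (h : ∀ t ∈ T, d.a t ≤ d.a g) :
    d.agg .max T = d.a g := by
  have : (T.val.map d.a).toFinset.max = (d.a g : WithBot ℚ) := by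
    refine le_antisymm (Finset.max_le fun q hq => ?_) (Finset.le_max ?_)
    · simp only [Multiset.mem_toFinset, Multiset.mem_map, Finset.mem_val] at hq
      obtain ⟨t, ht, rfl⟩ := hq
      exact_mod_cast h t ht
    · simp only [Multiset.mem_toFinset, Multiset.mem_map, Finset.mem_val]
      exact ⟨g, hg, rfl⟩
  simp only [SortedCols.agg, Agg.eval, this, WithBot.unbotD_coe]

theorem agg_min {T : Finset ℕ} {g : ℕ} (hg : g ∈ T) (h : ∀ t ∈ T, d.a g ≤ d.a t) :
    d.agg .min T = d.a g := by
  have : (T.val.map d.a).toFinset.min = (d.a g : WithTop ℚ) := by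
    refine le_antisymm (Finset.min_le ?_) (Finset.le_min fun q hq => ?_)
    · simp only [Multiset.mem_toFinset, Multiset.mem_map, Finset.mem_val]
      exact ⟨g, hg, rfl⟩
    · simp only [Multiset.mem_toFinset, Multiset.mem_map, Finset.mem_val] at hq
      obtain ⟨t, ht, rfl⟩ := hq
      exact_mod_cast h t ht
  simp only [SortedCols.agg, Agg.eval, this, WithTop.untopD_coe]

theorem agg_count (T : Finset ℕ) : d.agg .count T = T.card := by
  simp [SortedCols.agg, Agg.eval]

theorem agg_countd (T : Finset ℕ) : d.agg .countd T = (T.image d.a).card := rfl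

theorem agg_sum (T : Finset ℕ) : d.agg .sum T = ∑ t ∈ T, d.a t := rfl

theorem agg_avg (T : Finset ℕ) : d.agg .avg T = (∑ t ∈ T, d.a t) / T.card := by
  simp [SortedCols.agg, Agg.eval]

theorem card_filter_lt_orderEmbOfFin {T : Finset ℕ} (i : Fin T.card) :
    (T.filter fun t => t < T.orderEmbOfFin rfl i).card = i := by
  have : T.filter (fun t => t < T.orderEmbOfFin rfl i) =
      (Finset.Iio i).map (T.orderEmbOfFin rfl).toEmbedding := by
    ext t
    simp only [Finset.mem_filter, Finset.mem_map, Finset.mem_Iio]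
    constructor
    · rintro ⟨h1, h2⟩
      obtain ⟨j, rfl⟩ : t ∈ Set.range (T.orderEmbOfFin rfl) := by
        rw [Finset.range_orderEmbOfFin]; exact h1
      exact ⟨j, (T.orderEmbOfFin rfl).lt_iff_lt.1 h2, rfl⟩
    · rintro ⟨j, hj, rfl⟩
      exact ⟨Finset.orderEmbOfFin_mem _ _ _, (T.orderEmbOfFin rfl).lt_iff_lt.2 hj⟩
  rw [this, Finset.card_map, Fin.card_Iio]

theorem exists_card_filter_lt (T : Finset ℕ) (k : ℕ) (hk : k < T.card) :
    ∃ g ∈ T, (T.filter fun t => t < g).card = k :=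
  ⟨_, Finset.orderEmbOfFin_mem _ _ _, card_filter_lt_orderEmbOfFin ⟨k, hk⟩⟩

theorem eq_sort_getElem {T : Finset ℕ} {g k : ℕ} (hg : g ∈ T)
    (hk : (T.filter fun t => t < g).card = k) :
    ∃ h : k < (T.sort (· ≤ ·)).length, (T.sort (· ≤ ·))[k] = g := by
  obtain ⟨i, rfl⟩ : g ∈ Set.range (T.orderEmbOfFin rfl) := by
    rw [Finset.range_orderEmbOfFin]; exact hg
  rw [card_filter_lt_orderEmbOfFin] at hk
  subst hk
  exact ⟨by simp, rfl⟩

theorem agg_median {T : Finset ℕ} (hT : ∀ t ∈ T, t < d.n) (hγ : ∀ t ∈ T, ∀ u ∈ T, d.γ t = d.γ u)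
    {g h : ℕ} (hg : g ∈ T) (hh : h ∈ T)
    (hgc : (T.filter fun t => t < g).card = (T.card - 1) / 2)
    (hhc : (T.filter fun t => t < h).card = T.card / 2) :
    d.agg .median T = (d.a g + d.a h) / 2 := by
  -- Within one group the value is monotone in the position, so sorting positions sorts the bag.
  have hsort : (T.val.map d.a).sort (· ≤ ·) = (T.sort (· ≤ ·)).map d.a := by
    refine List.Perm.eq_of_pairwise' (r := (· ≤ ·)) (Multiset.pairwise_sort _ _) ?_ ?_
    · rw [List.pairwise_map]
      refine (T.sortedLT_sort.pairwise.imp_of_mem fun {t u} ht hu htu => ?_)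
      have ht' := (Finset.mem_sort _).1 ht
      have hu' := (Finset.mem_sort _).1 hu
      rcases d.sorted t u htu (hT u hu') with h | h
      · exact absurd (hγ t ht' u hu') h.ne
      · exact h.2
    · rw [← Multiset.coe_eq_coe, Multiset.sort_eq, ← Multiset.map_coe, Finset.sort_eq]
  obtain ⟨h1, h2⟩ := eq_sort_getElem hg hgc
  obtain ⟨h3, h4⟩ := eq_sort_getElem hh hhc
  simp only [SortedCols.agg, Agg.eval, hsort, List.length_map, Finset.length_sort]
  rw [List.getD_eq_getElem _ _ (by simpa using h1), List.getD_eq_getElem _ _ (by simpa using h3),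
    List.getElem_map, List.getElem_map, h2, h4]

/-! ### Validity of the schemes. -/

theorem valid_max {D : ℕ} (hD : 2 * d.n + 2 ≤ D) : (maxScheme d).Valid d .max D := by
  have hval : ∀ T g h, (maxScheme d).Cert d T ((maxScheme d).desc T g h) →
      d.agg .max T = d.a g := by
    intro T g h hc
    have h1 : ∑ t ∈ T, (if t = g then 1 else 0) = 1 := hc.final.1
    have h2 : ∑ t ∈ T, (if d.a t ≤ d.a g then 1 else 0) = ∑ t ∈ T, 1 := hc.final.2
    rw [Finset.sum_ite_eq'] at h1
    rw [← Finset.card_filter, ← Finset.card_eq_sum_ones, Finset.card_filter_eq_iff] at h2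
    refine agg_max ?_ h2
    by_contra h3
    simp [h3] at h1
  refine valid_of_not_conn (fun _ h => h) (fun _ _ _ => rfl) ?_ (by omega) ?_ ?_
  · intro l _ t _ g _ h _
    have : (maxScheme d).wt l t g h ≤ 2 := by
      simp only [maxScheme]; split_ifs <;> omega
    have := Nat.mul_le_mul_left d.n this
    omega
  · intro T g h T' g' h' hc hc'
    rw [hval _ _ _ hc, hval _ _ _ hc']
    rfl
  · intro T hT
    obtain ⟨g, hg, hmax⟩ := T.exists_max_image d.a hT.ne
    refine ⟨g, hg, g, hg, ?_, ?_⟩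
    · change ∑ t ∈ T, (if t = g then 1 else 0) = 1
      rw [Finset.sum_ite_eq', if_pos hg]
    · change ∑ t ∈ T, (if d.a t ≤ d.a g then 1 else 0) = ∑ t ∈ T, 1
      exact Finset.sum_congr rfl fun t ht => if_pos (hmax t ht)

theorem valid_min {D : ℕ} (hD : 2 * d.n + 2 ≤ D) : (minScheme d).Valid d .min D := by
  have hval : ∀ T g h, (minScheme d).Cert d T ((minScheme d).desc T g h) →
      d.agg .min T = d.a g := by
    intro T g h hc
    have h1 : ∑ t ∈ T, (if t = g then 1 else 0) = 1 := hc.final.1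
    have h2 : ∑ t ∈ T, (if d.a g ≤ d.a t then 1 else 0) = ∑ t ∈ T, 1 := hc.final.2
    rw [Finset.sum_ite_eq'] at h1
    rw [← Finset.card_filter, ← Finset.card_eq_sum_ones, Finset.card_filter_eq_iff] at h2
    refine agg_min ?_ h2
    by_contra h3
    simp [h3] at h1
  refine valid_of_not_conn (fun _ h => h) (fun _ _ _ => rfl) ?_ (by omega) ?_ ?_
  · intro l _ t _ g _ h _
    have : (minScheme d).wt l t g h ≤ 2 := by
      simp only [minScheme]; split_ifs <;> omega
    have := Nat.mul_le_mul_left d.n this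
    omega
  · intro T g h T' g' h' hc hc'
    rw [hval _ _ _ hc, hval _ _ _ hc']
    rfl
  · intro T hT
    obtain ⟨g, hg, hmin⟩ := T.exists_min_image d.a hT.ne
    refine ⟨g, hg, g, hg, ?_, ?_⟩
    · change ∑ t ∈ T, (if t = g then 1 else 0) = 1
      rw [Finset.sum_ite_eq', if_pos hg]
    · change ∑ t ∈ T, (if d.a g ≤ d.a t then 1 else 0) = ∑ t ∈ T, 1
      exact Finset.sum_congr rfl fun t ht => if_pos (hmin t ht)

theorem valid_count {D : ℕ} (hD : 2 * d.n + 2 ≤ D) : countScheme.Valid d .count D := by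
  refine valid_of_not_conn (fun _ h => h) (fun _ _ _ => rfl) ?_ (by omega) ?_ ?_
  · intro l _ t _ g _ h _
    have : countScheme.wt l t g h ≤ 2 := by
      simp only [countScheme]; split_ifs <;> omega
    have := Nat.mul_le_mul_left d.n this
    omega
  · intro T g h T' g' h' _ _
    rw [agg_count, agg_count, Nat.cast_le, Finset.card_eq_sum_ones, Finset.card_eq_sum_ones]
    rfl
  · intro T hT
    obtain ⟨g, hg⟩ := hT.ne
    exact ⟨g, hg, g, hg, trivial⟩

theorem valid_median {D : ℕ} (hD : 2 * d.n + 2 ≤ D) : (medianScheme d).Valid d .median D := by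
  have hcard : ∀ T g h, (medianScheme d).desc T g h 0 = T.card := fun T g h =>
    (Finset.card_eq_sum_ones T).symm
  have h1 : ∀ T g h, (medianScheme d).desc T g h 1 = (T.filter fun t => t < g).card :=
    fun T g h => (Finset.card_filter _ _).symm
  have h2 : ∀ T g h, (medianScheme d).desc T g h 2 = (T.filter fun t => t < h).card :=
    fun T g h => (Finset.card_filter _ _).symm
  have h3 : ∀ T g h, (medianScheme d).desc T g h 3 =
      (if g ∈ T then 1 else 0) + (if h ∈ T then 1 else 0) := by
    intro T g h
    rw [← Finset.sum_ite_eq' T g fun _ => 1, ← Finset.sum_ite_eq' T h fun _ => 1,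
      ← Finset.sum_add_distrib]
    rfl
  have hval : ∀ T g h, (medianScheme d).Cert d T ((medianScheme d).desc T g h) →
      d.agg .median T = (d.a g + d.a h) / 2 := by
    intro T g h hc
    obtain ⟨k1, k2, k3⟩ := hc.final
    rw [h1, hcard] at k1
    rw [h2, hcard] at k2
    rw [h3] at k3
    refine agg_median hc.sub hc.eq ?_ ?_ k1 k2
    · by_contra h; rw [if_neg h] at k3; split_ifs at k3 <;> omega
    · by_contra h; rw [if_neg h] at k3; split_ifs at k3 <;> omega
  refine valid_of_not_conn (fun _ h => h) (fun _ _ _ => rfl) ?_ (by omega) ?_ ?_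
  · intro l _ t _ g _ h _
    -- The weight `2` occurs in counter `3` at a position that is both guesses at once.
    have : (medianScheme d).wt l t g h ≤ 2 := by
      simp only [medianScheme]; split_ifs <;> omega
    have := Nat.mul_le_mul_left d.n this
    omega
  · intro T g h T' g' h' hc hc'
    rw [hval _ _ _ hc, hval _ _ _ hc', div_le_div_iff_of_pos_right (by norm_num)]
    rfl
  · intro T hT
    have hpos := hT.ne.card_pos
    obtain ⟨g, hg, hg'⟩ := exists_card_filter_lt T ((T.card - 1) / 2) (by omega)
    obtain ⟨h, hh, hh'⟩ := exists_card_filter_lt T (T.card / 2) (by omega)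
    refine ⟨g, hg, h, hh, ?_, ?_, ?_⟩
    · rw [h1, hcard, hg']
    · rw [h2, hcard, hh']
    · rw [h3, if_pos hg, if_pos hh]

theorem sum_toNat {z : ℕ → ℤ} {W : ℕ} (hz : ∀ t < d.n, d.a t = z t)
    (hW : ∀ t < d.n, (z t).natAbs ≤ W) {T : Finset ℕ} (hT : ∀ t ∈ T, t < d.n) :
    (((∑ t ∈ T, (z t + W).toNat : ℕ) : ℤ) - W * ((∑ _t ∈ T, 1 : ℕ) : ℤ) : ℤ) =
      ∑ t ∈ T, d.a t := by
  have h1 : ((∑ t ∈ T, (z t + W).toNat : ℕ) : ℤ) = ∑ t ∈ T, (z t + W) := by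
    rw [Nat.cast_sum]
    refine Finset.sum_congr rfl fun t ht => Int.toNat_of_nonneg ?_
    have := hW t (hT t ht)
    omega
  have h2 : ∑ t ∈ T, d.a t = ((∑ t ∈ T, z t : ℤ) : ℚ) := by
    rw [Int.cast_sum]
    exact Finset.sum_congr rfl fun t ht => hz t (hT t ht)
  rw [h1, h2, Finset.sum_add_distrib]
  simp [mul_comm]

theorem bound_sum {z : ℕ → ℤ} {W D : ℕ} (hW : ∀ t < d.n, (z t).natAbs ≤ W)
    (hD : (2 * d.n + 2) * (W + 1) ≤ D) (l t : ℕ) (ht : t < d.n) :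
    d.n * (if l = 0 then 1 else if l = 1 then (z t + W).toNat else 0) < D := by
  have h1 : (if l = 0 then 1 else if l = 1 then (z t + W).toNat else 0) ≤ 2 * (W + 1) := by
    have := hW t ht
    split_ifs <;> omega
  have h2 := Nat.mul_le_mul_left d.n h1
  nlinarith

theorem valid_sum {z : ℕ → ℤ} {W D : ℕ} (hz : ∀ t < d.n, d.a t = z t)
    (hW : ∀ t < d.n, (z t).natAbs ≤ W) (hD : (2 * d.n + 2) * (W + 1) ≤ D) :
    (sumScheme z W).Valid d .sum D := by
  refine valid_of_not_conn (fun _ h => h) (fun _ _ _ => rfl) ?_ (by nlinarith) ?_ ?_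
  · exact fun l _ t ht g _ h _ => bound_sum hW hD l t ht
  · intro T g h T' g' h' hc hc'
    rw [agg_sum, agg_sum, ← sum_toNat hz hW hc.sub, ← sum_toNat hz hW hc'.sub, Int.cast_le]
    rfl
  · intro T hT
    obtain ⟨g, hg⟩ := hT.ne
    exact ⟨g, hg, g, hg, trivial⟩

theorem valid_avg {z : ℕ → ℤ} {W D : ℕ} (hz : ∀ t < d.n, d.a t = z t)
    (hW : ∀ t < d.n, (z t).natAbs ≤ W) (hD : (2 * d.n + 2) * (W + 1) ≤ D) :
    (avgScheme z W).Valid d .avg D := by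
  refine valid_of_not_conn (fun _ h => h) (fun _ _ _ => rfl) ?_ (by nlinarith) ?_ ?_
  · exact fun l _ t ht g _ h _ => bound_sum hW hD l t ht
  · intro T g h T' g' h' hc hc'
    rw [agg_avg, agg_avg, div_le_div_iff₀ (by exact_mod_cast hc.ne.card_pos)
      (by exact_mod_cast hc'.ne.card_pos), ← sum_toNat hz hW hc.sub, ← sum_toNat hz hW hc'.sub,
      Finset.card_eq_sum_ones, Finset.card_eq_sum_ones]
    have key : ∀ (x y : ℤ) (m n : ℕ), (x : ℚ) * n ≤ y * m ↔ x * n ≤ y * m := fun x y m n => by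
      exact_mod_cast Iff.rfl
    rw [key]
    rfl
  · intro T hT
    obtain ⟨g, hg⟩ := hT.ne
    exact ⟨g, hg, g, hg, trivial⟩

/-- First positions of classes correspond to distinct values. Of two taken positions with equal
value, the later one has a predecessor of the same class and is no first position. Conversely, the
least taken position with a given value is a first position, since otherwise closedness would make
its predecessor taken as well. -/
theorem card_image_of_closed {T : Finset ℕ} (hT : (countdScheme d).IsGroup d T) :
    (T.image d.a).card = ∑ t ∈ T, (countdScheme d).wt 1 t 0 0 := by
  classical
  have : ∑ t ∈ T, (countdScheme d).wt 1 t 0 0 = (T.filter fun t =>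
      ¬ (0 < t ∧ d.γ (t - 1) = d.γ t ∧ d.a (t - 1) = d.a t)).card := by
    rw [Finset.card_filter]
    refine Finset.sum_congr rfl fun t _ => ?_
    simp only [countdScheme, ite_not]
    rfl
  rw [this]
  symm
  have amono : ∀ i j, i ≤ j → j ∈ T → i < d.n → d.γ i = d.γ j → d.a i ≤ d.a j := by
    intro i j hij hj _ hγ
    rcases hij.eq_or_lt with rfl | h
    · exact le_rfl
    · rcases d.sorted i j h (hT.sub j hj) with h | h
      · exact absurd hγ h.ne
      · exact h.2
  refine Finset.card_bij (fun t _ => d.a t) ?_ ?_ ?_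
  · intro t ht
    exact Finset.mem_image_of_mem _ (Finset.mem_filter.1 ht).1
  · have key : ∀ t u, t < u → t ∈ T → u ∈ T → d.a t = d.a u →
        0 < u ∧ d.γ (u - 1) = d.γ u ∧ d.a (u - 1) = d.a u := by
      intro t u htu ht hu ha
      have hun := hT.sub u hu
      have hγ : d.γ (u - 1) = d.γ u :=
        d.γ_eq_of_between (i := t) (by omega) (by omega) hun (hT.eq t ht u hu)
      refine ⟨by omega, hγ, le_antisymm (amono _ _ (by omega) hu (by omega) hγ) ?_⟩
      rw [← ha]
      rcases (show t ≤ u - 1 by omega).eq_or_lt with h | h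
      · rw [← h]
      · rcases d.sorted t (u - 1) h (by omega) with h1 | h1
        · rw [hγ, hT.eq t ht u hu] at h1; exact absurd h1 (lt_irrefl _)
        · exact h1.2
    intro t ht u hu ha
    rw [Finset.mem_filter] at ht hu
    rcases lt_trichotomy t u with h | h | h
    · exact absurd (key t u h ht.1 hu.1 ha) hu.2
    · exact h
    · exact absurd (key u t h hu.1 ht.1 ha.symm) ht.2
  · intro v hv
    obtain ⟨t, ht, rfl⟩ := Finset.mem_image.1 hv
    have hne : (T.filter fun u => d.a u = d.a t).Nonempty := ⟨t, by simp [ht]⟩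
    have hmem := Finset.min'_mem _ hne
    set u := (T.filter fun u => d.a u = d.a t).min' hne with hu
    rw [Finset.mem_filter] at hmem
    refine ⟨u, Finset.mem_filter.2 ⟨hmem.1, fun hcon => ?_⟩, hmem.2⟩
    have h1 := (hT.closed u hcon.1 (hT.sub u hmem.1) hcon.2).2 hmem.1
    have h2 := Finset.min'_le (T.filter fun u => d.a u = d.a t) (u - 1)
      (Finset.mem_filter.2 ⟨h1, hcon.2.2.trans hmem.2⟩)
    have := hcon.1
    omega

theorem valid_countd {D : ℕ} (hD : 2 * d.n + 2 ≤ D) : (countdScheme d).Valid d .countd D where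
  wt_zero _ _ _ := rfl
  bound := by
    intro l _ t _ g _ h _
    have : (countdScheme d).wt l t g h ≤ 2 := by
      simp only [countdScheme]; split_ifs <;> omega
    have := Nat.mul_le_mul_left d.n this
    omega
  two_le := by omega
  conn_γ _ _ _ h := h.1
  le_iff T c T' c' h h' := by
    rw [agg_countd, agg_countd, Nat.cast_le, card_image_of_closed h.toIsGroup,
      card_image_of_closed h'.toIsGroup]
    have h1 : c 1 = _ := h.count 1
    have h1' : c' 1 = _ := h'.count 1
    change c 1 ≤ c' 1 ↔ _
    rw [h1, h1']
    rfl
  exists_cert T hT := by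
    obtain ⟨g, hg⟩ := hT.ne
    exact ⟨_, cert_desc (g := g) (h := g) hT (hT.sub g hg) (hT.sub g hg) trivial⟩
  saturate s hs hm := by
    classical
    -- Adding all tuples that share group and value with a taken one leaves the distinct values of
    -- every group unchanged.
    set s' := (Finset.range d.n).filter fun t => ∃ u ∈ s, d.γ u = d.γ t ∧ d.a u = d.a t with hs'
    have hmem : ∀ t, t ∈ s' ↔ t < d.n ∧ ∃ u ∈ s, d.γ u = d.γ t ∧ d.a u = d.a t := by
      intro t; simp [hs']
    have hsub : s ⊆ s' := fun t ht => (hmem t).2 ⟨hs t ht, t, ht, rfl, rfl⟩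
    have hagg : ∀ g, d.agg .countd (d.block s' g) = d.agg .countd (d.block s g) := by
      intro g
      rw [agg_countd, agg_countd]
      congr 2
      ext v
      simp only [Finset.mem_image, d.mem_block]
      constructor
      · rintro ⟨t, ⟨ht, hg⟩, rfl⟩
        obtain ⟨-, u, hu, hu1, hu2⟩ := (hmem t).1 ht
        exact ⟨u, ⟨hu, hu1.trans hg⟩, hu2⟩
      · rintro ⟨t, ⟨ht, hg⟩, rfl⟩
        exact ⟨t, ⟨hsub ht, hg⟩, rfl⟩
    refine ⟨s', fun t ht => ((hmem t).1 ht).1, ?_, ?_, Finset.card_le_card hsub⟩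
    · intro t ht u hu htu
      obtain ⟨-, t', ht', h1, -⟩ := (hmem t).1 ht
      obtain ⟨-, u', hu', h2, -⟩ := (hmem u).1 hu
      rw [hagg, hagg, ← h1, ← h2]
      exact hm t' ht' u' hu' (by rw [h1, h2]; exact htu)
    · intro i hi hin hc
      rw [hmem, hmem, hc.1, hc.2]
      exact ⟨fun h => ⟨hin, h.2⟩, fun h => ⟨by omega, h.2⟩⟩

end Scheme

end AODRepair

namespace AODRepair

/-! ### Sorting the tuples of an instance -/

theorem getD_flatMap {α β : Type*} (f : α → List β) (m : ℕ) (hm : ∀ a, (f a).length = m) (b : β)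
    (l : List α) (a : α) : ∀ u < l.length, ∀ o < m,
      (l.flatMap f).getD (u * m + o) b = (f (l.getD u a)).getD o b := by
  induction l with
  | nil => intro u hu; simp at hu
  | cons c l ih =>
    intro u hu o ho
    rw [List.flatMap_cons]
    rcases u with _ | u
    · rw [List.getD_append _ _ _ _ (by rw [hm]; omega)]
      simp
    · rw [List.getD_append_right _ _ _ _ (by rw [hm]; nlinarith), hm,
        show (u + 1) * m + o - m = u * m + o by rw [Nat.succ_mul]; omega]
      rw [ih u (by simpa using hu) o ho]
      rfl

theorem length_flatMap_const {α β : Type*} (f : α → List β) (m : ℕ) (hm : ∀ a, (f a).length = m)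
    (l : List α) : (l.flatMap f).length = l.length * m := by
  induction l with
  | nil => simp
  | cons c l ih => rw [List.flatMap_cons, List.length_append, ih, hm, List.length_cons]; ring

theorem length_encodeTuple {k : ℕ} (t : Tuple k) : (encodeTuple t).length = 2 * k := by
  rw [encodeTuple, length_flatMap_const _ 2 (fun _ => rfl), List.length_ofFn, mul_comm]

theorem length_encodeTuples {k : ℕ} (l : List (Tuple k)) :
    (encodeTuples l).length = 2 + l.length * (2 * k) := by
  rw [encodeTuples, List.length_cons, List.length_cons,
    length_flatMap_const _ _ length_encodeTuple]
  omega

theorem getD_encodeTuple {k : ℕ} (t : Tuple k) (j : Fin k) :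
    (encodeTuple t).getD (2 * j) 0 = (t j).num ∧
      (encodeTuple t).getD (2 * j + 1) 0 = (t j).den := by
  have h := getD_flatMap encodeRat 2 (fun _ => rfl) (0 : ℤ) (List.ofFn t) 0 j (by simp)
  have e : (List.ofFn t).getD j 0 = t j := by
    rw [List.getD_eq_getElem _ _ (by simp)]; simp
  rw [e] at h
  rw [encodeTuple, mul_comm 2 (j : ℕ)]
  exact ⟨h 0 (by norm_num), h 1 (by norm_num)⟩

namespace Instance

variable (x : Instance)

def n : ℕ := x.tuples.length

def tup (u : ℕ) : Tuple x.k := x.tuples.getD u 0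

theorem length_encode : x.encode.length = 4 + x.n * (2 * x.k) := by
  simp only [encode, List.length_cons, length_encodeTuples, n]
  omega

theorem getD_encode {u o : ℕ} (hu : u < x.n) (ho : o < 2 * x.k) :
    x.encode.getD (4 + u * (2 * x.k) + o) 0 = (encodeTuple (x.tup u)).getD o 0 := by
  rw [show 4 + u * (2 * x.k) + o = u * (2 * x.k) + o + 4 by omega]
  simp only [encode, encodeTuples, List.getD_cons_succ]
  exact getD_flatMap _ _ length_encodeTuple 0 x.tuples 0 u hu o ho

/-- The lexicographic order on the numbers of the tuples, by the two relevant attributes and the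
number itself. -/
def LexLt (u v : ℕ) : Prop :=
  x.tup u x.G < x.tup v x.G ∨ (x.tup u x.G = x.tup v x.G ∧
    (x.tup u x.A < x.tup v x.A ∨ (x.tup u x.A = x.tup v x.A ∧ u < v)))

theorem lexLt_trans {u v w : ℕ} (h : x.LexLt u v) (h' : x.LexLt v w) : x.LexLt u w := by
  unfold LexLt at *
  rcases h with h | ⟨h1, h | ⟨h2, h⟩⟩ <;> rcases h' with h' | ⟨h1', h' | ⟨h2', h'⟩⟩
  · exact Or.inl (h.trans h')
  · exact Or.inl (h1' ▸ h)
  · exact Or.inl (h1' ▸ h)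
  · exact Or.inl (h1 ▸ h')
  · exact Or.inr ⟨h1.trans h1', Or.inl (h.trans h')⟩
  · exact Or.inr ⟨h1.trans h1', Or.inl (h2' ▸ h)⟩
  · exact Or.inl (h1 ▸ h')
  · exact Or.inr ⟨h1.trans h1', Or.inl (h2 ▸ h')⟩
  · exact Or.inr ⟨h1.trans h1', Or.inr ⟨h2.trans h2', h.trans h'⟩⟩

theorem lexLt_irrefl (u : ℕ) : ¬ x.LexLt u u := by simp [LexLt]

theorem lexLt_total {u v : ℕ} (h : u ≠ v) : x.LexLt u v ∨ x.LexLt v u := by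
  unfold LexLt
  rcases lt_trichotomy (x.tup u x.G) (x.tup v x.G) with h1 | h1 | h1
  · exact Or.inl (Or.inl h1)
  · rcases lt_trichotomy (x.tup u x.A) (x.tup v x.A) with h2 | h2 | h2
    · exact Or.inl (Or.inr ⟨h1, Or.inl h2⟩)
    · rcases lt_or_gt_of_ne h with h3 | h3
      · exact Or.inl (Or.inr ⟨h1, Or.inr ⟨h2, h3⟩⟩)
      · exact Or.inr (Or.inr ⟨h1.symm, Or.inr ⟨h2.symm, h3⟩⟩)
    · exact Or.inr (Or.inr ⟨h1.symm, Or.inl h2⟩)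
  · exact Or.inr (Or.inl h1)

open Classical in
/-- The position of a tuple in the sorted list. -/
noncomputable def rank (v : ℕ) : ℕ := ((Finset.range x.n).filter fun u => x.LexLt u v).card

theorem rank_lt_rank {u v : ℕ} (hu : u < x.n) (h : x.LexLt u v) : x.rank u < x.rank v := by
  classical
  refine Finset.card_lt_card ⟨fun w hw => ?_, fun hsub => ?_⟩
  · rw [Finset.mem_filter] at hw ⊢
    exact ⟨hw.1, x.lexLt_trans hw.2 h⟩
  · have := hsub (Finset.mem_filter.2 ⟨Finset.mem_range.2 hu, h⟩)
    exact x.lexLt_irrefl u (Finset.mem_filter.1 this).2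

theorem rank_lt {v : ℕ} (hv : v < x.n) : x.rank v < x.n := by
  classical
  conv_rhs => rw [← Finset.card_range x.n]
  refine Finset.card_lt_card ⟨Finset.filter_subset _ _, fun hsub => ?_⟩
  exact x.lexLt_irrefl v (Finset.mem_filter.1 (hsub (Finset.mem_range.2 hv))).2

theorem rank_inj {u v : ℕ} (hu : u < x.n) (hv : v < x.n) (h : x.rank u = x.rank v) : u = v := by
  by_contra hne
  rcases x.lexLt_total hne with h1 | h1
  · exact absurd h (x.rank_lt_rank hu h1).ne
  · exact absurd h.symm (x.rank_lt_rank hv h1).ne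

/-- The rank maps the numbers below `x.n` injectively to themselves, because ties are broken by the
place in the list. -/
theorem exists_rank_eq {i : ℕ} (hi : i < x.n) : ∃ u < x.n, x.rank u = i := by
  have := Finset.surj_on_of_inj_on_of_card_le (s := Finset.range x.n) (t := Finset.range x.n)
    (fun u _ => x.rank u) (fun u hu => Finset.mem_range.2 (x.rank_lt (Finset.mem_range.1 hu)))
    (fun u v hu hv h => x.rank_inj (Finset.mem_range.1 hu) (Finset.mem_range.1 hv) h) le_rfl i
    (Finset.mem_range.2 hi)
  obtain ⟨u, hu, h⟩ := this
  exact ⟨u, Finset.mem_range.1 hu, h.symm⟩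

open Classical in
/-- The number of the tuple at a position of the sorted list. -/
noncomputable def perm (i : ℕ) : ℕ := ∑ u ∈ Finset.range x.n, if x.rank u = i then u else 0

/-- Only one summand survives, by injectivity of the rank. The inverse is written as a sum because
the expression language has sums. -/
theorem perm_rank {u : ℕ} (hu : u < x.n) : x.perm (x.rank u) = u := by
  classical
  rw [perm, Finset.sum_eq_single u]
  · simp
  · intro v hv hne
    exact if_neg fun h => hne (x.rank_inj (Finset.mem_range.1 hv) hu h)
  · intro h; exact absurd (Finset.mem_range.2 hu) h

theorem perm_lt {i : ℕ} (hi : i < x.n) : x.perm i < x.n := by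
  obtain ⟨u, hu, rfl⟩ := x.exists_rank_eq hi
  rwa [x.perm_rank hu]

theorem rank_perm {i : ℕ} (hi : i < x.n) : x.rank (x.perm i) = i := by
  obtain ⟨u, hu, rfl⟩ := x.exists_rank_eq hi
  rw [x.perm_rank hu]

theorem perm_of_le {i : ℕ} (hi : x.n ≤ i) : x.perm i = 0 := by
  classical
  refine Finset.sum_eq_zero fun u hu => if_neg fun h => ?_
  have := x.rank_lt (Finset.mem_range.1 hu)
  omega

theorem perm_le (i : ℕ) : x.perm i ≤ x.n := by
  rcases lt_or_ge i x.n with h | h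
  · exact (x.perm_lt h).le
  · rw [x.perm_of_le h]; exact Nat.zero_le _

/-- The tuple at a position of the sorted list. -/
noncomputable def sortedTup (i : ℕ) : Tuple x.k := x.tup (x.perm i)

noncomputable def cols : SortedCols where
  n := x.n
  γ i := x.sortedTup i x.G
  a i := x.sortedTup i x.A
  sorted i j hij hj := by
    have h1 : ¬ x.LexLt (x.perm j) (x.perm i) := fun h => by
      have := x.rank_lt_rank (x.perm_lt hj) h
      rw [x.rank_perm hj, x.rank_perm (hij.trans hj)] at this
      omega
    have h2 : x.perm i ≠ x.perm j := fun h => by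
      have := congrArg x.rank h
      rw [x.rank_perm hj, x.rank_perm (hij.trans hj)] at this
      omega
    rcases (x.lexLt_total h2).resolve_right h1 with h | ⟨h3, h | ⟨h4, -⟩⟩
    · exact Or.inl h
    · exact Or.inr ⟨h3, h.le⟩
    · exact Or.inr ⟨h3, h4.le⟩

theorem tup_mem {u : ℕ} (hu : u < x.n) : x.tup u ∈ x.tuples := by
  rw [tup, List.getD_eq_getElem _ _ hu]; exact List.getElem_mem _

theorem sortedTup_inj {i j : ℕ} (hi : i < x.n) (hj : j < x.n)
    (h : x.sortedTup i = x.sortedTup j) : i = j := by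
  rw [sortedTup, sortedTup, tup, tup, List.getD_eq_getElem _ _ (x.perm_lt hi),
    List.getD_eq_getElem _ _ (x.perm_lt hj)] at h
  have h := x.nodup.getElem_inj_iff.1 h
  rw [← x.rank_perm hi, h, x.rank_perm hj]

theorem exists_sortedTup {t : Tuple x.k} (ht : t ∈ x.tuples) : ∃ i < x.n, x.sortedTup i = t := by
  obtain ⟨u, hu, rfl⟩ := List.getElem_of_mem ht
  refine ⟨x.rank u, x.rank_lt hu, ?_⟩
  rw [sortedTup, x.perm_rank hu, tup, List.getD_eq_getElem _ _ hu]

/-- The tuples at the given positions of the sorted list. -/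
noncomputable def sub (s : Finset ℕ) : Relation x.k := s.image x.sortedTup

theorem injOn_sortedTup {s : Finset ℕ} (hs : ∀ t ∈ s, t < x.n) :
    Set.InjOn x.sortedTup (s : Set ℕ) := fun i hi j hj h =>
  x.sortedTup_inj (hs i hi) (hs j hj) h

theorem groupAgg_sub (α : Agg) {s : Finset ℕ} (hs : ∀ t ∈ s, t < x.n) (g : ℚ) :
    groupAgg α x.G x.A (x.sub s) g = x.cols.agg α (x.cols.block s g) := by
  have h : (x.sub s).filter (fun t => t x.G = g) = (x.cols.block s g).image x.sortedTup := by
    rw [sub, Finset.filter_image]; rfl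
  have hinj : Set.InjOn x.sortedTup (x.cols.block s g : Set ℕ) :=
    x.injOn_sortedTup fun t ht => hs t ((x.cols.mem_block).1 ht).1
  rw [groupAgg, h, Finset.image_val_of_injOn hinj, Multiset.map_map]
  rfl

theorem satisfies_sub (α : Agg) {s : Finset ℕ} (hs : ∀ t ∈ s, t < x.n) :
    Satisfies α x.G x.A (x.sub s) ↔ x.cols.Mono α s := by
  simp only [Satisfies, x.groupAgg_sub α hs, SortedCols.Mono]
  constructor
  · intro h t ht u hu
    have key : ∀ t ∈ s, x.cols.γ t ∈ (x.sub s).image fun t => t x.G := fun t ht =>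
      Finset.mem_image.2 ⟨_, Finset.mem_image_of_mem _ ht, rfl⟩
    exact h _ (key t ht) _ (key u hu)
  · intro h g hg g' hg'
    simp only [sub, Finset.mem_image] at hg hg'
    obtain ⟨_, ⟨t, ht, rfl⟩, rfl⟩ := hg
    obtain ⟨_, ⟨u, hu, rfl⟩, rfl⟩ := hg'
    exact h t ht u hu

/-- Tuples of the relation correspond bijectively to positions, so every competing subset is the
image of a set of positions of the same size. -/
theorem isCRepair_sub (α : Agg) {s : Finset ℕ} (hs : ∀ t ∈ s, t < x.n) (hm : x.cols.Mono α s)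
    (hmax : ∀ s' : Finset ℕ, (∀ t ∈ s', t < x.n) → x.cols.Mono α s' → s'.card ≤ s.card) :
    IsCRepair α x.G x.A x.relation (x.sub s) := by
  refine ⟨⟨fun t ht => ?_, (x.satisfies_sub α hs).2 hm⟩, fun r hr => ?_⟩
  · obtain ⟨i, hi, rfl⟩ := Finset.mem_image.1 ht
    exact List.mem_toFinset.2 (x.tup_mem (x.perm_lt (hs i hi)))
  · set s' := (Finset.range x.n).filter fun i => x.sortedTup i ∈ r with hs'
    have hs'n : ∀ t ∈ s', t < x.n := fun t ht => Finset.mem_range.1 (Finset.mem_filter.1 ht).1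
    have hsub : x.sub s' = r := by
      ext t
      rw [sub, Finset.mem_image]
      constructor
      · rintro ⟨i, hi, rfl⟩; exact (Finset.mem_filter.1 hi).2
      · intro ht
        obtain ⟨i, hi, rfl⟩ := x.exists_sortedTup (List.mem_toFinset.1 (hr.1 ht))
        exact ⟨i, Finset.mem_filter.2 ⟨Finset.mem_range.2 hi, ht⟩, rfl⟩
    have h1 := hmax s' hs'n ((x.satisfies_sub α hs'n).1 (hsub ▸ hr.2))
    rw [← hsub, sub, sub, Finset.card_image_of_injOn (x.injOn_sortedTup hs'n),
      Finset.card_image_of_injOn (x.injOn_sortedTup hs)]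
    exact h1

/-- The list of the tuples at the given positions. -/
noncomputable def subList (s : Finset ℕ) : List (Tuple x.k) := (s.sort (· ≤ ·)).map x.sortedTup

theorem isAnswer_subList (α : Agg) {s : Finset ℕ} (hs : ∀ t ∈ s, t < x.n)
    (hm : x.cols.Mono α s)
    (hmax : ∀ s' : Finset ℕ, (∀ t ∈ s', t < x.n) → x.cols.Mono α s' → s'.card ≤ s.card) :
    x.IsAnswer α (encodeTuples (x.subList s)) := by
  refine ⟨_, ?_, rfl, ?_⟩
  · refine (List.nodup_map_iff_inj_on (Finset.sort_nodup _ _)).2 fun i hi j hj h => ?_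
    exact x.sortedTup_inj (hs i ((Finset.mem_sort _).1 hi)) (hs j ((Finset.mem_sort _).1 hj)) h
  · have : (x.subList s).toFinset = x.sub s := by
      ext t; simp [subList, sub]
    rw [this]
    exact x.isCRepair_sub α hs hm hmax

/-- An element of `s` is determined by the number of elements below it. This makes the `r`-th
element a sum with one surviving term, as needed for writing the output. -/
theorem sum_sort {s : Finset ℕ} {n r : ℕ} (hs : ∀ t ∈ s, t < n) (hr : r < s.card) :
    ∃ g ∈ s, (∑ i ∈ Finset.range n,
      if i ∈ s ∧ (s.filter fun t => t < i).card = r then i else 0) = g ∧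
      (s.sort (· ≤ ·)).getD r 0 = g := by
  obtain ⟨g, hg, h⟩ := Scheme.exists_card_filter_lt s r hr
  obtain ⟨h1, h2⟩ := Scheme.eq_sort_getElem hg h
  refine ⟨g, hg, ?_, by rw [List.getD_eq_getElem _ _ h1, h2]⟩
  rw [Finset.sum_eq_single g]
  · rw [if_pos ⟨hg, h⟩]
  · intro i _ hne
    refine if_neg fun hi => hne ?_
    obtain ⟨_, h3⟩ := Scheme.eq_sort_getElem hi.1 hi.2
    rw [← h3, h2]
  · intro h3; exact absurd (Finset.mem_range.2 (hs g hg)) h3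

end Instance

end AODRepair

namespace AODRepair

/-! ### Expressions for the entries of an instance -/

/-- Array `0` holds the instance. -/
def HasInput (x : Instance) (M : ℕ → ℤ → ℤ) : Prop := ∀ i : ℕ, M 0 i = x.encode.getD i 0

/-- Array `2` holds the sorting permutation. -/
def HasPerm (x : Instance) (M : ℕ → ℤ → ℤ) : Prop := ∀ i < x.n, M 2 i = x.perm i

namespace Term

def attrG : Term := arr 0 (lit 0)
def attrA : Term := arr 0 (lit 1)
def arity : Term := arr 0 (lit 2)
def size : Term := arr 0 (lit 3)
-- Four cells for `G`, `A`, the arity and the number of tuples come first; each tuple then occupies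
-- twice the arity many cells, numerators before their denominators.
def num (u j : Term) : Term := arr 0 (lit 4 + u * (lit 2 * arity) + lit 2 * j)
def den (u j : Term) : Term := arr 0 (lit 4 + u * (lit 2 * arity) + lit 2 * j + lit 1)
def tupLt (u v j : Term) : Term := (num u j * den v j).lt (num v j * den u j)
def tupEq (u v j : Term) : Term := (num u j * den v j).eq (num v j * den u j)
def lexLt (u v : Term) : Term := (tupLt u v attrG).or ((tupEq u v attrG).and
  ((tupLt u v attrA).or ((tupEq u v attrA).and (u.lt v))))
/-- Uses variable `2`. -/
def rank (v : Term) : Term := sum 2 (pos (((var 2).lt size).and (lexLt (var 2) v)))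
/-- The sorting permutation at variable `0`. -/
def perm : Term := sum 1 (pos (((var 1).lt size).and ((rank (var 1)).eq (var 0))) * var 1)
def abs (e : Term) : Term := e * pos e - e * pos (lit 0 - e)
/-- The sum of the absolute values of the numerators in the aggregate column. -/
def absSum : Term := sum 1 (pos ((var 1).lt size) * abs (num (var 1) attrA))

variable {x : Instance} {N : ℕ} {M : ℕ → ℤ → ℤ} {ρ : ℕ → ℤ}

theorem eval_attrG (h : HasInput x M) : attrG.eval N M ρ = ((x.G : ℕ) : ℤ) := h 0
theorem eval_attrA (h : HasInput x M) : attrA.eval N M ρ = ((x.A : ℕ) : ℤ) := h 1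
theorem eval_arity (h : HasInput x M) : arity.eval N M ρ = x.k := h 2
theorem eval_size (h : HasInput x M) : size.eval N M ρ = x.n := h 3

theorem eval_num (h : HasInput x M) {u j : Term} {u' : ℕ} {j' : Fin x.k} (hu : u.eval N M ρ = u')
    (hu' : u' < x.n) (hj : j.eval N M ρ = (j' : ℕ)) :
    (num u j).eval N M ρ = (x.tup u' j').num := by
  rw [← (getD_encodeTuple _ _).1, ← x.getD_encode hu' (by omega), ← h]
  simp only [num, eval_arr, eval_add, eval_mul, eval_lit, eval_arity h, hu, hj]
  push_cast
  rfl

theorem eval_den (h : HasInput x M) {u j : Term} {u' : ℕ} {j' : Fin x.k} (hu : u.eval N M ρ = u')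
    (hu' : u' < x.n) (hj : j.eval N M ρ = (j' : ℕ)) :
    (den u j).eval N M ρ = (x.tup u' j').den := by
  rw [← (getD_encodeTuple _ _).2, ← x.getD_encode hu' (by omega), ← h]
  simp only [den, eval_arr, eval_add, eval_mul, eval_lit, eval_arity h, hu, hj]
  push_cast
  rw [← add_assoc]

theorem holds_tupLt (h : HasInput x M) {u v j : Term} {u' v' : ℕ} {j' : Fin x.k}
    (hu : u.eval N M ρ = u') (hu' : u' < x.n) (hv : v.eval N M ρ = v') (hv' : v' < x.n)
    (hj : j.eval N M ρ = (j' : ℕ)) :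
    (tupLt u v j).Holds N M ρ ↔ x.tup u' j' < x.tup v' j' := by
  rw [tupLt, holds_lt, eval_mul, eval_mul, eval_num h hu hu' hj, eval_num h hv hv' hj,
    eval_den h hu hu' hj, eval_den h hv hv' hj, Rat.lt_iff]

theorem holds_tupEq (h : HasInput x M) {u v j : Term} {u' v' : ℕ} {j' : Fin x.k}
    (hu : u.eval N M ρ = u') (hu' : u' < x.n) (hv : v.eval N M ρ = v') (hv' : v' < x.n)
    (hj : j.eval N M ρ = (j' : ℕ)) :
    (tupEq u v j).Holds N M ρ ↔ x.tup u' j' = x.tup v' j' := by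
  rw [tupEq, holds_eq, eval_mul, eval_mul, eval_num h hu hu' hj, eval_num h hv hv' hj,
    eval_den h hu hu' hj, eval_den h hv hv' hj, Rat.eq_iff_mul_eq_mul]

theorem holds_lexLt (h : HasInput x M) {u v : Term} {u' v' : ℕ}
    (hu : u.eval N M ρ = u') (hu' : u' < x.n) (hv : v.eval N M ρ = v') (hv' : v' < x.n) :
    (lexLt u v).Holds N M ρ ↔ x.LexLt u' v' := by
  simp only [lexLt, holds_or, holds_and, holds_lt, hu, hv, Nat.cast_lt,
    holds_tupLt h hu hu' hv hv' (eval_attrG h), holds_tupLt h hu hu' hv hv' (eval_attrA h),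
    holds_tupEq h hu hu' hv hv' (eval_attrG h), holds_tupEq h hu hu' hv hv' (eval_attrA h)]
  rfl

/-- A sum whose summands vanish from `n` on. -/
theorem eval_sum_of_le {n y : ℕ} (hn : n ≤ N) {e : Term} {f : ℕ → ℤ}
    (h : ∀ u < n, e.eval N M (Function.update ρ y u) = f u)
    (h0 : ∀ u < N, n ≤ u → e.eval N M (Function.update ρ y u) = 0) :
    (sum y e).eval N M ρ = ∑ u ∈ Finset.range n, f u := by
  rw [eval_sum, ← Finset.sum_subset (Finset.range_mono hn)]
  · exact Finset.sum_congr rfl fun u hu => h u (Finset.mem_range.1 hu)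
  · intro u hu hu'
    exact h0 u (Finset.mem_range.1 hu) (by simpa using hu')

/-- The quantifier in `hv` expresses that `v` does not depend on variable `2`, which the sum binds.
-/
theorem eval_rank (h : HasInput x M) (hN : x.n ≤ N) {v : Term} {v' : ℕ} (hv' : v' < x.n)
    (hv : ∀ u : ℤ, v.eval N M (Function.update ρ 2 u) = v') :
    (rank v).eval N M ρ = x.rank v' := by
  classical
  rw [Instance.rank, Finset.card_filter, Nat.cast_sum]
  refine eval_sum_of_le hN (fun u hu => ?_) fun u _ hu => ?_
  · rw [eval_pos, holds_and, holds_lt, eval_size h,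
      holds_lexLt h (u' := u) (by simp) hu (hv _) hv']
    simp [hu]
  · rw [eval_pos, if_neg]
    rw [holds_and, holds_lt, eval_size h]
    simp [hu]

theorem eval_perm (h : HasInput x M) (hN : x.n ≤ N) {i : ℕ} (hi : ρ 0 = i) :
    perm.eval N M ρ = x.perm i := by
  classical
  rw [Instance.perm, Nat.cast_sum]
  refine eval_sum_of_le hN (fun u hu => ?_) fun u _ hu => ?_
  · rw [eval_mul, eval_pos, holds_and, holds_lt, eval_size h, holds_eq,
      eval_rank h hN hu (by simp)]
    simp [hu, hi]
  · rw [eval_mul, eval_pos, if_neg, zero_mul]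
    rw [holds_and, holds_lt, eval_size h]
    simp [hu]

theorem eval_abs (e : Term) : (abs e).eval N M ρ = |e.eval N M ρ| := by
  have h1 : e.Holds N M ρ ↔ 0 < e.eval N M ρ := Iff.rfl
  have h2 : (lit 0 - e).Holds N M ρ ↔ 0 < 0 - e.eval N M ρ := Iff.rfl
  simp only [abs, eval_sub, eval_mul, eval_pos]
  rcases lt_trichotomy (e.eval N M ρ) 0 with h | h | h
  · rw [abs_of_neg h, if_neg (by rw [h1]; omega), if_pos (by rw [h2]; omega)]; ring
  · rw [h]; simp
  · rw [abs_of_pos h, if_pos (by rw [h1]; omega), if_neg (by rw [h2]; omega)]; ring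

theorem eval_absSum (h : HasInput x M) (hN : x.n ≤ N) : absSum.eval N M ρ =
    (∑ u ∈ Finset.range x.n, (x.tup u x.A).num.natAbs : ℕ) := by
  rw [Nat.cast_sum]
  refine eval_sum_of_le hN (fun u hu => ?_) fun u _ hu => ?_
  · rw [eval_mul, eval_pos, holds_lt, eval_size h, eval_abs,
      eval_num h (u' := u) (by simp) hu (eval_attrA h)]
    simp [hu]
  · rw [eval_mul, eval_pos, if_neg, zero_mul]
    rw [holds_lt, eval_size h]
    simp [hu]

def colLt (i j c : Term) : Term := tupLt (arr 2 i) (arr 2 j) c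
def colEq (i j c : Term) : Term := tupEq (arr 2 i) (arr 2 j) c

theorem eval_arr_perm (hp : HasPerm x M) {i : Term} {i' : ℕ} (hi : i.eval N M ρ = i')
    (hi' : i' < x.n) : (arr 2 i).eval N M ρ = x.perm i' := by
  rw [eval_arr, hi, hp _ hi']

theorem holds_colLt (h : HasInput x M) (hp : HasPerm x M) {i j c : Term} {i' j' : ℕ}
    {c' : Fin x.k} (hi : i.eval N M ρ = i') (hi' : i' < x.n) (hj : j.eval N M ρ = j')
    (hj' : j' < x.n) (hc : c.eval N M ρ = (c' : ℕ)) :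
    (colLt i j c).Holds N M ρ ↔ x.sortedTup i' c' < x.sortedTup j' c' :=
  holds_tupLt h (eval_arr_perm hp hi hi') (x.perm_lt hi') (eval_arr_perm hp hj hj')
    (x.perm_lt hj') hc

theorem holds_colEq (h : HasInput x M) (hp : HasPerm x M) {i j c : Term} {i' j' : ℕ}
    {c' : Fin x.k} (hi : i.eval N M ρ = i') (hi' : i' < x.n) (hj : j.eval N M ρ = j')
    (hj' : j' < x.n) (hc : c.eval N M ρ = (c' : ℕ)) :
    (colEq i j c).Holds N M ρ ↔ x.sortedTup i' c' = x.sortedTup j' c' :=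
  holds_tupEq h (eval_arr_perm hp hi hi') (x.perm_lt hi') (eval_arr_perm hp hj hj')
    (x.perm_lt hj') hc

theorem eval_pred {i : Term} {i' : ℕ} (hi : i.eval N M ρ = i') (h : 0 < i') :
    (i - lit 1).eval N M ρ = (i' - 1 : ℕ) := by
  rw [eval_sub, hi, eval_lit]; omega

/-- Digit `j` of `q` in base `D`. -/
def dig (D q : Term) (j : ℕ) : Term := q / D.pow j - q / D.pow j / D * D

theorem eval_dig {D q : Term} {D' q' : ℕ} (hD : D.eval N M ρ = D') (hq : q.eval N M ρ = q')
    (j : ℕ) : (dig D q j).eval N M ρ = Scheme.digit D' q' j := by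
  simp only [dig, eval_sub, eval_div, eval_mul, eval_pow, hD, hq, Scheme.digit]
  push_cast
  rw [Int.emod_def, mul_comm]

def conj (l : List Term) : Term := l.foldr Term.and (lit 1)

theorem holds_conj (l : List Term) : (conj l).Holds N M ρ ↔ ∀ e ∈ l, e.Holds N M ρ := by
  induction l with
  | nil => simp [conj, Holds]
  | cons a l ih =>
    rw [conj, List.foldr_cons, holds_and]
    change _ ∧ (conj l).Holds N M ρ ↔ _
    rw [ih]; simp

end Term

/-! ### Expressions for a step of the automaton -/

/-- Expressions for the components of a scheme. -/
structure SchemeTerm where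
  wt : ℕ → Term → Term → Term → Term
  fin : (Fin 6 → Term) → Term
  le : (Fin 6 → Term) → (Fin 6 → Term) → Term
  conn : Term → Term

/-- Weights, comparisons and ties have to be right only at genuine positions, where the sorting
permutation is tabulated. The automaton therefore checks the range of its guesses. -/
structure SchemeTerm.Represents (s : SchemeTerm) (S : Scheme) (n N : ℕ) (M : ℕ → ℤ → ℤ) :
    Prop where
  wt : ∀ ρ (l : ℕ) (t g h : Term) (t' g' h' : ℕ), t.eval N M ρ = t' → t' < n →
    g.eval N M ρ = g' → g' < n →
    h.eval N M ρ = h' → h' < n → (s.wt l t g h).eval N M ρ = S.wt l t' g' h'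
  fin : ∀ ρ (c : Fin 6 → Term) (c' : Fin 6 → ℕ), (∀ l, (c l).eval N M ρ = c' l) →
    ((s.fin c).Holds N M ρ ↔ S.fin c')
  le : ∀ ρ (b c : Fin 6 → Term) (b' c' : Fin 6 → ℕ), (∀ l, (b l).eval N M ρ = b' l) →
    (∀ l, (c l).eval N M ρ = c' l) → b' 4 < n → b' 5 < n → c' 4 < n → c' 5 < n →
    ((s.le b c).Holds N M ρ ↔ S.le b' c')
  conn : ∀ ρ (t : Term) (t' : ℕ), t.eval N M ρ = t' → 0 < t' → t' < n →
    ((s.conn t).Holds N M ρ ↔ S.conn t')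

namespace Term

def isStart (i : Term) : Term := (i.le (lit 0)).or (colEq (i - lit 1) i attrG).not
def isEnd (i : Term) : Term :=
  (size.le (i + lit 1)).or (colEq (i + lit 1) i attrG).not

/-- The fields `start` and `count` of `Scheme.Step` share one clause: the factor `pos (isStart
i).not` drops the old counter at the start of a group. -/
def step (s : SchemeTerm) (D i q r : Term) : Term := conj [
  (dig D r 12).le (lit 1),
  (((lit 0).lt i).and (s.conn i)).not.or ((dig D r 12).eq (dig D q 12)),
  (dig D r 4).lt size,
  (dig D r 5).lt size,
  (isStart i).or (((dig D r 4).eq (dig D q 4)).and ((dig D r 5).eq (dig D q 5))),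
  conj ((List.range 4).map fun l => (dig D r l).eq
    (pos (isStart i).not * dig D q l + dig D r 12 * s.wt l i (dig D r 4) (dig D r 5))),
  ((isEnd i).and (dig D r 0)).not.or ((s.fin fun l => dig D r l).and
    ((((dig D q 6).le (lit 0)).or (((dig D q 10).lt size).and (((dig D q 11).lt size).and
      (s.le (fun l => dig D q (6 + l)) fun l => dig D r l)))).and
    (conj ((List.range 6).map fun l => (dig D r (6 + l)).eq (dig D r l))))),
  ((isEnd i).and (dig D r 0)).or
    (conj ((List.range 6).map fun l => (dig D r (6 + l)).eq (dig D q (6 + l))))]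

variable {x : Instance} {N : ℕ} {M : ℕ → ℤ → ℤ} {ρ : ℕ → ℤ}

theorem holds_isStart (h : HasInput x M) (hp : HasPerm x M) {i : Term} {i' : ℕ}
    (hi : i.eval N M ρ = i') (hi' : i' < x.n) :
    (isStart i).Holds N M ρ ↔ Scheme.IsStart x.cols i' := by
  rw [isStart, holds_or, holds_le, hi, eval_lit, holds_not, Scheme.IsStart]
  rcases Nat.eq_zero_or_pos i' with rfl | h0
  · simp
  · rw [holds_colEq h hp (eval_pred hi h0) (by omega) hi hi' (eval_attrG h)]
    have : ((i' : ℤ) ≤ 0) ↔ i' = 0 := by omega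
    rw [this]; rfl

theorem holds_isEnd (h : HasInput x M) (hp : HasPerm x M) {i : Term} {i' : ℕ}
    (hi : i.eval N M ρ = i') (hi' : i' < x.n) :
    (isEnd i).Holds N M ρ ↔ Scheme.IsEnd x.cols i' := by
  rw [isEnd, holds_or, holds_le, eval_add, hi, eval_lit, eval_size h, holds_not, Scheme.IsEnd]
  change _ ↔ i' + 1 = x.n ∨ _
  rcases (show i' + 1 ≤ x.n by omega).eq_or_lt with h0 | h0
  · have : (x.n : ℤ) ≤ i' + 1 := by omega
    simp [h0, this]
  · have h2 : (i + lit 1).eval N M ρ = (i' + 1 : ℕ) := by rw [eval_add, hi, eval_lit]; rfl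
    rw [holds_colEq h hp h2 h0 hi hi' (eval_attrG h)]
    have : ((x.n : ℤ) ≤ i' + 1) ↔ i' + 1 = x.n := by omega
    rw [this]; rfl

/-- Clause by clause; the range checks on the guesses have to be used before a weight or a
comparison can be evaluated. -/
theorem holds_step {s : SchemeTerm} {S : Scheme} (h : HasInput x M) (hp : HasPerm x M)
    (hs : s.Represents S x.n N M) {D i q r : Term} {D' i' q' r' : ℕ} (hD : D.eval N M ρ = D')
    (hi : i.eval N M ρ = i') (hi' : i' < x.n) (hq : q.eval N M ρ = q') (hr : r.eval N M ρ = r') :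
    (step s D i q r).Holds N M ρ ↔ S.PackedStep x.cols D' i' q' r' := by
  have dq := eval_dig hD hq
  have dr := eval_dig hD hr
  set X := Scheme.digit D' q' with hX
  set Y := Scheme.digit D' r' with hY
  have hst := holds_isStart (N := N) h hp hi hi'
  have hst' := (holds_not (isStart i) ρ).trans (not_congr hst)
  have hen := holds_isEnd (N := N) h hp hi hi'
  have hY0 : (dig D r 0).Holds N M ρ ↔ 0 < Y 0 := by
    rw [Holds, dr]; exact Int.natCast_pos
  simp only [step, holds_conj, List.mem_cons, List.not_mem_nil, or_false, forall_eq_or_imp,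
    forall_eq, List.mem_map, List.mem_range, forall_exists_index, and_imp,
    forall_apply_eq_imp_iff₂, holds_le, holds_lt, holds_or, holds_and, holds_not, holds_eq, dq, dr,
    eval_add, eval_mul, eval_pos, eval_lit, eval_size h, hst, hen, hY0, hi, Nat.cast_inj,
    Nat.cast_lt]
  have hconn : (0 < (i' : ℤ) ∧ (s.conn i).Holds N M ρ) ↔ 0 < i' ∧ S.conn i' := by
    rw [Int.natCast_pos]
    exact and_congr_right fun h0 => hs.conn ρ i i' hi h0 hi'
  have hfin := hs.fin ρ (fun l => dig D r l) (Scheme.cur Y) fun l => dr l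
  rw [hconn, hfin]
  unfold Scheme.PackedStep
  rw [← hX, ← hY]
  have hprev : ∀ Z : ℕ → ℕ, (Scheme.prev Y = Scheme.cur Z ↔ ∀ a < 6, Y (6 + a) = Z a) := fun Z =>
    ⟨fun e a ha => congrFun e ⟨a, ha⟩, fun e => funext fun l => e l l.2⟩
  have hprev' : Scheme.prev Y = Scheme.prev X ↔ ∀ a < 6, Y (6 + a) = X (6 + a) :=
    ⟨fun e a ha => congrFun e ⟨a, ha⟩, fun e => funext fun l => e l l.2⟩
  have hle : Y 4 < x.n → Y 5 < x.n → X 10 < x.n → X 11 < x.n →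
      ((s.le (fun l => dig D q (6 + l)) fun l => dig D r l).Holds N M ρ ↔
        S.le (Scheme.prev X) (Scheme.cur Y)) := fun a b c e =>
    hs.le ρ _ _ _ _ (fun l => dq _) (fun l => dr l) c e a b
  have hwt : Y 4 < x.n → Y 5 < x.n → ∀ l,
      (s.wt l i (dig D r 4) (dig D r 5)).eval N M ρ = S.wt l i' (Y 4) (Y 5) := fun a b l =>
    hs.wt ρ l i _ _ i' _ _ hi hi' (dr 4) a (dr 5) b
  constructor
  · rintro ⟨k1, k2, k3, k4, k5, k6, k7, k8⟩
    refine ⟨by exact_mod_cast k1, fun c => k2.resolve_left fun e => e c, k3, k4,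
      fun c => k5.resolve_left c, fun c l hl => ?_, fun c l hl => ?_, fun c => ?_, fun c => ?_⟩
    · have := k6 l hl
      rw [hwt k3 k4, if_neg (fun e => hst'.1 e c)] at this
      rw [zero_mul, zero_add] at this
      exact_mod_cast this
    · have := k6 l hl
      rw [hwt k3 k4, if_pos (hst'.2 c)] at this
      rw [one_mul] at this
      exact_mod_cast this
    · obtain ⟨m1, m2, m3⟩ := k7.resolve_left fun e => e c
      refine ⟨m1, ?_, (hprev Y).2 m3⟩
      rcases m2 with m2 | ⟨m2, m3, m4⟩
      · left; omega
      · exact Or.inr ⟨m2, m3, (hle k3 k4 m2 m3).1 m4⟩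
    · exact hprev'.2 (k8.resolve_left c)
  · rintro ⟨k1, k2, k3, k4, k5, k6, k6', k7, k8⟩
    refine ⟨by exact_mod_cast k1, ?_, k3, k4, ?_, fun l hl => ?_, ?_, ?_⟩
    · by_cases c : 0 < i' ∧ S.conn i'
      · exact Or.inr (k2 c)
      · exact Or.inl c
    · by_cases c : Scheme.IsStart x.cols i'
      · exact Or.inl c
      · exact Or.inr (k5 c)
    · rw [hwt k3 k4]
      by_cases c : Scheme.IsStart x.cols i'
      · rw [if_neg (fun e => hst'.1 e c), zero_mul, zero_add, k6 c l hl]; push_cast; rfl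
      · rw [if_pos (hst'.2 c), one_mul, k6' c l hl]; push_cast; rfl
    · by_cases c : Scheme.IsEnd x.cols i' ∧ 0 < Y 0
      · obtain ⟨m1, m2, m3⟩ := k7 c
        refine Or.inr ⟨m1, ?_, (hprev Y).1 m3⟩
        rcases m2 with m2 | ⟨m2, m3, m4⟩
        · left; omega
        · exact Or.inr ⟨m2, m3, (hle k3 k4 m2 m3).2 m4⟩
      · exact Or.inl c
    · by_cases c : Scheme.IsEnd x.cols i' ∧ 0 < Y 0
      · exact Or.inl c
      · exact Or.inr (hprev'.1 (k8 c))

end Term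

end AODRepair

namespace AODRepair

/-! ### Expressions for the schemes -/

namespace SchemeTerm

open Term

def colLe (i j : Term) : Term := (colLt j i attrA).not

def max : SchemeTerm where
  wt l t g _ := if l = 0 then lit 1 else if l = 1 then pos (t.eq g)
    else if l = 2 then pos (colLe t g) else lit 0
  fin c := ((c 1).eq (lit 1)).and ((c 2).eq (c 0))
  le b c := colLe (b 4) (c 4)
  conn _ := lit 0

def min : SchemeTerm where
  wt l t g _ := if l = 0 then lit 1 else if l = 1 then pos (t.eq g)
    else if l = 2 then pos (colLe g t) else lit 0
  fin c := ((c 1).eq (lit 1)).and ((c 2).eq (c 0))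
  le b c := colLe (b 4) (c 4)
  conn _ := lit 0

def count : SchemeTerm where
  wt l _ _ _ := if l = 0 then lit 1 else lit 0
  fin _ := lit 1
  le b c := (b 0).le (c 0)
  conn _ := lit 0

def sameClass (t : Term) : Term :=
  (colEq (t - lit 1) t attrG).and (colEq (t - lit 1) t attrA)

def countd : SchemeTerm where
  wt l t _ _ := if l = 0 then lit 1 else if l = 1 then
    pos (((lit 0).lt t).and (sameClass t)).not else lit 0
  fin _ := lit 1
  le b c := (b 1).le (c 1)
  conn t := sameClass t

def colNum (t : Term) : Term := num (arr 2 t) attrA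
def colDen (t : Term) : Term := den (arr 2 t) attrA

/-- Subtracting `pos (c 0)` imitates truncated subtraction of `1`. Medians are compared with
denominators cleared and the common factor one half dropped. -/
def median : SchemeTerm where
  wt l t g h := if l = 0 then lit 1 else if l = 1 then pos (t.lt g)
    else if l = 2 then pos (t.lt h) else if l = 3 then pos (t.eq g) + pos (t.eq h) else lit 0
  fin c := ((c 1).eq ((c 0 - pos (c 0)) / lit 2)).and
    (((c 2).eq (c 0 / lit 2)).and ((c 3).eq (lit 2)))
  le b c := ((colNum (b 4) * colDen (b 5) + colNum (b 5) * colDen (b 4)) *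
      (colDen (c 4) * colDen (c 5))).le
    ((colNum (c 4) * colDen (c 5) + colNum (c 5) * colDen (c 4)) *
      (colDen (b 4) * colDen (b 5)))
  conn _ := lit 0

def sum : SchemeTerm where
  wt l t _ _ := if l = 0 then lit 1 else if l = 1 then colNum t + absSum else lit 0
  fin _ := lit 1
  le b c := (b 1 - absSum * b 0).le (c 1 - absSum * c 0)
  conn _ := lit 0

def avg : SchemeTerm where
  wt l t _ _ := if l = 0 then lit 1 else if l = 1 then colNum t + absSum else lit 0
  fin _ := lit 1
  le b c := ((b 1 - absSum * b 0) * c 0).le ((c 1 - absSum * c 0) * b 0)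
  conn _ := lit 0

variable {x : Instance} {N : ℕ} {M : ℕ → ℤ → ℤ}

theorem holds_lit_zero (ρ : ℕ → ℤ) : (lit 0).Holds N M ρ ↔ False := by simp [Holds]
theorem holds_lit_one (ρ : ℕ → ℤ) : (lit 1).Holds N M ρ ↔ True := by simp [Holds]

theorem holds_colLe (h : HasInput x M) (hp : HasPerm x M) {ρ : ℕ → ℤ} {i j : Term} {i' j' : ℕ}
    (hi : i.eval N M ρ = i') (hi' : i' < x.n) (hj : j.eval N M ρ = j') (hj' : j' < x.n) :
    (colLe i j).Holds N M ρ ↔ x.cols.a i' ≤ x.cols.a j' := by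
  rw [colLe, holds_not, holds_colLt h hp hj hj' hi hi' (eval_attrA h), not_lt]
  rfl

theorem holds_sameClass (h : HasInput x M) (hp : HasPerm x M) {ρ : ℕ → ℤ} {t : Term} {t' : ℕ}
    (ht : t.eval N M ρ = t') (h0 : 0 < t') (ht' : t' < x.n) :
    (sameClass t).Holds N M ρ ↔
      x.cols.γ (t' - 1) = x.cols.γ t' ∧ x.cols.a (t' - 1) = x.cols.a t' := by
  rw [sameClass, holds_and, holds_colEq h hp (eval_pred ht h0) (by omega) ht ht' (eval_attrG h),
    holds_colEq h hp (eval_pred ht h0) (by omega) ht ht' (eval_attrA h)]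
  rfl

theorem eval_colNum (h : HasInput x M) (hp : HasPerm x M) {ρ : ℕ → ℤ} {t : Term} {t' : ℕ}
    (ht : t.eval N M ρ = t') (ht' : t' < x.n) :
    (colNum t).eval N M ρ = (x.cols.a t').num :=
  eval_num h (eval_arr_perm hp ht ht') (x.perm_lt ht') (eval_attrA h)

theorem eval_colDen (h : HasInput x M) (hp : HasPerm x M) {ρ : ℕ → ℤ} {t : Term} {t' : ℕ}
    (ht : t.eval N M ρ = t') (ht' : t' < x.n) :
    (colDen t).eval N M ρ = (x.cols.a t').den :=
  eval_den h (eval_arr_perm hp ht ht') (x.perm_lt ht') (eval_attrA h)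

theorem represents_max (h : HasInput x M) (hp : HasPerm x M) :
    max.Represents (Scheme.maxScheme x.cols) x.n N M where
  wt ρ l t g k t' g' k' ht ht' hg hg' _ _ := by
    classical
    simp only [max, Scheme.maxScheme]
    split_ifs with h0 h1 h2 h3 h4 <;>
      simp_all only [eval_lit, eval_pos, holds_eq, holds_colLe h hp ht ht' hg hg', Nat.cast_inj] <;>
      simp
  fin ρ c c' hc := by
    simp only [max, Scheme.maxScheme, holds_and, holds_eq, hc, eval_lit]
    norm_cast
  le ρ b c b' c' hb hc b4 _ c4 _ := holds_colLe h hp (hb 4) b4 (hc 4) c4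
  conn ρ _ _ _ _ _ := holds_lit_zero ρ

theorem represents_min (h : HasInput x M) (hp : HasPerm x M) :
    min.Represents (Scheme.minScheme x.cols) x.n N M where
  wt ρ l t g k t' g' k' ht ht' hg hg' _ _ := by
    classical
    simp only [min, Scheme.minScheme]
    split_ifs with h0 h1 h2 h3 h4 <;>
      simp_all only [eval_lit, eval_pos, holds_eq, holds_colLe h hp hg hg' ht ht', Nat.cast_inj] <;>
      simp
  fin ρ c c' hc := by
    simp only [min, Scheme.minScheme, holds_and, holds_eq, hc, eval_lit]
    norm_cast
  le ρ b c b' c' hb hc b4 _ c4 _ := holds_colLe h hp (hb 4) b4 (hc 4) c4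
  conn ρ _ _ _ _ _ := holds_lit_zero ρ

theorem represents_count : count.Represents Scheme.countScheme x.n N M where
  wt ρ l t g k t' g' k' ht ht' hg hg' _ _ := by
    simp only [count, Scheme.countScheme]
    split_ifs <;> simp
  fin ρ c c' hc := holds_lit_one ρ
  le ρ b c b' c' hb hc _ _ _ _ := by
    simp only [count, Scheme.countScheme, holds_le, hb, hc, Nat.cast_le]
  conn ρ _ _ _ _ _ := holds_lit_zero ρ

theorem represents_countd (h : HasInput x M) (hp : HasPerm x M) :
    countd.Represents (Scheme.countdScheme x.cols) x.n N M where
  wt ρ l t g k t' g' k' ht ht' hg hg' _ _ := by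
    classical
    have key : ((lit 0).lt t).Holds N M ρ ∧ (sameClass t).Holds N M ρ ↔
        0 < t' ∧ x.cols.γ (t' - 1) = x.cols.γ t' ∧ x.cols.a (t' - 1) = x.cols.a t' := by
      rw [holds_lt, ht, eval_lit, Int.natCast_pos]
      exact and_congr_right fun h0 => holds_sameClass h hp ht h0 ht'
    simp only [countd, Scheme.countdScheme]
    by_cases h0 : l = 0
    · simp [h0]
    · by_cases h1 : l = 1
      · rw [if_neg h0, if_pos h1, if_neg h0, if_pos h1, eval_pos, holds_not, holds_and, key]
        split_ifs <;> simp_all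
      · simp [h0, h1]
  fin ρ c c' hc := holds_lit_one ρ
  le ρ b c b' c' hb hc _ _ _ _ := by
    simp only [countd, Scheme.countdScheme, holds_le, hb, hc, Nat.cast_le]
  conn ρ t t' ht h0 ht' := holds_sameClass h hp ht h0 ht'

theorem add_le_add_iff_num_den (p q r s : ℚ) : p + q ≤ r + s ↔
    (p.num * q.den + q.num * p.den) * (r.den * s.den) ≤
      (r.num * s.den + s.num * r.den) * (p.den * q.den) := by
  have hp : (0 : ℚ) < p.den := by exact_mod_cast p.pos
  have hq : (0 : ℚ) < q.den := by exact_mod_cast q.pos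
  have hr : (0 : ℚ) < r.den := by exact_mod_cast r.pos
  have hs : (0 : ℚ) < s.den := by exact_mod_cast s.pos
  conv_lhs => rw [← Rat.num_div_den p, ← Rat.num_div_den q, ← Rat.num_div_den r,
    ← Rat.num_div_den s]
  rw [div_add_div _ _ hp.ne' hq.ne', div_add_div _ _ hr.ne' hs.ne',
    div_le_div_iff₀ (mul_pos hp hq) (mul_pos hr hs), mul_comm (p.den : ℚ) q.num,
    mul_comm (r.den : ℚ) s.num]
  exact_mod_cast Iff.rfl

theorem represents_median (h : HasInput x M) (hp : HasPerm x M) :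
    median.Represents (Scheme.medianScheme x.cols) x.n N M where
  wt ρ l t g k t' g' k' ht ht' hg hg' hk _ := by
    classical
    simp only [median, Scheme.medianScheme]
    by_cases h0 : l = 0
    · simp [h0]
    by_cases h1 : l = 1
    · rw [if_neg h0, if_pos h1, if_neg h0, if_pos h1, eval_pos, holds_lt, ht, hg, Nat.cast_lt]
      split_ifs <;> simp
    by_cases h2 : l = 2
    · rw [if_neg h0, if_neg h1, if_pos h2, if_neg h0, if_neg h1, if_pos h2, eval_pos, holds_lt,
        ht, hk, Nat.cast_lt]
      split_ifs <;> simp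
    by_cases h3 : l = 3
    · rw [if_neg h0, if_neg h1, if_neg h2, if_pos h3, if_neg h0, if_neg h1, if_neg h2, if_pos h3,
        eval_add, eval_pos, eval_pos, holds_eq, holds_eq, ht, hg, hk, Nat.cast_inj, Nat.cast_inj]
      split_ifs <;> simp
    · simp [h0, h1, h2, h3]
  fin ρ c c' hc := by
    classical
    have : (c 0 - pos (c 0)).eval N M ρ = (c' 0 - 1 : ℕ) := by
      have h0 : (c 0).Holds N M ρ ↔ 0 < c' 0 := by rw [Holds, hc, Int.natCast_pos]
      rw [eval_sub, eval_pos, hc, h0]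
      split_ifs <;> omega
    simp only [median, Scheme.medianScheme, holds_and, holds_eq, eval_div, this, hc, eval_lit]
    norm_cast
  le ρ b c b' c' hb hc b4 b5 c4 c5 := by
    simp only [median, Scheme.medianScheme, holds_le, eval_mul, eval_add,
      eval_colNum h hp (hb 4) b4, eval_colNum h hp (hb 5) b5, eval_colNum h hp (hc 4) c4,
      eval_colNum h hp (hc 5) c5, eval_colDen h hp (hb 4) b4, eval_colDen h hp (hb 5) b5,
      eval_colDen h hp (hc 4) c4, eval_colDen h hp (hc 5) c5]
    exact (add_le_add_iff_num_den _ _ _ _).symm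
  conn ρ _ _ _ _ _ := holds_lit_zero ρ

end SchemeTerm

namespace Instance

/-- The sum of the absolute values in an integer column `A`. -/
def absSum (x : Instance) : ℕ := ∑ u ∈ Finset.range x.n, (x.tup u x.A).num.natAbs

noncomputable def intCol (x : Instance) (i : ℕ) : ℤ := (x.cols.a i).num

theorem natAbs_intCol_le (x : Instance) {t : ℕ} (ht : t < x.n) :
    (x.intCol t).natAbs ≤ x.absSum :=
  Finset.single_le_sum (f := fun u => (x.tup u x.A).num.natAbs) (fun _ _ => Nat.zero_le _)
    (Finset.mem_range.2 (x.perm_lt ht))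

theorem cols_a_eq {x : Instance} (hx : x.IntegerColumn) {t : ℕ} (ht : t < x.n) :
    x.cols.a t = x.intCol t := by
  obtain ⟨z, hz⟩ := hx _ (x.tup_mem (x.perm_lt ht))
  change x.cols.a t = z at hz
  rw [intCol, hz]
  simp

end Instance

namespace SchemeTerm

open Term

variable {x : Instance} {N : ℕ} {M : ℕ → ℤ → ℤ}

theorem eval_shifted (h : HasInput x M) (hp : HasPerm x M) (hN : x.n ≤ N) {ρ : ℕ → ℤ} {t : Term}
    {t' : ℕ} (ht : t.eval N M ρ = t') (ht' : t' < x.n) :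
    (colNum t + absSum).eval N M ρ = (x.intCol t' + x.absSum).toNat := by
  have := x.natAbs_intCol_le ht'
  rw [eval_add, eval_colNum h hp ht ht', eval_absSum h hN, Int.toNat_of_nonneg (by omega)]
  rfl

theorem represents_sum (h : HasInput x M) (hp : HasPerm x M) (hN : x.n ≤ N) :
    sum.Represents (Scheme.sumScheme x.intCol x.absSum) x.n N M where
  wt ρ l t g k t' g' k' ht ht' _ _ _ _ := by
    simp only [sum, Scheme.sumScheme]
    split_ifs
    · simp
    · exact eval_shifted h hp hN ht ht'
    · simp
  fin ρ c c' hc := holds_lit_one ρ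
  le ρ b c b' c' hb hc _ _ _ _ := by
    simp only [sum, Scheme.sumScheme, holds_le, eval_sub, eval_mul, hb, hc, eval_absSum h hN]
    rfl
  conn ρ _ _ _ _ _ := holds_lit_zero ρ

theorem represents_avg (h : HasInput x M) (hp : HasPerm x M) (hN : x.n ≤ N) :
    avg.Represents (Scheme.avgScheme x.intCol x.absSum) x.n N M where
  wt ρ l t g k t' g' k' ht ht' _ _ _ _ := by
    simp only [avg, Scheme.avgScheme]
    split_ifs
    · simp
    · exact eval_shifted h hp hN ht ht'
    · simp
  fin ρ c c' hc := holds_lit_one ρ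
  le ρ b c b' c' hb hc _ _ _ _ := by
    simp only [avg, Scheme.avgScheme, holds_le, eval_sub, eval_mul, hb, hc, eval_absSum h hN]
    rfl
  conn ρ _ _ _ _ _ := holds_lit_zero ρ

end SchemeTerm

end AODRepair

namespace AODRepair

/-! ### Expressions for the tables of the algorithm -/

namespace Term

/-- The base for packing states; `w` bounds the absolute values of the summands. -/
def base (w : Term) : Term := (lit 2 * size + lit 2) * (w + lit 1)
def states (w : Term) : Term := (base w).pow 13
def value (w i q : Term) : Term := arr 3 (i * states w + q)

/-- One plus the weight of a heaviest path to a state. -/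
def valueTable (s : SchemeTerm) (w : Term) : Term :=
  let i := var 0 / states w
  let y := var 0 - var 0 / states w * states w
  pos ((i.eq (lit 0)).and (y.eq (lit 0))) + pos (((lit 0).lt i).and (i.le size)) *
    maxOver 1 2 (pos (((var 1).lt (states w)).and ((step s (base w) (i - lit 1) (var 1) y).and
      ((lit 0).lt (value w (i - lit 1) (var 1))))) *
      (value w (i - lit 1) (var 1) + dig (base w) y 12))

/-- Cell `j - 1` of array `4` holds the state already chosen in the following layer. Maximality in
the last layer is phrased as the absence of a state with larger value. -/
def backCond (s : SchemeTerm) (w : Term) : Term :=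
  let y := arr 4 (var 0 - lit 1)
  let i := size - var 0
  ((var 0).le size).and (((var 2).lt (states w)).and
    ((((var 0).eq (lit 0)).and
        (ex 3 (((var 3).lt (states w)).and
          ((value w size (var 2)).lt (value w size (var 3))))).not).or
      (((lit 0).lt (var 0)).and ((y.lt (states w)).and ((step s (base w) i (var 2) y).and
        (((lit 0).lt (value w i (var 2))).and
          ((value w i (var 2) + dig (base w) y 12).eq (value w (i + lit 1) y))))))))

/-- The states of a heaviest path, backwards. -/
def backTable (s : SchemeTerm) (w : Term) : Term := least 1 2 (backCond s w)

def chosen (w i : Term) : Term := (dig (base w) (arr 4 (size - (i + lit 1))) 12).eq (lit 1)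
/-- The number of chosen positions before `i`; uses variable `2`. -/
def before (w i : Term) : Term :=
  sum 2 (pos (((var 2).lt size).and (((var 2).lt i).and (chosen w (var 2)))))
/-- The chosen position number `r`; uses variables `1` and `2`. -/
def select (w r : Term) : Term :=
  sum 1 (pos (((var 1).lt size).and ((chosen w (var 1)).and ((before w (var 1)).eq r))) * var 1)
def outLength (w : Term) : Term := lit 2 + before w size * (lit 2 * arity)
-- After the two leading cells, entry `o` of output tuple `r` is copied from the input, from the
-- tuple at the `r`-th chosen position of the sorted order.
def outTable (w : Term) : Term :=
  let m := lit 2 * arity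
  let r := (var 0 - lit 2) / m
  let o := var 0 - lit 2 - r * m
  pos ((var 0).eq (lit 0)) * arity + pos ((var 0).eq (lit 1)) * before w size +
    pos (((lit 2).le (var 0)).and ((var 0).lt (outLength w))) *
      arr 0 (lit 4 + arr 2 (select w r) * m + o)
-- The first summand makes room for all pairs of a layer and a state; the second is the length of
-- the input, which exceeds that of the output.
def boundTerm (w : Term) : Term :=
  (size + lit 1) * states w + (lit 4 + size * (lit 2 * arity))

end Term

/-- The expressions `s` and `w` describe the scheme `S` and the number `W` on input `x`. -/
structure Describes (x : Instance) (s : SchemeTerm) (w : Term) (S : Scheme) (W : ℕ) : Prop where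
  weight : ∀ N M ρ, HasInput x M → x.n ≤ N → w.eval N M ρ = W
  scheme : ∀ N M, HasInput x M → HasPerm x M → x.n ≤ N → s.Represents S x.n N M

namespace Instance

variable (x : Instance) (S : Scheme) (W N : ℕ)

def base : ℕ := (2 * x.n + 2) * (W + 1)
@[irreducible] def numStates : ℕ := x.base W ^ 13
def bound : ℕ := (x.n + 1) * x.numStates W + (4 + x.n * (2 * x.k))

noncomputable def pathValue (i y : ℕ) : ℕ :=
  AODRepair.pathValue (x.numStates W) (S.PackedStep x.cols (x.base W))
    (fun y => Scheme.digit (x.base W) y 12) i y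

/-- The layers lie one after the other in a single array; cells behind layer `x.n` are filled with
`0`. -/
noncomputable def value (z : ℕ) : ℕ :=
  if z / x.numStates W ≤ x.n then x.pathValue S W (z / x.numStates W) (z % x.numStates W) else 0

noncomputable def back (j : ℕ) : ℕ :=
  AODRepair.back N (x.numStates W) (S.PackedStep x.cols (x.base W))
    (fun y => Scheme.digit (x.base W) y 12) x.n j

noncomputable def taken : Finset ℕ := S.taken x.cols (x.base W) N

theorem pathValue_le (i y : ℕ) : x.pathValue S W i y ≤ i + 1 :=
  AODRepair.pathValue_le (fun _ _ _ h => h.bit) i y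

theorem numStates_pos : 0 < x.numStates W := by
  unfold numStates base; positivity

variable {x S W N}

theorem value_eq {i q : ℕ} (hi : i ≤ x.n) (hq : q < x.numStates W) :
    x.value S W (i * x.numStates W + q) = x.pathValue S W i q := by
  have h1 : (i * x.numStates W + q) / x.numStates W = i := by
    rw [mul_comm, Nat.mul_add_div (x.numStates_pos W), Nat.div_eq_of_lt hq, add_zero]
  have h2 : (i * x.numStates W + q) % x.numStates W = q := by
    rw [mul_comm, Nat.mul_add_mod, Nat.mod_eq_of_lt hq]
  rw [value, h1, h2, if_pos hi]

theorem index_lt (hN : x.bound W ≤ N) {i q : ℕ} (hi : i ≤ x.n) (hq : q < x.numStates W) :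
    i * x.numStates W + q < N := by
  have := Nat.mul_le_mul_right (x.numStates W) hi
  unfold bound at hN
  rw [Nat.succ_mul] at hN
  omega

theorem numStates_le (hN : x.bound W ≤ N) : x.numStates W ≤ N := by
  unfold bound at hN
  rw [Nat.succ_mul] at hN
  omega

theorem succ_n_le (hN : x.bound W ≤ N) : x.n + 1 ≤ N := by
  have := Nat.le_mul_of_pos_right (x.n + 1) (x.numStates_pos W)
  unfold bound at hN
  omega

theorem value_le (hN : x.bound W ≤ N) (z : ℕ) : x.value S W z ≤ N := by
  have h := succ_n_le hN
  unfold value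
  split_ifs with h1
  · have := x.pathValue_le S W (z / x.numStates W) (z % x.numStates W)
    omega
  · omega

theorem back_le (j : ℕ) : x.back S W N j ≤ N := AODRepair.back_le

theorem mem_taken {i : ℕ} : i ∈ x.taken S W N ↔
    i < x.n ∧ Scheme.digit (x.base W) (x.back S W N (x.n - (i + 1))) 12 = 1 := by
  unfold taken Scheme.taken
  rw [Finset.mem_filter, Finset.mem_range]
  unfold back numStates
  rfl

end Instance

namespace Term

variable {x : Instance} {S : Scheme} {W N : ℕ} {M : ℕ → ℤ → ℤ} {ρ : ℕ → ℤ} {s : SchemeTerm}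
  {w : Term}

theorem eval_base (hd : Describes x s w S W) (h : HasInput x M) (hn : x.n ≤ N) :
    (base w).eval N M ρ = x.base W := by
  simp only [base, eval_mul, eval_add, eval_lit, eval_size h, hd.weight N M ρ h hn, Instance.base]
  push_cast
  rfl

theorem eval_states (hd : Describes x s w S W) (h : HasInput x M) (hn : x.n ≤ N) :
    (states w).eval N M ρ = x.numStates W := by
  unfold Instance.numStates
  rw [states, eval_pow, eval_base hd h hn, Nat.cast_pow]

/-- Any parameter `N ≥ x.n` will do, so the input length can serve as a provisional parameter for
computing the final one. -/
theorem eval_boundTerm (hd : Describes x s w S W) (h : HasInput x M) (hn : x.n ≤ N) :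
    (boundTerm w).eval N M ρ = x.bound W := by
  simp only [boundTerm, eval_mul, eval_add, eval_lit, eval_size h, eval_states hd h hn,
    eval_arity h, Instance.bound]
  push_cast
  rfl

/-- Correctness of array `3` is assumed only below `z`, so that this applies while the array is
being filled as well as afterwards. -/
theorem eval_value (hd : Describes x s w S W) (h : HasInput x M) (hN : x.bound W ≤ N) {z : ℕ}
    (hz : ∀ j < z, M 3 j = x.value S W j) {i q : Term} {i' q' : ℕ} (hi : i.eval N M ρ = i')
    (hi' : i' ≤ x.n) (hq : q.eval N M ρ = q') (hq' : q' < x.numStates W)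
    (hlt : i' * x.numStates W + q' < z) :
    (value w i q).eval N M ρ = x.pathValue S W i' q' := by
  have hn := (Nat.le_succ _).trans (Instance.succ_n_le hN)
  rw [value, eval_arr, eval_add, eval_mul, hi, hq, eval_states hd h hn,
    ← Instance.value_eq hi' hq', ← hz _ hlt]
  push_cast
  rfl

theorem natCast_sub_div_mul (z m : ℕ) : (z : ℤ) - (z / m : ℕ) * m = (z % m : ℕ) := by
  have h := Nat.div_add_mod z m
  generalize z / m = q at *
  generalize z % m = r at *
  subst h
  push_cast
  ring

theorem eval_valueTable (hd : Describes x s w S W) (h : HasInput x M) (hp : HasPerm x M)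
    (hN : x.bound W ≤ N) {z : ℕ} (hz : ∀ j < z, M 3 j = x.value S W j) (hρ : ρ 0 = z) :
    (valueTable s w).eval N M ρ = x.value S W z := by
  classical
  have hn := (Nat.le_succ _).trans (Instance.succ_n_le hN)
  have hS := x.numStates_pos W
  have ei : ∀ ρ' : ℕ → ℤ, ρ' 0 = z →
      (var 0 / states w).eval N M ρ' = (z / x.numStates W : ℕ) := fun ρ' h' => by
    rw [eval_div, eval_var, h', eval_states hd h hn]
    norm_cast
  have ey : ∀ ρ' : ℕ → ℤ, ρ' 0 = z →
      (var 0 - var 0 / states w * states w).eval N M ρ' = (z % x.numStates W : ℕ) :=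
    fun ρ' h' => by
      rw [eval_sub, eval_mul, ei ρ' h', eval_states hd h hn, eval_var, h', natCast_sub_div_mul]
  set i := z / x.numStates W with hi
  set y := z % x.numStates W with hy
  have hzi : z = i * x.numStates W + y := by
    have := Nat.div_add_mod z (x.numStates W)
    rw [mul_comm] at this
    exact this.symm
  clear_value i y
  simp only [valueTable, eval_add, eval_mul, eval_pos, holds_and, holds_eq, holds_lt, holds_le,
    ei ρ hρ, ey ρ hρ, eval_lit, eval_size h, Instance.value, ← hi, ← hy]
  rcases Nat.eq_zero_or_pos i with h0 | h0
  · rw [h0, if_pos (Nat.zero_le _), if_neg (c := 0 < ((0 : ℕ) : ℤ) ∧ ((0 : ℕ) : ℤ) ≤ x.n) (by simp),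
      zero_mul, add_zero]
    simp only [Instance.pathValue, pathValue]
    by_cases hy0 : y = 0 <;> simp [hy0]
  by_cases hin : i ≤ x.n
  · obtain ⟨k, rfl⟩ : ∃ k, i = k + 1 := ⟨i - 1, by omega⟩
    rw [if_neg (by rintro ⟨h1, -⟩; omega), zero_add, if_pos ⟨by omega, by omega⟩, one_mul,
      if_pos hin]
    set R := S.PackedStep x.cols (x.base W) with hR
    set F : ℕ → ℕ := fun u => if u < x.numStates W ∧ R k u y ∧ 0 < x.pathValue S W k u then
      x.pathValue S W k u + Scheme.digit (x.base W) y 12 else 0 with hF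
    rw [eval_maxOver (f := F) (by norm_num)]
    · congr 1
      rw [Instance.pathValue, pathValue]
      have hsub : Finset.range (x.numStates W) ⊆ Finset.range N :=
        Finset.range_mono (Instance.numStates_le hN)
      refine le_antisymm (Finset.sup_le fun u _ => ?_) (Finset.sup_le fun u hu => ?_)
      · by_cases hu : u < x.numStates W
        · refine le_trans (le_of_eq ?_) (Finset.le_sup (Finset.mem_range.2 hu))
          simp only [hF, hu, true_and]
          rfl
        · simp [hF, hu]
      · refine le_trans (le_of_eq ?_) (Finset.le_sup (f := F) (hsub hu))
        simp only [hF, Finset.mem_range.1 hu, true_and]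
        rfl
    -- A value in layer `k` is at most `k + 1` and a step adds at most one, so `F` stays below `x.n
    -- + 1 ≤ N`.
    · intro u _
      simp only [hF]
      split_ifs with hc
      · have h1 := x.pathValue_le S W k u
        have h2 : Scheme.digit (x.base W) y 12 ≤ 1 := hc.2.1.bit
        have := Instance.succ_n_le hN
        omega
      · omega
    · intro v _ u _
      set ρ' := Function.update (Function.update ρ 2 (v : ℤ)) 1 (u : ℤ) with hρ'
      have h0' : ρ' 0 = z := by simp [hρ', hρ]
      have h1' : (var 1).eval N M ρ' = u := by simp [hρ']
      have ek : (var 0 / states w - lit 1).eval N M ρ' = k := eval_pred (ei ρ' h0') h0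
      have hstep := holds_step h hp (hd.scheme N M h hp hn) (eval_base hd h hn) ek (by omega) h1'
        (ey ρ' h0')
      rw [eval_mul, eval_pos, holds_and, holds_and, hstep, holds_lt, holds_lt,
        eval_states hd h hn, h1', eval_add, eval_dig (eval_base hd h hn) (ey ρ' h0'), Nat.cast_lt,
        eval_lit]
      by_cases hu : u < x.numStates W
      -- All of layer `k` precedes layer `k + 1` in the array, so this entry is already there.
      · have hlt : k * x.numStates W + u < z := by
          rw [hzi, Nat.succ_mul]; omega
        rw [eval_value hd h hN hz ek (by omega) h1' hu hlt, Int.natCast_pos]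
        simp only [hF]
        split_ifs
        · rw [one_mul, Nat.cast_add]
        · rw [zero_mul, Nat.cast_zero]
      · rw [if_neg fun hc => hu hc.1, zero_mul]
        simp [hF, hu]
  · rw [if_neg (by rintro ⟨h1, -⟩; omega), zero_add, if_neg (by rintro ⟨-, h1⟩; omega), zero_mul,
      if_neg hin]
    rfl

theorem holds_backCond (hd : Describes x s w S W) (h : HasInput x M) (hp : HasPerm x M)
    (hN : x.bound W ≤ N) (hV : ∀ z < N, M 3 z = x.value S W z) {j v y : ℕ}
    (hy : 0 < j → M 4 (j - 1 : ℕ) = y) (h0 : ρ 0 = j) (h2 : ρ 2 = v) :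
    (backCond s w).Holds N M ρ ↔ BackCond (x.numStates W) (S.PackedStep x.cols (x.base W))
      (fun y => Scheme.digit (x.base W) y 12) x.n j y v := by
  have hn := (Nat.le_succ _).trans (Instance.succ_n_le hN)
  have e2 : ∀ {ρ' : ℕ → ℤ}, ρ' 2 = v → (var 2).eval N M ρ' = v := fun h => h
  rw [backCond]
  simp only [holds_and, holds_or, holds_not, holds_le, holds_lt, eval_var, h0, h2, eval_size h,
    eval_states hd h hn, Nat.cast_lt, Nat.cast_le]
  refine and_congr_right fun hj => and_congr_right fun hv => or_congr ?_ ?_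
  · refine and_congr (by rw [holds_eq, eval_var, h0, eval_lit]; exact Nat.cast_eq_zero) ?_
    rw [holds_ex]
    have key : ∀ z < x.numStates W, ((value w size (var 2)).lt (value w size (var 3))).Holds N M
        (Function.update ρ 3 (z : ℤ)) ↔ x.pathValue S W x.n v < x.pathValue S W x.n z := by
      intro z hz
      rw [holds_lt, eval_value hd h hN hV (eval_size h) le_rfl (e2 (by simp [h2])) hv
        (Instance.index_lt hN le_rfl hv), eval_value hd h hN hV (eval_size h) le_rfl
        (q := var 3) (q' := z) (by simp) hz (Instance.index_lt hN le_rfl hz), Nat.cast_lt]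
    constructor
    · intro hex z hz
      by_contra hc
      refine hex ⟨z, lt_of_lt_of_le hz (Instance.numStates_le hN), ?_⟩
      rw [holds_and, key z hz]
      refine ⟨?_, not_le.1 hc⟩
      rw [holds_lt, eval_states hd h hn]
      simpa using hz
    · rintro hall ⟨z, _, hz⟩
      rw [holds_and, holds_lt, eval_states hd h hn] at hz
      have hz1 : z < x.numStates W := by simpa using hz.1
      have := (key z hz1).1 hz.2
      exact absurd (hall z hz1) (not_le.2 this)
  · rw [eval_lit, Int.natCast_pos]
    refine and_congr_right fun hj0 => ?_
    have ey : (arr 4 (var 0 - lit 1)).eval N M ρ = y := by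
      rw [eval_arr, eval_pred (i := var 0) h0 hj0, hy hj0]
    have ei : (size - var 0).eval N M ρ = (x.n - j : ℕ) := by
      rw [eval_sub, eval_size h, eval_var, h0]; omega
    have ei1 : (size - var 0 + lit 1).eval N M ρ = (x.n - j + 1 : ℕ) := by
      rw [eval_add, ei, eval_lit]; rfl
    rw [ey, Nat.cast_lt]
    refine and_congr_right fun hys => and_congr ?_ (and_congr ?_ ?_)
    · exact holds_step h hp (hd.scheme N M h hp hn) (eval_base hd h hn) ei (by omega) (e2 h2) ey
    · rw [eval_value hd h hN hV ei (by omega) (e2 h2) hv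
        (Instance.index_lt hN (by omega) hv), Int.natCast_pos]
      rfl
    · rw [holds_eq, eval_add, eval_value hd h hN hV ei (by omega) (e2 h2) hv
        (Instance.index_lt hN (by omega) hv), eval_dig (eval_base hd h hn) ey,
        eval_value hd h hN hV ei1 (by omega) ey hys (Instance.index_lt hN (by omega) hys),
        ← Nat.cast_add, Nat.cast_inj]
      rfl

theorem eval_backTable (hd : Describes x s w S W) (h : HasInput x M) (hp : HasPerm x M)
    (hN : x.bound W ≤ N) (hV : ∀ z < N, M 3 z = x.value S W z) {j : ℕ}
    (hB : ∀ i < j, M 4 i = x.back S W N i) (hρ : ρ 0 = j) :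
    (backTable s w).eval N M ρ = x.back S W N j := by
  have key : ∀ y : ℕ, (0 < j → M 4 (j - 1 : ℕ) = y) → (backTable s w).eval N M ρ =
      leastBelow N (BackCond (x.numStates W) (S.PackedStep x.cols (x.base W))
        (fun y => Scheme.digit (x.base W) y 12) x.n j y) := fun y hy =>
    eval_least (by norm_num) fun u _ v _ =>
      holds_backCond hd h hp hN hV hy (by simp [hρ]) (by simp)
  rcases j with _ | j
  -- There is no state after the last layer; `back` uses `0` as a dummy.
  · exact key 0 fun h => absurd h (lt_irrefl _)
  · exact key _ fun _ => hB j (Nat.lt_succ_self j)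

/-! ### Correctness of the output expressions. -/

section Output

variable (hd : Describes x s w S W) (h : HasInput x M) (hN : x.bound W ≤ N)
  (hB : ∀ j < N, M 4 j = x.back S W N j)

include hd h hN hB

theorem holds_chosen {i : Term} {i' : ℕ} (hi : i.eval N M ρ = i') (hi' : i' < x.n) :
    (chosen w i).Holds N M ρ ↔ i' ∈ x.taken S W N := by
  have hn := Instance.succ_n_le hN
  have e : (arr 4 (size - (i + lit 1))).eval N M ρ = x.back S W N (x.n - (i' + 1)) := by
    rw [eval_arr, ← hB _ (by omega), eval_sub, eval_size h, eval_add, hi, eval_lit]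
    congr 1
    omega
  rw [chosen, holds_eq, eval_dig (eval_base hd h (by omega)) e, Instance.mem_taken, eval_lit]
  constructor
  · exact fun h => ⟨hi', by exact_mod_cast h⟩
  · exact fun h => by exact_mod_cast h.2

theorem eval_before {i : Term} {i' : ℕ} (hi : ∀ u : ℤ, i.eval N M (Function.update ρ 2 u) = i') :
    (before w i).eval N M ρ = ((x.taken S W N).filter fun t => t < i').card := by
  classical
  have hn := Instance.succ_n_le hN
  have e : (x.taken S W N).filter (fun t => t < i') =
      (Finset.range x.n).filter fun t => t < i' ∧ t ∈ x.taken S W N := by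
    ext t
    simp only [Finset.mem_filter, Finset.mem_range]
    exact ⟨fun h => ⟨(Instance.mem_taken.1 h.1).1, h.2, h.1⟩, fun h => ⟨h.2.2, h.2.1⟩⟩
  rw [e, Finset.card_filter, Nat.cast_sum]
  refine eval_sum_of_le (by omega) (fun u hu => ?_) fun u _ hu => ?_
  · rw [eval_pos, holds_and, holds_and, holds_lt, holds_lt, eval_size h, hi,
      holds_chosen hd h hN hB (i' := u) (by simp) hu]
    simp [hu]
  · rw [eval_pos, if_neg]
    rw [holds_and, holds_lt, eval_size h]
    simp [hu]

theorem eval_before_size : (before w size).eval N M ρ = (x.taken S W N).card := by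
  rw [eval_before hd h hN hB (i' := x.n) fun _ => eval_size h]
  congr 2
  exact Finset.filter_true_of_mem fun t ht => (Instance.mem_taken.1 ht).1

theorem eval_outLength : (outLength w).eval N M ρ =
    (encodeTuples (x.subList (x.taken S W N))).length := by
  rw [length_encodeTuples, Instance.subList, List.length_map, Finset.length_sort, outLength,
    eval_add, eval_mul, eval_before_size hd h hN hB, eval_mul, eval_arity h, eval_lit]
  push_cast
  rfl

theorem eval_select {r : Term} {r' : ℕ} (hr : ∀ u : ℤ, r.eval N M (Function.update ρ 1 u) = r') :
    (select w r).eval N M ρ = (∑ i ∈ Finset.range x.n, if i ∈ x.taken S W N ∧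
      ((x.taken S W N).filter fun t => t < i).card = r' then i else 0 : ℕ) := by
  classical
  have hn := Instance.succ_n_le hN
  rw [Nat.cast_sum]
  refine eval_sum_of_le (by omega) (fun u hu => ?_) fun u _ hu => ?_
  · rw [eval_mul, eval_pos, holds_and, holds_and, holds_lt, eval_size h, holds_eq, hr,
      holds_chosen hd h hN hB (i' := u) (by simp) hu,
      eval_before hd h hN hB (i' := u) (by simp), eval_var, Function.update_self, Nat.cast_inj,
      Nat.cast_lt]
    simp only [hu, true_and]
    split_ifs <;> simp
  · rw [eval_mul, eval_pos, if_neg, zero_mul]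
    rw [holds_and, holds_lt, eval_size h]
    simp [hu]

theorem eval_outTable (hp : HasPerm x M) {z : ℕ} (hρ : ρ 0 = z) : (outTable w).eval N M ρ =
    (encodeTuples (x.subList (x.taken S W N))).getD z 0 := by
  classical
  set T := x.taken S W N with hT
  have hTn : ∀ t ∈ T, t < x.n := fun t ht => (Instance.mem_taken.1 ht).1
  have hlen := length_encodeTuples (x.subList T)
  have hcard : (x.subList T).length = T.card := by
    rw [Instance.subList, List.length_map, Finset.length_sort]
  rw [hcard] at hlen
  have hk : 0 < x.k := x.G.pos
  simp only [outTable, eval_add, eval_mul (pos _), eval_pos, holds_eq, holds_and, holds_le,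
    holds_lt, eval_outLength hd h hN hB, eval_before_size hd h hN hB, eval_arity h]
  simp only [eval_var, hρ, eval_lit]
  rcases z with _ | _ | z
  · simp [encodeTuples]
  · simp [encodeTuples, ← hT, hcard]
  · rw [if_neg (by omega), if_neg (by omega), zero_mul, zero_mul, zero_add, zero_add, ← hT, hlen]
    by_cases hz : z < T.card * (2 * x.k)
    · rw [if_pos ⟨by omega, Nat.cast_lt.2 (by omega)⟩, one_mul]
      set r := z / (2 * x.k) with hr
      set o := z % (2 * x.k) with ho
      have hzro : z = r * (2 * x.k) + o := by
        have := Nat.div_add_mod z (2 * x.k)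
        rw [mul_comm] at this
        exact this.symm
      have hrT : r < T.card := Nat.div_lt_of_lt_mul (by rwa [mul_comm])
      have hok : o < 2 * x.k := Nat.mod_lt _ (by omega)
      have er : ∀ ρ' : ℕ → ℤ, ρ' 0 = (z + 1 + 1 : ℕ) →
          ((var 0 - lit 2) / (lit 2 * arity)).eval N M ρ' = r := fun ρ' h' => by
        rw [eval_div, eval_sub, eval_var, h', eval_mul, eval_arity h, eval_lit,
          show (((z + 1 + 1 : ℕ) : ℤ) - 2) = (z : ℤ) by omega, hr]
        push_cast
        rfl
      obtain ⟨g, hg, hsum, hsort⟩ := Instance.sum_sort hTn hrT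
      have esel := eval_select hd h hN hB (ρ := ρ) (r := (var 0 - lit 2) / (lit 2 * arity))
        (r' := r) fun u => er _ (by simp [hρ])
      rw [← hT, hsum] at esel
      have hgn := hTn g hg
      have eo : (var 0 - lit 2 - (var 0 - lit 2) / (lit 2 * arity) * (lit 2 * arity)).eval N M ρ =
          o := by
        rw [eval_sub, eval_sub, eval_mul, er ρ hρ, eval_var, hρ, eval_mul, eval_arity h, eval_lit]
        have : ((z : ℕ) : ℤ) = r * (2 * x.k) + o := by exact_mod_cast hzro
        push_cast
        omega
      rw [eval_arr, eval_add, eval_add, eo, eval_mul, eval_arr_perm hp esel hgn, eval_mul,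
        eval_arity h, eval_lit, eval_lit]
      have e1 : ((4 : ℤ) + x.perm g * (2 * x.k) + o) =
          ((4 + x.perm g * (2 * x.k) + o : ℕ) : ℤ) := by push_cast; rfl
      rw [e1, h, x.getD_encode (x.perm_lt hgn) hok]
      simp only [encodeTuples, List.getD_cons_succ]
      rw [hzro, getD_flatMap _ _ length_encodeTuple 0 (x.subList T) 0 r (by rwa [hcard]) o hok]
      congr 2
      rw [Instance.subList, List.getD_eq_getElem _ _ (by simpa using hrT), List.getElem_map,
        ← hsort, List.getD_eq_getElem _ _ (by simpa using hrT)]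
      rfl
    · rw [if_neg fun hc => hz (by have := Nat.cast_lt.1 hc.2; omega), zero_mul,
        List.getD_eq_default _ _ (by omega)]

end Output

end Term

end AODRepair

namespace AODRepair

/-! ### The algorithm -/

/-- The parameter is first the input length and then the computed bound, which evaluation at depth
`0` leaves in register `1`. The last evaluation likewise leaves the output length in register `1`,
as the output convention demands. -/
def repairProgram (s : SchemeTerm) (w : Term) : Program :=
  .seq (.copy 2 0) (.seq ((Term.boundTerm w).compile 0) (.seq (.copy 2 1)
    (.seq (tableProg 2 Term.perm) (.seq (tableProg 3 (Term.valueTable s w))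
      (.seq (tableProg 4 (Term.backTable s w)) (.seq (tableProg 1 (Term.outTable w))
        ((Term.outLength w).compile 0)))))))

open Polynomial in
/-- A bound for the parameter and the lengths of all numbers. -/
noncomputable def parameterBound : ℕ[X] := (2 * X + 1) * ((4 * X + 2) * (X + 1)) ^ 13 + 2 * X

open Polynomial in
noncomputable def repairCost (s : SchemeTerm) (w : Term) : ℕ[X] :=
  2 * (X + 2) + (Term.boundTerm w).cost + tableCost Term.perm + tableCost (Term.valueTable s w) +
    tableCost (Term.backTable s w) + tableCost (Term.outTable w) + (Term.outLength w).cost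

theorem eval_repairCost (s : SchemeTerm) (w : Term) (B : ℕ) : (repairCost s w).eval B =
    2 * (B + 2) + (Term.boundTerm w).cost.eval B + (tableCost Term.perm).eval B +
      (tableCost (Term.valueTable s w)).eval B + (tableCost (Term.backTable s w)).eval B +
      (tableCost (Term.outTable w)).eval B + (Term.outLength w).cost.eval B := by
  unfold repairCost
  generalize (Term.boundTerm w).cost = p1, tableCost Term.perm = p2,
    tableCost (Term.valueTable s w) = p3, tableCost (Term.backTable s w) = p4,
    tableCost (Term.outTable w) = p5, (Term.outLength w).cost = p6
  simp only [Polynomial.eval_add, Polynomial.eval_mul, Polynomial.eval_X, Polynomial.eval_ofNat]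

theorem bound_le {x : Instance} {W z : ℕ} (hlen : x.encode.length ≤ 2 * z) (hW : W ≤ z) :
    x.bound W ≤ parameterBound.eval z := by
  rw [x.length_encode] at hlen
  have hk : 0 < x.k := x.G.pos
  have hn : x.n ≤ 2 * z := by
    have := Nat.le_mul_of_pos_right x.n (show 0 < 2 * x.k by omega)
    omega
  simp only [parameterBound, Polynomial.eval_add, Polynomial.eval_mul, Polynomial.eval_pow,
    Polynomial.eval_X, Polynomial.eval_ofNat, Polynomial.eval_one]
  unfold Instance.bound Instance.numStates Instance.base
  refine Nat.add_le_add (Nat.mul_le_mul (by omega) (Nat.pow_le_pow_left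
    (Nat.mul_le_mul (by omega) (by omega)) 13)) hlen

theorem getD_fits {b : ℕ} {l : List ℤ} (h : ∀ z ∈ l, Fits b z) (i : ℕ) : Fits b (l.getD i 0) := by
  rcases lt_or_ge i l.length with hi | hi
  · rw [List.getD_eq_getElem _ _ hi]; exact h _ (List.getElem_mem _)
  · rw [List.getD_eq_default _ _ hi]; exact fits_zero _

theorem fits_encodeTuples {b k : ℕ} {l l' : List (Tuple k)} (h : ∀ z ∈ encodeTuples l, Fits b z)
    (hl : ∀ t ∈ l', t ∈ l) (hlen : l'.length ≤ b) : ∀ z ∈ encodeTuples l', Fits b z := by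
  intro z hz
  simp only [encodeTuples, List.mem_cons, List.mem_flatMap] at hz h
  rcases hz with rfl | rfl | ⟨t, ht, hz⟩
  · exact h _ (Or.inl rfl)
  · exact fits_natCast hlen
  · exact h z (Or.inr (Or.inr ⟨t, hl t ht, hz⟩))

/-- One number `B`, polynomial in `z`, bounds the parameter and the digits of all array entries
throughout the run. Each of the finitely many phases then costs a fixed polynomial in `B`. -/
theorem Exec.repairProgram {α : Agg} {s : SchemeTerm} {w : Term} {x : Instance} {S : Scheme}
    {W z : ℕ} (hd : Describes x s w S W) (hv : S.Valid x.cols α (x.base W))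
    (hfit : ∀ v ∈ x.encode, Fits z v) (hlen : x.encode.length ≤ 2 * z) (hW : W ≤ z) :
    ∃ t o c, Exec (repairProgram s w) (initState x.encode) t c ∧ HasOutput t o ∧ x.IsAnswer α o ∧
      c ≤ ((repairCost s w).comp parameterBound).eval z := by
  set N := x.bound W with hN
  set B := parameterBound.eval z with hB
  have hNB : N ≤ B := bound_le hlen hW
  have hzB : 2 * z ≤ B := by
    simp only [hB, parameterBound, Polynomial.eval_add, Polynomial.eval_mul, Polynomial.eval_X,
      Polynomial.eval_ofNat]
    omega
  have hfitB : ∀ v ∈ x.encode, Fits B v := fun v hv => (hfit v hv).mono (by omega)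
  have hnN := Instance.succ_n_le (N := N) (x := x) le_rfl
  set L := x.encode.length with hL
  have hnL : x.n ≤ L := by
    have := Nat.le_mul_of_pos_right x.n (show 0 < 2 * x.k by have := x.G.pos; omega)
    rw [hL, x.length_encode]; omega
  set s0 := initState x.encode with hs0
  have h0 : s0.reg 0 = (L : ℤ) := rfl
  have hmem0 : ∀ m i, Fits B (s0.mem m i) := by
    intro m i
    simp only [hs0, initState]
    split_ifs
    · exact getD_fits hfitB _
    · exact fits_zero _
  have hin0 : HasInput x s0.mem := by
    intro i
    simp [hs0, initState]
  set s1 := s0.setReg 2 (s0.reg 0) with hs1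
  have r1 : Ready L B s1 :=
    { le := by omega
      reg := by rw [hs1, State.setReg_reg, if_pos rfl, h0]
      mem := hmem0
      slots := fun y => by
        rw [hs1, State.setReg_reg, if_neg (by simp only [slot]; omega)]
        have : s0.reg (slot y) = 0 := by
          change (if slot y = 0 then (L : ℤ) else 0) = 0
          exact if_neg (by simp only [slot]; omega)
        rw [this]; exact fits_zero _ }
  obtain ⟨s2, c2, x2, a2, v2, k2⟩ := (Term.boundTerm w).exec_compile r1.le 0 s1 r1.reg r1.mem
    r1.slots
  have hin1 : HasInput x s1.mem := hin0
  rw [Term.eval_boundTerm hd hin1 hnL, ← hN] at v2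
  set s3 := s2.setReg 2 (s2.reg 1) with hs3
  have r2 := a2.ready r1
  have hin3 : HasInput x s3.mem := by
    have : s3.mem = s1.mem := a2.1
    rw [this]; exact hin1
  have r3 : Ready N B s3 :=
    { le := hNB
      reg := by rw [hs3, State.setReg_reg, if_pos rfl]; exact v2
      mem := r2.mem
      slots := fun y => by
        rw [hs3, State.setReg_reg, if_neg (by simp only [slot]; omega)]; exact r2.slots y }
  have keep : ∀ {m : ℕ} (hm : m ≠ 0) {M M' : ℕ → ℤ → ℤ}, (∀ m' ≠ m, M' m' = M m') →
      HasInput x M → HasInput x M' := fun hm _ _ h hi i => by rw [h 0 hm.symm]; exact hi i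
  have upd : ∀ {m m' : ℕ} (M : ℕ → ℤ → ℤ) (V : ℤ → ℤ), m' ≠ m →
      Function.update M m V m' = M m' := fun M V h => Function.update_of_ne h _ _
  have keepIn : ∀ {m : ℕ} (hm : m ≠ 0) {M : ℕ → ℤ → ℤ} (V : ℤ → ℤ), HasInput x M →
      HasInput x (Function.update M m V) := fun hm _ _ h => keep hm (fun _ => upd _ _) h
  have keepPerm : ∀ {m : ℕ} (hm : m ≠ 2) {M : ℕ → ℤ → ℤ} (V : ℤ → ℤ), HasPerm x M →
      HasPerm x (Function.update M m V) := fun hm M V h i hi => by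
    rw [upd M V hm.symm]; exact h i hi
  obtain ⟨s4, c4, x4, r4, u4, v4, k4⟩ := exec_tableProg r3 2 Term.perm (fun i => x.perm i)
    (fun i _ => fits_natCast (by have := x.perm_le i; omega))
    (fun i _ V _ ρ hρ => Term.eval_perm (keepIn (by norm_num) V hin3)
      (by omega) hρ)
  have hin4 := keep (by norm_num) u4 hin3
  have hp4 : HasPerm x s4.mem := fun i hi => v4 i (by omega)
  obtain ⟨s5, c5, x5, r5, u5, v5, k5⟩ := exec_tableProg r4 3 (Term.valueTable s w)
    (fun i => x.value S W i)
    (fun i _ => fits_natCast ((Instance.value_le (N := N) le_rfl i).trans hNB))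
    (fun i _ V hV ρ hρ => Term.eval_valueTable hd
      (keepIn (by norm_num) V hin4)
      (keepPerm (by norm_num) V hp4) le_rfl
      (fun j hj => by rw [Function.update_self]; exact hV j hj) hρ)
  have hin5 := keep (by norm_num) u5 hin4
  have hp5 : HasPerm x s5.mem := fun i hi => by rw [u5 2 (by norm_num)]; exact hp4 i hi
  obtain ⟨s6, c6, x6, r6, u6, v6, k6⟩ := exec_tableProg r5 4 (Term.backTable s w)
    (fun i => x.back S W N i)
    (fun i _ => fits_natCast ((Instance.back_le i).trans hNB))
    (fun i _ V hV ρ hρ => Term.eval_backTable hd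
      (keepIn (by norm_num) V hin5)
      (keepPerm (by norm_num) V hp5) le_rfl
      (fun j hj => by rw [upd _ _ (by norm_num)]; exact v5 j hj)
      (fun j hj => by rw [Function.update_self]; exact hV j hj) hρ)
  have hin6 := keep (by norm_num) u6 hin5
  have hp6 : HasPerm x s6.mem := fun i hi => by rw [u6 2 (by norm_num)]; exact hp5 i hi
  set T := x.taken S W N with hT
  have hTn : ∀ t ∈ T, t < x.n := fun t ht => (Instance.mem_taken.1 ht).1
  set o := encodeTuples (x.subList T) with ho
  have hcard : (x.subList T).length ≤ x.n := by
    rw [Instance.subList, List.length_map, Finset.length_sort, ← Finset.card_range x.n]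
    exact Finset.card_le_card fun t ht => Finset.mem_range.2 (hTn t ht)
  have hofit : ∀ v ∈ o, Fits B v := by
    refine fits_encodeTuples (l := x.tuples) (fun v hv => hfitB v ?_) (fun t ht => ?_) (by omega)
    · exact List.mem_cons_of_mem _ (List.mem_cons_of_mem _ hv)
    · simp only [Instance.subList, List.mem_map, Finset.mem_sort] at ht
      obtain ⟨i, hi, rfl⟩ := ht
      exact x.tup_mem (x.perm_lt (hTn i hi))
  obtain ⟨s7, c7, x7, r7, u7, v7, k7⟩ := exec_tableProg r6 1 (Term.outTable w)
    (fun i => o.getD i 0) (fun i _ => getD_fits hofit i)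
    (fun i _ V hV ρ hρ => Term.eval_outTable hd
      (keepIn (by norm_num) V hin6) le_rfl
      (fun j hj => by rw [upd _ _ (by norm_num)]; exact v6 j hj)
      (keepPerm (by norm_num) V hp6) hρ)
  have hin7 := keep (by norm_num) u7 hin6
  obtain ⟨s8, c8, x8, a8, v8, k8⟩ := (Term.outLength w).exec_compile hNB 0 s7 r7.reg r7.mem
    r7.slots
  rw [Term.eval_outLength hd hin7 le_rfl
    (fun j hj => by rw [u7 4 (by norm_num)]; exact v6 j hj)] at v8
  refine ⟨s8, o, _, .seq (.copy _ _ _) (.seq x2 (.seq (.copy _ _ _) (.seq x4 (.seq x5 (.seq x6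
    (.seq x7 x8)))))), ⟨v8, fun i hi => ?_⟩, ?_, ?_⟩
  · rw [a8.1]
    refine v7 i (lt_of_lt_of_le hi ?_)
    rw [length_encodeTuples, hN]
    have := Nat.mul_le_mul_right (2 * x.k) hcard
    unfold Instance.bound
    omega
  · have hS : x.base W ^ 13 ≤ N := by
      have := Instance.numStates_le (x := x) (W := W) (N := N) le_rfl
      unfold Instance.numStates at this
      exact this
    obtain ⟨hm, hmax⟩ := Scheme.taken_spec hv hS
    exact x.isAnswer_subList α hTn hm hmax
  · rw [Polynomial.eval_comp, ← hB, h0]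
    have e2 : s2.reg 1 = (N : ℤ) := v2
    rw [e2]
    have b1 : bitLen (L : ℤ) ≤ B + 1 := (fits_natCast (by omega)).bitLen_le
    have b2 : bitLen (N : ℤ) ≤ B + 1 := (fits_natCast hNB).bitLen_le
    rw [eval_repairCost]
    clear_value B N
    omega

theorem solvableInPolyTime {α : Agg} {s : SchemeTerm} {w : Term} {D : Set Instance}
    {size : Instance → ℕ} (S : Instance → Scheme) (W : Instance → ℕ)
    (hd : ∀ x ∈ D, Describes x s w (S x) (W x))
    (hv : ∀ x ∈ D, (S x).Valid x.cols α (x.base (W x)))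
    (hfit : ∀ x ∈ D, ∀ v ∈ x.encode, Fits (size x) v)
    (hlen : ∀ x ∈ D, x.encode.length ≤ 2 * size x) (hW : ∀ x ∈ D, W x ≤ size x) :
    SolvableInPolyTime D Instance.encode size (Instance.IsAnswer α) :=
  ⟨repairProgram s w, (repairCost s w).comp parameterBound, fun x hx =>
    Exec.repairProgram (hd x hx) (hv x hx) (hfit x hx) (hlen x hx) (hW x hx)⟩

/-- With `W = 0` the base is `2 * x.n + 2`, so the number of states depends only on the number of
tuples. -/
theorem solvable_binary {α : Agg} {s : SchemeTerm} (S : Instance → Scheme)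
    (hd : ∀ x N M, HasInput x M → HasPerm x M → s.Represents (S x) x.n N M)
    (hv : ∀ x : Instance, ∀ D, 2 * x.n + 2 ≤ D → (S x).Valid x.cols α D) :
    SolvableInPolyTime Set.univ Instance.encode Instance.binarySize (Instance.IsAnswer α) := by
  refine solvableInPolyTime (s := s) (w := .lit 0) S (fun _ => 0)
    (fun x _ => ⟨fun _ _ _ _ _ => rfl, fun N M h hp _ => hd x N M h hp⟩)
    (fun x _ => hv x _ (by simp [Instance.base])) (fun x _ v hv => ?_) (fun x _ => ?_)
    (fun _ _ => Nat.zero_le _)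
  · exact fits_of_bitLen_le (List.single_le_sum (fun _ _ => Nat.zero_le _) _
      (List.mem_map_of_mem hv))
  · have : ∀ l : List ℤ, l.length ≤ (l.map bitLen).sum := fun l => by
      have := List.card_nsmul_le_sum (l.map bitLen) 1 fun b hb => by
        obtain ⟨z, _, rfl⟩ := List.mem_map.1 hb
        exact Nat.succ_le_succ (Nat.zero_le _)
      simpa using this
    have := this x.encode
    unfold Instance.binarySize
    omega

/-! ### Input length with column `A` in unary. -/

theorem sum_range_getD {α : Type*} (l : List α) (d : α) (f : α → ℕ) :
    ∑ u ∈ Finset.range l.length, f (l.getD u d) = (l.map f).sum := by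
  induction l with
  | nil => simp
  | cons a l ih =>
    rw [List.length_cons, Finset.sum_range_succ', List.map_cons, List.sum_cons, ← ih, add_comm]
    simp

/-- The length of a tuple with the entry in column `A` in unary. -/
def unaryTupleSize (x : Instance) (t : Tuple x.k) : ℕ :=
  ∑ j : Fin x.k, if j = x.A then (t j).num.natAbs + 1
    else bitLen (t j).num + bitLen ((t j).den : ℤ)

theorem arity_le_unaryTupleSize (x : Instance) (t : Tuple x.k) : x.k ≤ unaryTupleSize x t := by
  have := Finset.card_nsmul_le_sum Finset.univ (fun j : Fin x.k => if j = x.A then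
    (t j).num.natAbs + 1 else bitLen (t j).num + bitLen ((t j).den : ℤ)) 1 fun j _ => by
      simp only [bitLen]; split_ifs <;> omega
  simpa [unaryTupleSize] using this

theorem entry_le_unaryTupleSize (x : Instance) (t : Tuple x.k) (j : Fin x.k) :
    (if j = x.A then (t j).num.natAbs + 1
      else bitLen (t j).num + bitLen ((t j).den : ℤ)) ≤ unaryTupleSize x t :=
  Finset.single_le_sum (f := fun j : Fin x.k => if j = x.A then (t j).num.natAbs + 1
    else bitLen (t j).num + bitLen ((t j).den : ℤ)) (fun _ _ => Nat.zero_le _) (Finset.mem_univ j)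

theorem unarySize_eq (x : Instance) : x.unarySize = bitLen ((x.G : ℕ) : ℤ) +
    bitLen ((x.A : ℕ) : ℤ) + bitLen (x.k : ℤ) + bitLen (x.tuples.length : ℤ) +
    (x.tuples.map (unaryTupleSize x)).sum := rfl

theorem unaryTupleSize_le {x : Instance} {t : Tuple x.k} (ht : t ∈ x.tuples) :
    unaryTupleSize x t ≤ x.unarySize := by
  have := List.single_le_sum (l := x.tuples.map (unaryTupleSize x)) (fun _ _ => Nat.zero_le _) _
    (List.mem_map_of_mem ht)
  rw [unarySize_eq]
  omega

theorem fits_unarySize {x : Instance} (hx : x.IntegerColumn) :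
    ∀ v ∈ x.encode, Fits x.unarySize v := by
  have hu := unarySize_eq x
  intro v hv
  simp only [Instance.encode, encodeTuples, List.mem_cons, List.mem_flatMap, encodeTuple,
    encodeRat, List.not_mem_nil, or_false] at hv
  rcases hv with rfl | rfl | rfl | rfl | ⟨t, ht, q, hq, hv⟩
  · exact fits_of_bitLen_le (by omega)
  · exact fits_of_bitLen_le (by omega)
  · exact fits_of_bitLen_le (by omega)
  · exact fits_of_bitLen_le (by omega)
  · obtain ⟨j, rfl⟩ := List.mem_ofFn.1 hq
    have h1 := entry_le_unaryTupleSize x t j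
    have h2 := unaryTupleSize_le ht
    split_ifs at h1 with hj
    · subst hj
      obtain ⟨z, hz⟩ := hx t ht
      rcases hv with rfl | rfl
      · exact (show Fits (t x.A).num.natAbs _ from Nat.lt_two_pow_self).mono (by omega)
      · rw [hz, Rat.den_intCast]
        exact fits_natCast (by omega)
    · rcases hv with rfl | rfl
      · exact fits_of_bitLen_le (by omega)
      · exact fits_of_bitLen_le (by omega)

/-- The factor two is due to column `A`: an entry there fills two cells, but a zero contributes only
one to the length. -/
theorem length_encode_le_unarySize (x : Instance) : x.encode.length ≤ 2 * x.unarySize := by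
  have h1 := List.card_nsmul_le_sum (x.tuples.map (unaryTupleSize x)) x.k fun b hb => by
    obtain ⟨t, _, rfl⟩ := List.mem_map.1 hb
    exact arity_le_unaryTupleSize x t
  rw [List.length_map, smul_eq_mul] at h1
  have h2 : ∀ z : ℤ, 1 ≤ bitLen z := fun z => Nat.succ_le_succ (Nat.zero_le _)
  have h3 := h2 ((x.G : ℕ) : ℤ)
  have h4 := h2 ((x.A : ℕ) : ℤ)
  rw [unarySize_eq, x.length_encode, Instance.n, mul_left_comm]
  omega

theorem absSum_le_unarySize (x : Instance) : x.absSum ≤ x.unarySize := by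
  have h1 : x.absSum = (x.tuples.map fun t => (t x.A).num.natAbs).sum :=
    sum_range_getD x.tuples 0 fun t => (t x.A).num.natAbs
  have h2 : (x.tuples.map fun t => (t x.A).num.natAbs).sum ≤
      (x.tuples.map (unaryTupleSize x)).sum := List.sum_le_sum fun t _ => by
    have := entry_le_unaryTupleSize x t x.A
    rw [if_pos rfl] at this
    omega
  rw [h1, unarySize_eq]
  omega

/-- The sum of the absolute values in column `A` bounds each of them, is given by an expression, and
is at most the unary length. -/
theorem solvable_unary {α : Agg} {s : SchemeTerm} (S : Instance → Scheme)
    (hd : ∀ x N M, HasInput x M → HasPerm x M → x.n ≤ N → s.Represents (S x) x.n N M)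
    (hv : ∀ x : Instance, x.IntegerColumn → (S x).Valid x.cols α (x.base x.absSum)) :
    SolvableInPolyTime {x : Instance | x.IntegerColumn} Instance.encode Instance.unarySize
      (Instance.IsAnswer α) :=
  solvableInPolyTime (s := s) (w := Term.absSum) S Instance.absSum
    (fun x _ => ⟨fun _ _ _ h hn => Term.eval_absSum h hn, fun N M h hp hn => hd x N M h hp hn⟩)
    (fun x hx => hv x hx) (fun _ hx => fits_unarySize hx)
    (fun x _ => length_encode_le_unarySize x) (fun x _ => absSum_le_unarySize x)

end AODRepair

theorem theorem1 :
    (∀ α ∈ ({.max, .min, .count, .countd, .median} : Set AODRepair.Agg),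
      AODRepair.SolvableInPolyTime Set.univ AODRepair.Instance.encode
        AODRepair.Instance.binarySize (AODRepair.Instance.IsAnswer α)) ∧
    (∀ α ∈ ({.sum, .avg} : Set AODRepair.Agg),
      AODRepair.SolvableInPolyTime {x : AODRepair.Instance | x.IntegerColumn}
        AODRepair.Instance.encode AODRepair.Instance.unarySize
        (AODRepair.Instance.IsAnswer α)) := by
  constructor
  · rintro α (rfl | rfl | rfl | rfl | rfl)
    · exact AODRepair.solvable_binary (fun x => AODRepair.Scheme.maxScheme x.cols)
        (fun _ _ _ => AODRepair.SchemeTerm.represents_max) fun _ _ hD =>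
          AODRepair.Scheme.valid_max hD
    · exact AODRepair.solvable_binary (fun x => AODRepair.Scheme.minScheme x.cols)
        (fun _ _ _ => AODRepair.SchemeTerm.represents_min) fun _ _ hD =>
          AODRepair.Scheme.valid_min hD
    · exact AODRepair.solvable_binary (fun _ => AODRepair.Scheme.countScheme)
        (fun _ _ _ _ _ => AODRepair.SchemeTerm.represents_count) fun _ _ hD =>
          AODRepair.Scheme.valid_count hD
    · exact AODRepair.solvable_binary (fun x => AODRepair.Scheme.countdScheme x.cols)
        (fun _ _ _ => AODRepair.SchemeTerm.represents_countd) fun _ _ hD =>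
          AODRepair.Scheme.valid_countd hD
    · exact AODRepair.solvable_binary (fun x => AODRepair.Scheme.medianScheme x.cols)
        (fun _ _ _ => AODRepair.SchemeTerm.represents_median) fun _ _ hD =>
          AODRepair.Scheme.valid_median hD
  · rintro α (rfl | rfl)
    · exact AODRepair.solvable_unary (fun x => AODRepair.Scheme.sumScheme x.intCol x.absSum)
        (fun _ _ _ => AODRepair.SchemeTerm.represents_sum) fun x hx =>
          AODRepair.Scheme.valid_sum (fun _ => AODRepair.Instance.cols_a_eq hx)
            (fun _ => x.natAbs_intCol_le) le_rfl
    · exact AODRepair.solvable_unary (fun x => AODRepair.Scheme.avgScheme x.intCol x.absSum)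
        (fun _ _ _ => AODRepair.SchemeTerm.represents_avg) fun x hx =>
          AODRepair.Scheme.valid_avg (fun _ => AODRepair.Instance.cols_a_eq hx)
            (fun _ => x.natAbs_intCol_le) le_rfl
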